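/- **Setting.** Let $n\ge 2$ and let $\mathcal O\mapsto\mathfrak A(\mathcal O)$ be a net of von Neumann algebras on a Hilbert space $\mathcal H$, indexed by the bounded open regions of $(1+n)$-dimensional Minkowski space, with a strongly continuous unitary representation $U$ of the proper orthochronous Poincaré group and an invariant unit vector $\Omega$, satisfying isotony, locality, covariance, the spectrum condition (joint spectrum of the translation generators in the closed forward light cone) and uniqueness of the vacuum. Let $U(t)=e^{itH}$ be the time translations, $H\ge 0$, $R=(1+H)^{-1}$, and $P(E)$ the spectral projector of $H$ for $[0,E]$. Let $\Sigma$ be the space of ultraweakly continuous functionals on $B(\mathcal H)$, $\|\sigma\|_\ell=\|\sigma((1+H)^\ell\,\cdot\,(1+H)^\ell)\|$, and $C^\infty(\Sigma)=\{\sigma\in\Sigma:\|\sigma\|_\ell<\infty\ \forall \ell>0\}$ with the Fréchet topology of these norms; its dual $C^\infty(\Sigma)^*$ has the weak* topology, the dual norms $\|\cdot\|_{-\ell}$, and the conjugation $\phi^*(\sigma)=\overline{\phi(\sigma^*)}$, $\sigma^*(A)=\overline{\sigma(A^*)}$. Its elements are viewed as quadratic forms on $C^\infty(H)=\bigcap_{\ell>0}R^\ell\mathcal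 H$. Assume the microscopic phase space condition: for each $\gamma\ge0$ there is a continuous linear finite-rank map $\psi:C^\infty(\Sigma)\to\Sigma$ such that for all sufficiently large $\ell$, $r^{-\gamma}\sup\{|(\sigma-\psi(\sigma))(A)| : \|\sigma\|_\ell\le1,\ A\in\mathfrak A(\mathcal O_r),\ \|A\|\le1\}\to0$ as $r\to0$, where $\mathcal O_r$ is the double cone of radius $r$ about the origin. Let $\Phi_\gamma$ be the image of $\psi^*:\Sigma^*\to C^\infty(\Sigma)^*$ for $\psi$ of minimal rank, and $\Phi_{\mathrm{FH}}=\bigcup_{\gamma\ge 0}\Phi_\gamma$ the set of pointlike fields. Let $\mathcal K$ be the space of analytic functions $K$ on the open lower half plane with $\sup_{-1\le\operatorname{Im}z<0}|K(z)||\operatorname{Im}z|^{\ell}<\infty$ for some $\ell>0$. Put $g_1\diamond g_2(s,s')=g_1(s+s'/2)\,g_2(s-s'/2)$, and let $\mathcal K_+\subset\mathcal K$ consist of the $K$ of positive type, i.e. $\int ds\,ds'\,K(s'-i0)\,\bar g\diamond g(s,s')\ge0$ for all $g\in\mathcal S(\mathbb R)$. To $\Pi=\sum_jK_j\otimes\phi_j\otimes\phi_j'\in\mathcal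 K\otimes C^\infty(\Sigma)^*\otimes C^\infty(\Sigma)^*$ (a finite sum) there belongs a unique $C^\infty(\Sigma)^*$-valued distribution $\Pi(s')$ on $\mathbb R$ (of finite order, locally with values in one space $\{\|\cdot\|_{-\ell}<\infty\}$) with $$\sigma(\Pi(f))=\sum_j\lim_{y\to0+}\int ds'\,f(s')\,K_j(s'-iy)\,F_j(s'-iy),\qquad F_j(z)=\sigma\big(e^{izH/2}\phi_j e^{-izH}\phi_j'e^{izH/2}\big),$$ for all $f\in\mathcal D(\mathbb R)$ and all functionals of the form $\sigma=\tau(P(E)\,\cdot\,P(E))$, $\tau\in\Sigma$, $E>0$. For a $C^\infty(\Sigma)^*$-valued distribution $T$ put $$\mathcal I_{g_1,g_2}(T)=\int ds\,U(s)\Big[\int ds'\,g_1\diamond g_2(s,s')\,T(s')\Big]U(s)^*$$ (weak integral), and let $\|g\|_{d,m}=\max_{0\le k\le m}d^k\|g^{(k)}\|_{L^1}$. For $\alpha\ge0$, an *$\alpha$-approximating projector* for $\Pi$ is a weak*-continuous linear projector $p$ in $C^\infty(\Sigma)^*$ with $p(\phi^*)=p(\phi)^*$ and with finite-dimensional image contained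 in $\Phi_{\mathrm{FH}}$, such that for some $\ell>0$, $m\in\mathbb N$, $$\sup\big\{\|\mathcal I_{g_1,g_2}(\Pi-p\Pi)\|_{-\ell} : g_1,g_2\in\mathcal D(-d,d),\ \|g_1\|_{d,m},\|g_2\|_{d,m}\le1\big\}=o(d^\alpha)\quad(d\to0).$$ **Theorem (quantum inequality).** Let $\Pi=\sum_jK_j\otimes\phi_j^*\otimes\phi_j$ be a finite sum with $K_j\in\mathcal K_+$ and $\phi_j\in\Phi_{\mathrm{FH}}$, let $\alpha\ge0$, and let $p$ be an $\alpha$-approximating projector for $\Pi$. Then there are $\ell>0$, $m\in\mathbb N$ and a function $\epsilon:(0,\infty)\to(0,\infty)$ with $\epsilon(d)=o(d^\alpha)$ as $d\to0$ such that for all $d>0$ and $g\in\mathcal D(-d,d)$, the form $R^\ell\,\mathcal I_{\bar g,g}(p\Pi)\,R^\ell$ is a bounded operator and $$R^\ell\,\mathcal I_{\bar g,g}(p\Pi)\,R^\ell\ \ge\ -\epsilon(d)\,\|g\|_{d,m}^2\,\mathbf 1 .$$ Moreover, with the same $\ell,m,\epsilon$: whenever $p=\sum_{j=1}^q\sigma_j(\,\cdot\,)\,\phi_j$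 with hermitean $\sigma_j\in C^\infty(\Sigma)$ and hermitean $\phi_j\in\Phi_{\mathrm{FH}}$ (not the fields in the definition of $\Pi$), $\sigma_j(\phi_k)=\delta_{jk}$, the functions $f_j(s)=\int ds'\,\bar g\diamond g(s,s')\,\sigma_j(\Pi(s'))$ are real-valued elements of $\mathcal D(-d,d)$, and with $\phi_j(f_j)=\int dt\,f_j(t)\,U(t)\phi_jU(t)^*$ one has $$\sum_{j=1}^q\phi_j(f_j)\ \ge\ -\epsilon(d)\,\|g\|_{d,m}^2\,(1+H)^{2\ell}$$ as quadratic forms on $C^\infty(H)$. -/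

import Mathlib

open scoped InnerProductSpace Distributions ContDiff TensorProduct ComplexConjugate Topology
open MeasureTheory Filter

noncomputable section

set_option linter.unusedSectionVars false

namespace QI

/-! ### Minkowski space and the Poincaré group -/

/-- Minkowski space of dimension `1 + n`: a time coordinate and `n` space coordinates. -/
abbrev Minkowski (n : ℕ) : Type := ℝ × EuclideanSpace ℝ (Fin n)

/-- The Lorentz square `t² - |x|²`. -/
def lorentzSq {n : ℕ} (x : Minkowski n) : ℝ := x.1 ^ 2 - ‖x.2‖ ^ 2

/-- The closed forward light cone. -/
def forwardCone (n : ℕ) : Set (Minkowski n) := {x | ‖x.2‖ ≤ x.1}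

/-- The proper orthochronous Lorentz group: linear maps that preserve the Lorentz square, have
determinant one, and map the closed forward cone into itself (it inherits its topology from the
space of linear maps). -/
def Lorentz (n : ℕ) : Submonoid (Minkowski n →L[ℝ] Minkowski n) where
  carrier := {Λ | (∀ x, lorentzSq (Λ x) = lorentzSq x) ∧ Λ.det = 1 ∧
    ∀ x ∈ forwardCone n, Λ x ∈ forwardCone n}
  one_mem' := ⟨fun _ => rfl, by simp [ContinuousLinearMap.det], fun _ hx => hx⟩
  mul_mem' := by
    rintro A B ⟨hA, hA', hA''⟩ ⟨hB, hB', hB''⟩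
    refine ⟨fun x => (hA (B x)).trans (hB x), ?_, fun x hx => hA'' _ (hB'' x hx)⟩
    simp only [ContinuousLinearMap.det] at hA' hB' ⊢
    have : ((A * B : Minkowski n →L[ℝ] Minkowski n) : Minkowski n →ₗ[ℝ] Minkowski n) =
        (A : Minkowski n →ₗ[ℝ] Minkowski n) * (B : Minkowski n →ₗ[ℝ] Minkowski n) := rfl
    rw [this, map_mul, hA', hB', one_mul]

/-- Bounded open regions of Minkowski space. -/
def Region (n : ℕ) : Type := {O : Set (Minkowski n) // IsOpen O ∧ Bornology.IsBounded O}

/-- Spacelike separation of two regions. -/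
def Region.Spacelike {n : ℕ} (O₁ O₂ : Region n) : Prop :=
  ∀ x ∈ O₁.1, ∀ y ∈ O₂.1, lorentzSq (x - y) < 0

/-- The standard double cone of radius `r` centred at the origin. -/
def doubleCone (n : ℕ) (r : ℝ) : Region n :=
  ⟨{x | |x.1| + ‖x.2‖ < r}, isOpen_lt (by fun_prop) continuous_const, by
    refine (Metric.isBounded_ball (x := (0 : Minkowski n)) (r := r)).subset fun x hx => ?_
    have hx' : |x.1| + ‖x.2‖ < r := hx
    rw [mem_ball_zero_iff, Prod.norm_def, max_lt_iff, Real.norm_eq_abs]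
    constructor <;> linarith [abs_nonneg x.1, norm_nonneg x.2]⟩

/-! ### Local nets of von Neumann algebras in the vacuum sector -/

variable {n : ℕ} {𝓗 : Type*} [NormedAddCommGroup 𝓗] [InnerProductSpace ℂ 𝓗] [CompleteSpace 𝓗]

variable (n 𝓗) in
/-- A local net of von Neumann algebras in the vacuum sector, on `(1+n)`-dimensional Minkowski
space, with a strongly continuous unitary representation of the proper orthochronous Poincaré
group, subject to isotony, locality, covariance, positivity of the energy and uniqueness of the
vacuum. -/
structure LocalNet where
  /-- the algebra of observables measurable in a bounded open region -/
  alg : Region n → VonNeumannAlgebra 𝓗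
  /-- the representation of the Poincaré group, `U a Λ` being the action of `x ↦ Λ x + a` -/
  U : Minkowski n → Lorentz n → unitary (𝓗 →L[ℂ] 𝓗)
  U_one : U 0 1 = 1
  U_mul : ∀ a b Λ M, U a Λ * U b M = U (a + (Λ : Minkowski n →L[ℝ] Minkowski n) b) (Λ * M)
  U_continuous : ∀ x : 𝓗, Continuous fun q : Minkowski n × Lorentz n =>
    (U q.1 q.2 : 𝓗 →L[ℂ] 𝓗) x
  /-- the vacuum vector -/
  vacuum : 𝓗
  vacuum_norm : ‖vacuum‖ = 1
  vacuum_invariant : ∀ a Λ, (U a Λ : 𝓗 →L[ℂ] 𝓗) vacuum = vacuum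
  isotony : ∀ O₁ O₂ : Region n, O₁.1 ⊆ O₂.1 → ∀ A, A ∈ alg O₁ → A ∈ alg O₂
  locality : ∀ O₁ O₂ : Region n, O₁.Spacelike O₂ → ∀ A₁ ∈ alg O₁, ∀ A₂ ∈ alg O₂,
    A₁ * A₂ = A₂ * A₁
  covariance : ∀ a (Λ : Lorentz n) (O O' : Region n),
    O'.1 = (fun x => (Λ : Minkowski n →L[ℝ] Minkowski n) x + a) '' O.1 → ∀ A : 𝓗 →L[ℂ] 𝓗,
      A ∈ alg O ↔ (U a Λ : 𝓗 →L[ℂ] 𝓗) * A * star (U a Λ : 𝓗 →L[ℂ] 𝓗) ∈ alg O'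
  /-- With `U(x) = exp(i P·x)`, the joint spectrum of `P` lies in the closed forward cone. As that
  cone is closed, convex and self-dual, this says that `P·a ≥ 0` for each of its points `a`; the
  operator `P·a` maps `x` to `y` if `d/dt U(t a) x = i y` at `t = 0`. -/
  positiveEnergy : ∀ a ∈ forwardCone n, ∀ x y : 𝓗,
    HasDerivAt (fun t : ℝ => (U (t • a) 1 : 𝓗 →L[ℂ] 𝓗) x) (Complex.I • y) 0 → 0 ≤ (⟪x, y⟫_ℂ).re
  vacuum_unique : ∀ x : 𝓗, (∀ a, (U a 1 : 𝓗 →L[ℂ] 𝓗) x = x) → ∃ c : ℂ, x = c • vacuum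

/-! ### Ultraweakly continuous functionals -/

variable (𝓗) in
/-- The ultraweak topology of `B(𝓗)`: the coarsest topology for which all the functionals
`A ↦ ∑ ⟪xₖ, A yₖ⟫`, with square-summable sequences `x`, `y` in `𝓗`, are continuous. -/
abbrev ultraweak : TopologicalSpace (𝓗 →L[ℂ] 𝓗) :=
  ⨅ (x : ℕ → 𝓗) (y : ℕ → 𝓗) (_ : Summable fun k => ‖x k‖ ^ 2) (_ : Summable fun k => ‖y k‖ ^ 2),
    TopologicalSpace.induced (fun A : 𝓗 →L[ℂ] 𝓗 => ∑' k, ⟪x k, A (y k)⟫_ℂ) inferInstance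

theorem ultraweak_continuous_basic {x y : ℕ → 𝓗} (hx : Summable fun k => ‖x k‖ ^ 2)
    (hy : Summable fun k => ‖y k‖ ^ 2) :
    Continuous[ultraweak 𝓗, inferInstance] fun A : 𝓗 →L[ℂ] 𝓗 => ∑' k, ⟪x k, A (y k)⟫_ℂ := by
  refine continuous_iff_le_induced.2 ?_
  exact (iInf_le _ x).trans ((iInf_le _ y).trans ((iInf_le _ hx).trans (iInf_le _ hy)))

theorem ultraweak_continuous_rng (F : (𝓗 →L[ℂ] 𝓗) → (𝓗 →L[ℂ] 𝓗))
    (hF : ∀ x y : ℕ → 𝓗, (Summable fun k => ‖x k‖ ^ 2) → (Summable fun k => ‖y k‖ ^ 2) →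
      Continuous[ultraweak 𝓗, inferInstance] fun A => ∑' k, ⟪x k, F A (y k)⟫_ℂ) :
    Continuous[ultraweak 𝓗, ultraweak 𝓗] F := by
  refine continuous_iInf_rng.2 fun x => continuous_iInf_rng.2 fun y =>
    continuous_iInf_rng.2 fun hx => continuous_iInf_rng.2 fun hy => ?_
  exact continuous_induced_rng.2 (hF x y hx hy)

theorem summable_sq_apply (C : 𝓗 →L[ℂ] 𝓗) {x : ℕ → 𝓗} (hx : Summable fun k => ‖x k‖ ^ 2) :
    Summable fun k => ‖C (x k)‖ ^ 2 := by
  refine Summable.of_nonneg_of_le (fun k => by positivity) (fun k => ?_) (hx.mul_left (‖C‖ ^ 2))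
  rw [← mul_pow]
  gcongr
  exact C.le_opNorm _

theorem ultraweak_continuous_mul (C D : 𝓗 →L[ℂ] 𝓗) :
    Continuous[ultraweak 𝓗, ultraweak 𝓗] fun A => C * A * D := by
  refine ultraweak_continuous_rng _ fun x y hx hy => ?_
  have := ultraweak_continuous_basic (summable_sq_apply (star C) hx) (summable_sq_apply D hy)
  convert this using 4 with A k
  rw [ContinuousLinearMap.star_eq_adjoint, ContinuousLinearMap.adjoint_inner_left]
  rfl

theorem ultraweak_continuous_star :
    Continuous[ultraweak 𝓗, ultraweak 𝓗] fun A : 𝓗 →L[ℂ] 𝓗 => star A := by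
  refine ultraweak_continuous_rng _ fun x y hx hy => ?_
  have := @Continuous.comp _ _ _ (ultraweak 𝓗) _ _ _ _ Complex.continuous_conj
    (ultraweak_continuous_basic hy hx)
  convert! this using 2 with A
  simp only [Function.comp_apply]
  rw [Complex.conj_tsum]
  refine tsum_congr fun k => ?_
  rw [ContinuousLinearMap.star_eq_adjoint, ContinuousLinearMap.adjoint_inner_right,
    inner_conj_symm]

variable (𝓗) in
/-- `Σ`, the space of ultraweakly continuous linear functionals on `B(𝓗)`. -/
def NormalFunctional : Submodule ℂ (StrongDual ℂ (𝓗 →L[ℂ] 𝓗)) where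
  carrier := {σ | Continuous[ultraweak 𝓗, inferInstance] σ}
  zero_mem' := @continuous_const _ _ (ultraweak 𝓗) _ 0
  add_mem' := fun ha hb => @Continuous.add _ _ _ _ _ (ultraweak 𝓗) _ _ ha hb
  smul_mem' := fun c σ ha => @Continuous.comp _ _ _ (ultraweak 𝓗) _ _ σ (fun z : ℂ => c • z)
    (continuous_const_smul c) ha

/-- The functional `A ↦ ⟪u, A v⟫`. -/
def vectorFunctional (u v : 𝓗) : StrongDual ℂ (𝓗 →L[ℂ] 𝓗) :=
  (innerSL ℂ u).comp (ContinuousLinearMap.apply ℂ 𝓗 v)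

theorem vectorFunctional_apply (u v : 𝓗) (A : 𝓗 →L[ℂ] 𝓗) :
    vectorFunctional u v A = ⟪u, A v⟫_ℂ := rfl

theorem vectorFunctional_mem (u v : 𝓗) : vectorFunctional u v ∈ NormalFunctional 𝓗 := by
  have hs : ∀ w : 𝓗, Summable fun k : ℕ => ‖(if k = 0 then w else 0 : 𝓗)‖ ^ 2 := fun w =>
    summable_of_ne_finset_zero (s := {0}) fun k hk => by
      rw [if_neg (by simpa using hk)]; simp
  have := ultraweak_continuous_basic (hs u) (hs v)
  change Continuous[ultraweak 𝓗, inferInstance] fun A : 𝓗 →L[ℂ] 𝓗 => ⟪u, A v⟫_ℂ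
  convert this using 2 with A
  rw [tsum_eq_single 0 fun k hk => by simp [hk]]
  simp

/-- The hermitean conjugate `σ*(A) = conj (σ (A*))` of a functional. -/
def conjFunctional (σ : StrongDual ℂ (𝓗 →L[ℂ] 𝓗)) : StrongDual ℂ (𝓗 →L[ℂ] 𝓗) where
  toFun A := conj (σ (star A))
  map_add' A B := by simp
  map_smul' c A := by simp
  cont := Complex.continuous_conj.comp (σ.continuous.comp continuous_star)

theorem conjFunctional_apply (σ : StrongDual ℂ (𝓗 →L[ℂ] 𝓗)) (A : 𝓗 →L[ℂ] 𝓗) :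
    conjFunctional σ A = conj (σ (star A)) := rfl

theorem conjFunctional_mem {σ : StrongDual ℂ (𝓗 →L[ℂ] 𝓗)} (h : σ ∈ NormalFunctional 𝓗) :
    conjFunctional σ ∈ NormalFunctional 𝓗 :=
  @Continuous.comp _ _ _ (ultraweak 𝓗) _ _ (fun A => σ (star A)) (fun z : ℂ => conj z)
    Complex.continuous_conj
    (@Continuous.comp _ _ _ (ultraweak 𝓗) (ultraweak 𝓗) _ (fun A : 𝓗 →L[ℂ] 𝓗 => star A) σ h
      ultraweak_continuous_star)

/-- The functional `A ↦ σ (C A D)`. -/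
def sandwichFunctional (C D : 𝓗 →L[ℂ] 𝓗) (σ : StrongDual ℂ (𝓗 →L[ℂ] 𝓗)) :
    StrongDual ℂ (𝓗 →L[ℂ] 𝓗) where
  toFun A := σ (C * A * D)
  map_add' A B := by simp [mul_add, add_mul]
  map_smul' c A := by simp
  cont := σ.continuous.comp (by fun_prop)

theorem sandwichFunctional_apply (C D : 𝓗 →L[ℂ] 𝓗) (σ : StrongDual ℂ (𝓗 →L[ℂ] 𝓗))
    (A : 𝓗 →L[ℂ] 𝓗) : sandwichFunctional C D σ A = σ (C * A * D) := rfl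

theorem sandwichFunctional_mem (C D : 𝓗 →L[ℂ] 𝓗) {σ : StrongDual ℂ (𝓗 →L[ℂ] 𝓗)}
    (h : σ ∈ NormalFunctional 𝓗) : sandwichFunctional C D σ ∈ NormalFunctional 𝓗 :=
  @Continuous.comp _ _ _ (ultraweak 𝓗) (ultraweak 𝓗) _ (fun A : 𝓗 →L[ℂ] 𝓗 => C * A * D) σ h
    (ultraweak_continuous_mul C D)

namespace LocalNet

variable (N : LocalNet n 𝓗)

/-! ### The Hamiltonian -/

/-- The time translations `U(t)`. -/
def timeU (t : ℝ) : 𝓗 →L[ℂ] 𝓗 := (N.U (t, 0) 1 : 𝓗 →L[ℂ] 𝓗)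

theorem timeU_mul (s t : ℝ) : N.timeU s * N.timeU t = N.timeU (s + t) := by
  have := congrArg (fun V : unitary (𝓗 →L[ℂ] 𝓗) => (V : 𝓗 →L[ℂ] 𝓗))
    (N.U_mul (s, 0) (t, 0) 1 1)
  simpa [timeU] using this

theorem star_timeU_mul (t : ℝ) : star (N.timeU t) * N.timeU t = 1 :=
  Unitary.coe_star_mul_self (N.U (t, 0) 1)

theorem timeU_mul_star (t : ℝ) : N.timeU t * star (N.timeU t) = 1 :=
  Unitary.coe_mul_star_self (N.U (t, 0) 1)

/-- The Hamiltonian `H`, generator of `U(t) = exp(itH)`: its domain consists of the vectors `x` for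
which `t ↦ U(t) x` is differentiable at `0`, and `H x = -i d/dt U(t) x` at `t = 0`. -/
def hamiltonian : 𝓗 →ₗ.[ℂ] 𝓗 where
  domain :=
    { carrier := {x | DifferentiableAt ℝ (fun t : ℝ => N.timeU t x) 0}
      zero_mem' := by simp
      add_mem' := fun {a b} ha hb => by
        have : (fun t : ℝ => N.timeU t (a + b)) =
            (fun t : ℝ => N.timeU t a) + fun t : ℝ => N.timeU t b := by
          ext t
          simp
        change DifferentiableAt ℝ (fun t : ℝ => N.timeU t (a + b)) 0
        rw [this]
        exact DifferentiableAt.add ha hb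
      smul_mem' := fun c x ha => by
        have : (fun t : ℝ => N.timeU t (c • x)) = c • fun t : ℝ => N.timeU t x := by
          ext t
          simp
        change DifferentiableAt ℝ (fun t : ℝ => N.timeU t (c • x)) 0
        rw [this]
        exact DifferentiableAt.const_smul ha c }
  toFun :=
    { toFun := fun x => -Complex.I • deriv (fun t : ℝ => N.timeU t (x : 𝓗)) 0
      map_add' := fun x y => by
        have := (x.2.hasDerivAt.add y.2.hasDerivAt).deriv
        rw [← smul_add, ← this]
        congr 2
        ext t
        simp
      map_smul' := fun c x => by
        have := (x.2.hasDerivAt.const_smul c).deriv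
        rw [RingHom.id_apply, smul_comm c, ← this]
        congr 2
        ext t
        simp }

/-- `R` is the inverse of `1 + H`. -/
def IsResolvent (R : 𝓗 →L[ℂ] 𝓗) : Prop :=
  ∀ x y : 𝓗, R y = x ↔ ∃ h : x ∈ N.hamiltonian.domain, x + N.hamiltonian ⟨x, h⟩ = y

open scoped Classical in
/-- `R = (1 + H)⁻¹`. -/
def resolvent : 𝓗 →L[ℂ] 𝓗 := if h : ∃ R, N.IsResolvent R then h.choose else 0

/-- `R^ℓ = (1 + H)^(-ℓ)`, for real `ℓ`. -/
def Rpow (ℓ : ℝ) : 𝓗 →L[ℂ] 𝓗 := N.resolvent ^ ℓ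

theorem star_Rpow (ℓ : ℝ) : star (N.Rpow ℓ) = N.Rpow ℓ :=
  (IsSelfAdjoint.of_nonneg (CFC.rpow_nonneg (a := N.resolvent) (y := ℓ))).star_eq

theorem hamiltonian_timeU (t : ℝ) {x : 𝓗} (h : x ∈ N.hamiltonian.domain) :
    ∃ h' : N.timeU t x ∈ N.hamiltonian.domain,
      N.hamiltonian ⟨N.timeU t x, h'⟩ = N.timeU t (N.hamiltonian ⟨x, h⟩) := by
  have hd : HasDerivAt (fun s : ℝ => N.timeU s (N.timeU t x))
      (N.timeU t (deriv (fun s : ℝ => N.timeU s x) 0)) 0 := by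
    have h0 : HasDerivAt (fun s : ℝ => N.timeU s x) (deriv (fun s : ℝ => N.timeU s x) 0) 0 :=
      DifferentiableAt.hasDerivAt h
    have h1 := ((N.timeU t).restrictScalars ℝ).hasFDerivAt.comp_hasDerivAt (0 : ℝ) h0
    refine h1.congr_of_eventuallyEq (Eventually.of_forall fun s => ?_)
    change (N.timeU s * N.timeU t) x = (N.timeU t * N.timeU s) x
    rw [timeU_mul, timeU_mul, add_comm]
  refine ⟨hd.differentiableAt, ?_⟩
  change -Complex.I • deriv (fun s : ℝ => N.timeU s (N.timeU t x)) 0 =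
    N.timeU t (-Complex.I • deriv (fun s : ℝ => N.timeU s x) 0)
  rw [hd.deriv, map_smul]

theorem commute_timeU_resolvent (t : ℝ) : Commute N.resolvent (N.timeU t) := by
  unfold resolvent
  split_ifs with h
  · have hR := h.choose_spec
    set R := h.choose
    ext y
    change R (N.timeU t y) = N.timeU t (R y)
    rw [hR]
    obtain ⟨h1, h2⟩ := (hR (R y) y).1 rfl
    obtain ⟨h3, h4⟩ := N.hamiltonian_timeU t h1
    exact ⟨h3, by rw [h4, ← map_add, h2]⟩
  · exact Commute.zero_left _

theorem commute_timeU_Rpow (t ℓ : ℝ) : Commute (N.Rpow ℓ) (N.timeU t) :=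
  (N.commute_timeU_resolvent t).cfc_nnreal _

/-- The space `C^∞(H) = ⋂_{ℓ>0} (1+H)^(-ℓ) 𝓗` of smooth vectors. -/
def smoothVectors : Submodule ℂ 𝓗 :=
  ⨅ (ℓ : ℝ) (_ : 0 < ℓ), LinearMap.range (N.Rpow ℓ : 𝓗 →ₗ[ℂ] 𝓗)

/-- The spectral projector `P(E)` of `H` for `[0, E]`. In terms of `R`, it is the projector onto
the spectral subspace of `R` for `[(1+E)⁻¹, 1]`, i.e. onto the vectors that are annihilated by
`f(R)` whenever `f` is continuous and vanishes on this interval. -/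
def energyProj (E : ℝ) : 𝓗 →L[ℂ] 𝓗 :=
  (⨅ (f : C(ℝ, ℝ)) (_ : ∀ r ∈ Set.Icc (1 / (1 + E)) 1, f r = 0),
    LinearMap.ker ((cfc f N.resolvent : 𝓗 →L[ℂ] 𝓗) : 𝓗 →ₗ[ℂ] 𝓗)).topologicalClosure.starProjection

/-- `e^{-wH}`, for `Re w > 0`, as a continuous function of `R = (1+H)⁻¹`. -/
def expNeg (w : ℂ) : 𝓗 →L[ℂ] 𝓗 :=
  cfc (fun r : ℂ => if r = 0 then 0 else Complex.exp (-w * (r⁻¹ - 1))) N.resolvent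

/-- `e^{w min(H,E)}`, as a continuous function of `R = (1+H)⁻¹`; it agrees with `e^{wH}` on the
range of `P(E)`. -/
def expCut (E : ℝ) (w : ℂ) : 𝓗 →L[ℂ] 𝓗 :=
  cfc (fun r : ℂ => Complex.exp (w * (((max r.re (1 / (1 + E)))⁻¹ - 1 : ℝ) : ℂ))) N.resolvent

/-! ### Smooth functionals and their dual -/

/-- The functional `σ((1+H)^ℓ · (1+H)^ℓ)` is bounded by `C`. Evaluated at `R^ℓ B R^ℓ`, it is
`σ(B)`. -/
def EnergyBound (ℓ : ℝ) (σ : StrongDual ℂ (𝓗 →L[ℂ] 𝓗)) (C : ℝ) : Prop :=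
  0 ≤ C ∧ ∀ B : 𝓗 →L[ℂ] 𝓗, ‖σ B‖ ≤ C * ‖N.Rpow ℓ * B * N.Rpow ℓ‖

/-- The norm `‖σ‖_ℓ = ‖σ((1+H)^ℓ · (1+H)^ℓ)‖`. -/
def normFun (ℓ : ℝ) (σ : StrongDual ℂ (𝓗 →L[ℂ] 𝓗)) : ℝ := sInf {C | N.EnergyBound ℓ σ C}

/-- The space `Σ_ℓ` of ultraweakly continuous functionals with finite norm `‖σ‖_ℓ`. -/
def sigmaSpace (ℓ : ℝ) : Submodule ℂ (StrongDual ℂ (𝓗 →L[ℂ] 𝓗)) where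
  carrier := {σ | σ ∈ NormalFunctional 𝓗 ∧ ∃ C, N.EnergyBound ℓ σ C}
  zero_mem' := ⟨zero_mem _, 0, le_rfl, fun B => by simp⟩
  add_mem' := by
    rintro a b ⟨ha, C, hC, hC'⟩ ⟨hb, D, hD, hD'⟩
    refine ⟨add_mem ha hb, C + D, add_nonneg hC hD, fun B => ?_⟩
    rw [add_mul]
    exact (norm_add_le _ _).trans (add_le_add (hC' B) (hD' B))
  smul_mem' := by
    rintro c a ⟨ha, C, hC, hC'⟩
    refine ⟨Submodule.smul_mem _ c ha, ‖c‖ * C, by positivity, fun B => ?_⟩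
    rw [_root_.smul_apply, norm_smul, mul_assoc]
    exact mul_le_mul_of_nonneg_left (hC' B) (norm_nonneg c)

/-- The underlying vector space of `C^∞(Σ) = ⋂_{ℓ>0} Σ_ℓ`. -/
def smoothSubmodule : Submodule ℂ (StrongDual ℂ (𝓗 →L[ℂ] 𝓗)) :=
  ⨅ (ℓ : ℝ) (_ : 0 < ℓ), N.sigmaSpace ℓ

/-- The space `C^∞(Σ)` of smooth functionals, a type of its own since it carries the Fréchet
topology of the norms `‖ · ‖_ℓ`, not the norm topology of `B(𝓗)*`. -/
def SmoothFunctional : Type _ := N.smoothSubmodule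

instance : AddCommGroup N.SmoothFunctional := inferInstanceAs (AddCommGroup N.smoothSubmodule)

instance : Module ℂ N.SmoothFunctional := inferInstanceAs (Module ℂ N.smoothSubmodule)

theorem mem_smooth_iff {σ : StrongDual ℂ (𝓗 →L[ℂ] 𝓗)} : σ ∈ N.smoothSubmodule ↔
    ∀ ℓ : ℝ, 0 < ℓ → σ ∈ NormalFunctional 𝓗 ∧ ∃ C, N.EnergyBound ℓ σ C := by
  simp only [smoothSubmodule, Submodule.mem_iInf]
  rfl

/-- The inclusion of `C^∞(Σ)` into `B(𝓗)*`. -/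
def SmoothFunctional.val {N : LocalNet n 𝓗} (σ : N.SmoothFunctional) :
    StrongDual ℂ (𝓗 →L[ℂ] 𝓗) := (show N.smoothSubmodule from σ : StrongDual ℂ (𝓗 →L[ℂ] 𝓗))

theorem SmoothFunctional.ext {N : LocalNet n 𝓗} {σ τ : N.SmoothFunctional}
    (h : ∀ A, σ.val A = τ.val A) : σ = τ :=
  Subtype.ext (ContinuousLinearMap.ext h)

theorem normFun_spec {ℓ : ℝ} {σ : StrongDual ℂ (𝓗 →L[ℂ] 𝓗)} (h : ∃ C, N.EnergyBound ℓ σ C) :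
    N.EnergyBound ℓ σ (N.normFun ℓ σ) := by
  have h0 : 0 ≤ N.normFun ℓ σ := le_csInf h fun C hC => hC.1
  refine ⟨h0, fun B => ?_⟩
  rcases (norm_nonneg (N.Rpow ℓ * B * N.Rpow ℓ)).eq_or_lt with hB | hB
  · obtain ⟨C, hC⟩ := h
    have := hC.2 B
    rw [← hB] at this ⊢
    simpa using this
  · rw [← div_le_iff₀ hB]
    exact le_csInf h fun C hC => (div_le_iff₀ hB).2 (hC.2 B)

theorem normFun_le {ℓ : ℝ} {σ : StrongDual ℂ (𝓗 →L[ℂ] 𝓗)} {C : ℝ} (h : N.EnergyBound ℓ σ C) :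
    N.normFun ℓ σ ≤ C :=
  csInf_le ⟨0, fun _ hC => hC.1⟩ h

/-- The norms `‖ · ‖_ℓ`, `ℓ > 0`, as seminorms on `C^∞(Σ)`. -/
def energySeminorm : SeminormFamily ℂ N.SmoothFunctional {ℓ : ℝ // 0 < ℓ} := fun ℓ =>
  Seminorm.ofSMulLE (fun σ => N.normFun ℓ σ.val)
    (le_antisymm (N.normFun_le ⟨le_rfl, fun B => by
        change ‖(0 : ℂ)‖ ≤ _
        simp⟩)
      (N.normFun_spec ((N.mem_smooth_iff.1 (0 : N.smoothSubmodule).2 ℓ ℓ.2).2)).1)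
    (fun σ τ => by
      have h1 := N.normFun_spec (N.mem_smooth_iff.1 σ.2 ℓ ℓ.2).2
      have h2 := N.normFun_spec (N.mem_smooth_iff.1 τ.2 ℓ ℓ.2).2
      refine N.normFun_le ⟨add_nonneg h1.1 h2.1, fun B => ?_⟩
      rw [add_mul]
      exact (norm_add_le _ _).trans (add_le_add (h1.2 B) (h2.2 B)))
    (fun c σ => by
      have h1 := N.normFun_spec (N.mem_smooth_iff.1 σ.2 ℓ ℓ.2).2
      refine N.normFun_le ⟨mul_nonneg (norm_nonneg c) h1.1, fun B => ?_⟩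
      change ‖c • (σ.val B)‖ ≤ _
      rw [norm_smul, mul_assoc]
      exact mul_le_mul_of_nonneg_left (h1.2 B) (norm_nonneg c))

instance : Nonempty {ℓ : ℝ // 0 < ℓ} := ⟨⟨1, one_pos⟩⟩

/-- The Fréchet topology of `C^∞(Σ)`. -/
instance : TopologicalSpace N.SmoothFunctional := N.energySeminorm.moduleFilterBasis.topology

theorem withSeminorms : WithSeminorms N.energySeminorm := ⟨rfl⟩

/-- The dual `C^∞(Σ)*` with the weak* topology. Its elements are the (generalized) fields. -/
abbrev SmoothDual : Type _ := WeakDual ℂ N.SmoothFunctional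

/-- `‖Φ‖_{-ℓ} ≤ C`, for a form `Φ` on `C^∞(Σ)`. -/
def DualBound (ℓ : ℝ) (Φ : N.SmoothFunctional → ℂ) (C : ℝ) : Prop :=
  ∀ σ, ‖Φ σ‖ ≤ C * N.normFun ℓ σ.val

/-- Hermitean conjugation on `C^∞(Σ)`. -/
def conjSmooth : N.SmoothFunctional →ₛₗ[starRingEnd ℂ] N.SmoothFunctional where
  toFun σ := ⟨conjFunctional σ.val, N.mem_smooth_iff.2 fun ℓ hℓ => by
    obtain ⟨h, C, hC, hC'⟩ := N.mem_smooth_iff.1 σ.2 ℓ hℓ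
    refine ⟨conjFunctional_mem h, C, hC, fun B => ?_⟩
    have h1 := hC' (star B)
    have h2 : N.Rpow ℓ * star B * N.Rpow ℓ = star (N.Rpow ℓ * B * N.Rpow ℓ) := by
      simp [star_mul, star_Rpow, mul_assoc]
    rw [h2, norm_star] at h1
    rwa [conjFunctional_apply, RCLike.norm_conj]⟩
  map_add' σ τ := Subtype.ext (ContinuousLinearMap.ext fun A => map_add (starRingEnd ℂ) _ _)
  map_smul' c σ := Subtype.ext (ContinuousLinearMap.ext fun A => map_mul (starRingEnd ℂ) _ _)

theorem normFun_conjSmooth_le (ℓ : ℝ) (hℓ : 0 < ℓ) (σ : N.SmoothFunctional) :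
    N.normFun ℓ (N.conjSmooth σ).val ≤ N.normFun ℓ σ.val := by
  obtain ⟨hC, hC'⟩ := N.normFun_spec (N.mem_smooth_iff.1 σ.2 ℓ hℓ).2
  refine N.normFun_le ⟨hC, fun B => ?_⟩
  have h1 := hC' (star B)
  have h2 : N.Rpow ℓ * star B * N.Rpow ℓ = star (N.Rpow ℓ * B * N.Rpow ℓ) := by
    simp [star_mul, star_Rpow, mul_assoc]
  rw [h2, norm_star] at h1
  change ‖conj (σ.val (star B))‖ ≤ _
  rwa [RCLike.norm_conj]

theorem continuous_conjSmooth : Continuous N.conjSmooth := by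
  refine WithSeminorms.continuous_of_isBounded N.withSeminorms N.withSeminorms _ fun ℓ => ?_
  refine ⟨{ℓ}, 1, fun σ => ?_⟩
  simpa using! N.normFun_conjSmooth_le ℓ ℓ.2 σ

/-- Hermitean conjugation of fields, `φ*(σ) = conj (φ(σ*))`. -/
def conjField (φ : N.SmoothDual) : N.SmoothDual :=
  StrongDual.toWeakDual
    { toFun := fun σ => conj (φ (N.conjSmooth σ))
      map_add' := fun σ τ => by simp
      map_smul' := fun c σ => by simp
      cont := Complex.continuous_conj.comp
        ((map_continuous φ).comp N.continuous_conjSmooth) }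

/-- The smooth functional `A ↦ ⟪u, A v⟫`, for smooth vectors `u`, `v`. -/
def vecSmooth (u v : N.smoothVectors) : N.SmoothFunctional :=
  ⟨vectorFunctional (u : 𝓗) v, N.mem_smooth_iff.2 fun ℓ hℓ => by
    refine ⟨vectorFunctional_mem _ _, ?_⟩
    have hu := u.2
    have hv := v.2
    simp only [smoothVectors, Submodule.mem_iInf] at hu hv
    obtain ⟨u', hu'⟩ := hu ℓ hℓ
    obtain ⟨v', hv'⟩ := hv ℓ hℓ
    refine ⟨‖u'‖ * ‖v'‖, by positivity, fun B => ?_⟩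
    have h1 : vectorFunctional (u : 𝓗) (v : 𝓗) B =
        ⟪u', (N.Rpow ℓ * B * N.Rpow ℓ) v'⟫_ℂ := by
      rw [vectorFunctional_apply, ← hu', ← hv']
      change ⟪N.Rpow ℓ u', B (N.Rpow ℓ v')⟫_ℂ = ⟪u', N.Rpow ℓ (B (N.Rpow ℓ v'))⟫_ℂ
      conv_lhs => rw [← N.star_Rpow ℓ, ContinuousLinearMap.star_eq_adjoint,
        ContinuousLinearMap.adjoint_inner_left, ← ContinuousLinearMap.star_eq_adjoint,
        N.star_Rpow ℓ]
    rw [h1]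
    calc _ ≤ ‖u'‖ * ‖(N.Rpow ℓ * B * N.Rpow ℓ) v'‖ := norm_inner_le_norm _ _
      _ ≤ ‖u'‖ * (‖N.Rpow ℓ * B * N.Rpow ℓ‖ * ‖v'‖) := by
        gcongr
        exact ContinuousLinearMap.le_opNorm _ _
      _ = _ := by ring⟩

/-- The time-translated functional `σ(U(s) · U(s)*)`. Thus, as a form on `C^∞(Σ)`, the
translate `U(s) Φ U(s)*` of `Φ` is `σ ↦ Φ (N.translate s σ)`. -/
def translate (s : ℝ) (σ : N.SmoothFunctional) : N.SmoothFunctional :=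
  ⟨sandwichFunctional (N.timeU s) (star (N.timeU s)) σ.val, N.mem_smooth_iff.2 fun ℓ hℓ => by
    obtain ⟨h, C, hC, hC'⟩ := N.mem_smooth_iff.1 σ.2 ℓ hℓ
    refine ⟨sandwichFunctional_mem _ _ h, C, hC, fun B => (hC' _).trans ?_⟩
    have hc := (N.commute_timeU_Rpow s ℓ).eq
    have hc' : star (N.timeU s) * N.Rpow ℓ = N.Rpow ℓ * star (N.timeU s) := by
      have := congrArg star hc
      simpa [star_mul, star_Rpow] using this
    have h1 : N.Rpow ℓ * (N.timeU s * B * star (N.timeU s)) * N.Rpow ℓ =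
        N.timeU s * (N.Rpow ℓ * B * N.Rpow ℓ) * star (N.timeU s) := by
      calc _ = (N.Rpow ℓ * N.timeU s) * B * (star (N.timeU s) * N.Rpow ℓ) := by
            simp only [mul_assoc]
        _ = _ := by rw [hc, hc']; simp only [mul_assoc]
    rw [h1]
    gcongr
    have hn : ‖N.timeU s‖ ≤ 1 := by
      have h2 := CStarRing.norm_star_mul_self (x := N.timeU s)
      rw [N.star_timeU_mul] at h2
      have h3 : ‖(1 : 𝓗 →L[ℂ] 𝓗)‖ ≤ 1 := ContinuousLinearMap.norm_id_le
      nlinarith [norm_nonneg (N.timeU s)]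
    calc _ ≤ ‖N.timeU s‖ * ‖N.Rpow ℓ * B * N.Rpow ℓ‖ * ‖star (N.timeU s)‖ := norm_mul₃_le
      _ ≤ 1 * ‖N.Rpow ℓ * B * N.Rpow ℓ‖ * 1 := by
        rw [norm_star]
        gcongr
      _ = _ := by ring⟩

/-- The functional `σ` is of the form `τ(P(E) · P(E))` with `τ ∈ Σ`, that is, `σ ∈ Σ(E)`. -/
def EnergyBounded (E : ℝ) (σ : N.SmoothFunctional) : Prop :=
  ∃ τ ∈ NormalFunctional 𝓗, ∀ A, σ.val A = τ (N.energyProj E * A * N.energyProj E)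

/-- The bounded operator `C` is the product `A Φ B`, in the weak sense:
`⟪x, C y⟫ = Φ(A* x, B y)` for smooth vectors `x`, `y`. -/
def IsWeakProduct (A : 𝓗 →L[ℂ] 𝓗) (Φ : N.SmoothFunctional → ℂ) (B C : 𝓗 →L[ℂ] 𝓗) : Prop :=
  ∀ x y : N.smoothVectors, ∃ (hx : star A (x : 𝓗) ∈ N.smoothVectors)
    (hy : B (y : 𝓗) ∈ N.smoothVectors),
    ⟪(x : 𝓗), C (y : 𝓗)⟫_ℂ = Φ (N.vecSmooth ⟨star A (x : 𝓗), hx⟩ ⟨B (y : 𝓗), hy⟩)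

open scoped Classical in
/-- The bounded operator `A Φ B`, whenever it exists. -/
def weakProduct (A : 𝓗 →L[ℂ] 𝓗) (Φ : N.SmoothFunctional → ℂ) (B : 𝓗 →L[ℂ] 𝓗) : 𝓗 →L[ℂ] 𝓗 :=
  if h : ∃ C, N.IsWeakProduct A Φ B C then h.choose else 0

/-! ### Pointlike fields -/

/-- The finite rank map `ψ` approximates the inclusion `Ξ : C^∞(Σ) → Σ` to order `γ` on the local
algebras: `r^(-γ) ‖(Ξ - ψ)⌈𝔄(r)‖_ℓ → 0` as `r → 0`, for all sufficiently large `ℓ`. -/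
def IsPhaseSpaceApprox (γ : ℝ) (ψ : N.SmoothFunctional →L[ℂ] NormalFunctional 𝓗) : Prop :=
  Module.Finite ℂ (LinearMap.range (ψ : N.SmoothFunctional →ₗ[ℂ] NormalFunctional 𝓗)) ∧
  ∃ ℓ₀ > (0 : ℝ), ∀ ℓ ≥ ℓ₀, ∀ c > (0 : ℝ), ∀ᶠ r : ℝ in 𝓝[>] 0, ∀ σ : N.SmoothFunctional,
    ∀ A ∈ N.alg (doubleCone n r),
      ‖σ.val A - (ψ σ : StrongDual ℂ (𝓗 →L[ℂ] 𝓗)) A‖ ≤ c * r ^ γ * N.normFun ℓ σ.val * ‖A‖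

/-- The microscopic phase space condition. -/
def MicroscopicPhaseSpace : Prop := ∀ γ : ℝ, 0 ≤ γ → ∃ ψ, N.IsPhaseSpaceApprox γ ψ

/-- `ψ` is an approximation to order `γ` of minimal rank. -/
def IsMinimalApprox (γ : ℝ) (ψ : N.SmoothFunctional →L[ℂ] NormalFunctional 𝓗) : Prop :=
  N.IsPhaseSpaceApprox γ ψ ∧ ∀ ψ', N.IsPhaseSpaceApprox γ ψ' →
    Module.finrank ℂ (LinearMap.range (ψ : N.SmoothFunctional →ₗ[ℂ] NormalFunctional 𝓗)) ≤
    Module.finrank ℂ (LinearMap.range (ψ' : N.SmoothFunctional →ₗ[ℂ] NormalFunctional 𝓗))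

/-- The space `Φ_γ` of fields: the image of the dual map `ψ*`, where `ψ` is an approximation to
order `γ` of minimal rank. -/
def fieldsOfOrder (γ : ℝ) : Set N.SmoothDual :=
  {φ | ∃ ψ, N.IsMinimalApprox γ ψ ∧
    ∃ L : StrongDual ℂ (NormalFunctional 𝓗), φ = StrongDual.toWeakDual (L.comp ψ)}

/-- The field content `⋃_γ Φ_γ` of the theory: the pointlike fields. -/
def pointlikeFields : Set N.SmoothDual := ⋃ (γ : ℝ) (_ : 0 ≤ γ), N.fieldsOfOrder γ

end LocalNet

/-! ### Kernels, boundary values and test functions -/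

/-- The space `𝒦` of analytic functions on the open lower half plane that are regular at the
boundary, `sup_{-1 ≤ Im z < 0} |F z| |Im z|^ℓ < ∞` for some `ℓ > 0`. They are extended by zero to
the whole plane, so that equality of kernels is equality of functions. -/
def Kernel : Submodule ℂ (ℂ → ℂ) where
  carrier := {F | DifferentiableOn ℂ F {z | z.im < 0} ∧ (∀ z, 0 ≤ z.im → F z = 0) ∧
    ∃ ℓ > (0 : ℝ), ∃ C : ℝ, ∀ z : ℂ, -1 ≤ z.im → z.im < 0 → ‖F z‖ * |z.im| ^ ℓ ≤ C}
  zero_mem' := ⟨differentiableOn_const 0, fun _ _ => rfl, 1, one_pos, 0, fun z _ _ => by simp⟩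
  add_mem' := by
    rintro F G ⟨hF, hF0, ℓ, hℓ, C, hC⟩ ⟨hG, hG0, m, hm, D, hD⟩
    refine ⟨hF.add hG, fun z hz => by simp [hF0 z hz, hG0 z hz], ℓ + m, by positivity, C + D,
      fun z h1 h2 => ?_⟩
    have ha : 0 < |z.im| := abs_pos.2 h2.ne
    have ha1 : |z.im| ≤ 1 := by rw [abs_le]; constructor <;> linarith
    have e1 : |z.im| ^ (ℓ + m) ≤ |z.im| ^ ℓ :=
      Real.rpow_le_rpow_of_exponent_ge ha ha1 (by linarith)
    have e2 : |z.im| ^ (ℓ + m) ≤ |z.im| ^ m :=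
      Real.rpow_le_rpow_of_exponent_ge ha ha1 (by linarith)
    calc ‖(F + G) z‖ * |z.im| ^ (ℓ + m) ≤ (‖F z‖ + ‖G z‖) * |z.im| ^ (ℓ + m) := by
          gcongr
          exact norm_add_le _ _
      _ = ‖F z‖ * |z.im| ^ (ℓ + m) + ‖G z‖ * |z.im| ^ (ℓ + m) := add_mul _ _ _
      _ ≤ ‖F z‖ * |z.im| ^ ℓ + ‖G z‖ * |z.im| ^ m := by gcongr
      _ ≤ C + D := add_le_add (hC z h1 h2) (hD z h1 h2)
  smul_mem' := by
    rintro c F ⟨hF, hF0, ℓ, hℓ, C, hC⟩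
    refine ⟨hF.const_smul c, fun z hz => by simp [hF0 z hz], ℓ, hℓ, ‖c‖ * C, fun z h1 h2 => ?_⟩
    rw [Pi.smul_apply, norm_smul, mul_assoc]
    exact mul_le_mul_of_nonneg_left (hC z h1 h2) (norm_nonneg c)

/-- `(g₁ ⋄ g₂)(s, s') = g₁(s + s'/2) g₂(s - s'/2)`. -/
def diamond (g₁ g₂ : ℝ → ℂ) (s s' : ℝ) : ℂ := g₁ (s + s' / 2) * g₂ (s - s' / 2)

/-- The boundary distribution `K(s' - i0)` is of positive type: applied, as a distribution in the
second variable, to `(ḡ ⋄ g)(s, s')` it gives a nonnegative number, for each Schwartz function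
`g`. -/
def PositiveType (K : Kernel) : Prop :=
  ∀ g : SchwartzMap ℝ ℂ, ∃ c : ℝ, 0 ≤ c ∧
    Tendsto (fun y : ℝ => ∫ s' : ℝ, (K : ℂ → ℂ) (s' - y * Complex.I) *
      ∫ s : ℝ, diamond (fun t => conj (g t)) g s s') (𝓝[>] 0) (𝓝 (c : ℂ))

/-- The space `𝓓(ℝ)` of complex test functions. -/
abbrev Test : Type := 𝓓((⊤ : TopologicalSpace.Opens ℝ), ℂ)

/-- `f ∈ 𝓓(-d, d)`. -/
def Test.SupportedIn (f : Test) (d : ℝ) : Prop := tsupport f ⊆ Set.Ioo (-d) d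

/-- The norm `‖f‖_{d,m} = max_{0 ≤ k ≤ m} d^k ‖f^(k)‖₁`. -/
def sobNorm (d : ℝ) (m : ℕ) (f : ℝ → ℂ) : ℝ :=
  (Finset.range (m + 1)).sup' ⟨0, by simp⟩ fun k => d ^ k * ∫ t, ‖iteratedDeriv k f t‖

/-- The complex conjugate `ḡ`. -/
def conjTest (g : Test) : Test where
  toFun t := conj (g t)
  contDiff' := Complex.conjCLE.contDiff.comp g.contDiff
  hasCompactSupport' := g.hasCompactSupport.comp_left (g := fun z : ℂ => conj z) (map_zero _)
  tsupport_subset' := fun _ _ => trivial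

/-- The test function `(g₁ ⋄ g₂)(s, · )`. -/
def diamondTest (g₁ g₂ : Test) (s : ℝ) : Test where
  toFun s' := diamond g₁ g₂ s s'
  contDiff' := by
    have h1 := g₁.contDiff
    have h2 := g₂.contDiff
    unfold diamond
    exact (h1.comp (by fun_prop)).mul (h2.comp (by fun_prop))
  hasCompactSupport' := by
    unfold diamond
    refine HasCompactSupport.mul_right (f := fun s' : ℝ => g₁ (s + s' / 2)) ?_
    exact g₁.hasCompactSupport.comp_homeomorph
      ((Homeomorph.mulRight₀ (2⁻¹ : ℝ) (by norm_num)).trans (Homeomorph.addLeft s))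
  tsupport_subset' := fun _ _ => trivial

namespace LocalNet

variable (N : LocalNet n 𝓗)

/-! ### Distributions and products -/

/-- The linear map `T` is a `C^∞(Σ)*`-valued distribution. -/
def IsFieldDistribution (T : Test →ₗ[ℂ] N.SmoothDual) : Prop :=
  ∃ ℓ > (0 : ℝ), ∃ m : ℕ, ∀ d > (0 : ℝ), ∃ c : ℝ, ∀ f : Test, f.SupportedIn d →
    N.DualBound ℓ (T f) (c * sobNorm d m f)

/-- For `σ ∈ Σ(E)`, the analytic function in the lower half plane whose boundary value is
`σ(φ(s'/2) φ'(-s'/2))`, namely `F(z) = σ(e^{wH} φ e^{-2wH} φ' e^{wH})` with `w = iz/2`. The factors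
`φ e^{-wH}` and `e^{-wH} φ'` are made bounded by the projectors `P(E)`, which commute with `e^{wH}`
and leave `σ = σ(P(E) · P(E))` unchanged. -/
def twoPointFn (E : ℝ) (σ : N.SmoothFunctional) (φ φ' : N.SmoothDual) (z : ℂ) : ℂ :=
  let w := Complex.I * z / 2
  σ.val (N.expCut E w * N.weakProduct (N.energyProj E) φ (N.expNeg w) *
    N.weakProduct (N.expNeg w) φ' (N.energyProj E) * N.expCut E w)

/-- The space `𝒦 ⊗ C^∞(Σ)* ⊗ C^∞(Σ)*` of formal products. -/
abbrev Products : Type _ := Kernel ⊗[ℂ] (N.SmoothDual ⊗[ℂ] N.SmoothDual)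

/-- `T` is the distribution associated with the product `Π = ∑ⱼ Kⱼ ⊗ φⱼ ⊗ φ'ⱼ`: for energy-bounded
`σ`, `σ(T(f)) = ∑ⱼ ∫ ds' f(s') Kⱼ(s'-i0) σ(φⱼ(s'/2-i0) φ'ⱼ(-s'/2+i0))`, where the product of
boundary values is the boundary value of the product of the analytic functions. -/
def IsProductDistribution (P : N.Products) (T : Test →ₗ[ℂ] N.SmoothDual) : Prop :=
  N.IsFieldDistribution T ∧
  ∀ (q : ℕ) (K : Fin q → Kernel) (φ φ' : Fin q → N.SmoothDual),
    P = ∑ j, K j ⊗ₜ[ℂ] (φ j ⊗ₜ[ℂ] φ' j) →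
    ∀ E > (0 : ℝ), ∀ σ : N.SmoothFunctional, N.EnergyBounded E σ → ∀ f : Test,
      Tendsto (fun y : ℝ => ∑ j, ∫ s' : ℝ, f s' * (K j : ℂ → ℂ) (s' - y * Complex.I) *
        N.twoPointFn E σ (φ j) (φ' j) (s' - y * Complex.I)) (𝓝[>] 0) (𝓝 (T f σ))

open scoped Classical in
/-- The (unique) distribution `Π(s')` associated with the product `Π`. -/
def productDistribution (P : N.Products) : Test →ₗ[ℂ] N.SmoothDual :=
  if h : ∃ T, N.IsProductDistribution P T then h.choose else 0

/-- The form `∫ ds U(s) (∫ ds' (g₁ ⋄ g₂)(s,s') T(s')) U(s)*` on `C^∞(Σ)`, as a weak integral. -/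
def convolInt (T : Test →ₗ[ℂ] N.SmoothDual) (g₁ g₂ : Test) (σ : N.SmoothFunctional) : ℂ :=
  ∫ s : ℝ, T (diamondTest g₁ g₂ s) (N.translate s σ)

/-- The smeared field `φ(f) = ∫ dt f(t) U(t) φ U(t)*`, as a form on `C^∞(Σ)`. -/
def smearedField (φ : N.SmoothDual) (f : Test) (σ : N.SmoothFunctional) : ℂ :=
  ∫ t : ℝ, f t * φ (N.translate t σ)

/-- The distribution `p T`. -/
def applyProj (p : N.SmoothDual →L[ℂ] N.SmoothDual) (T : Test →ₗ[ℂ] N.SmoothDual) :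
    Test →ₗ[ℂ] N.SmoothDual := (p : N.SmoothDual →ₗ[ℂ] N.SmoothDual) ∘ₗ T

/-- The continuous linear map `p` is an `α`-approximating projector for the product `Π`: it is a
hermitean projector whose image consists of pointlike fields and has finite dimension, and for some
`ℓ`, `m`, the norm of the bilinear map `(g₁, g₂) ↦ ∫ ds U(s) (∫ ds' g₁ ⋄ g₂ (Π - pΠ)) U(s)*`, from
`𝓓(-d,d)` with the norms `‖ · ‖_{d,m}` to forms with the norm `‖ · ‖_{-ℓ}`, is `o(d^α)`. -/
def IsApproximating (α : ℝ) (P : N.Products) (p : N.SmoothDual →L[ℂ] N.SmoothDual) : Prop :=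
  (∀ φ, p (p φ) = p φ) ∧
  (∀ φ, p (N.conjField φ) = N.conjField (p φ)) ∧
  FiniteDimensional ℂ (LinearMap.range (p : N.SmoothDual →ₗ[ℂ] N.SmoothDual)) ∧
  (∀ φ, p φ ∈ N.pointlikeFields) ∧
  ∃ ℓ > (0 : ℝ), ∃ m : ℕ, ∀ c > (0 : ℝ), ∀ᶠ d : ℝ in 𝓝[>] 0, ∀ g₁ g₂ : Test,
    g₁.SupportedIn d → g₂.SupportedIn d →
      N.DualBound ℓ (N.convolInt
        (N.productDistribution P - N.applyProj p (N.productDistribution P)) g₁ g₂)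
        (c * d ^ α * (sobNorm d m g₁ * sobNorm d m g₂))

/-- The classically positive products `∑ⱼ Kⱼ ⊗ φⱼ* ⊗ φⱼ`, with kernels `Kⱼ` of positive type and
pointlike fields `φⱼ`. -/
def positiveProducts : Set N.Products :=
  {P | ∃ (q : ℕ) (K : Fin q → Kernel) (φ : Fin q → N.SmoothDual),
    (∀ j, PositiveType (K j)) ∧ (∀ j, φ j ∈ N.pointlikeFields) ∧
    P = ∑ j, K j ⊗ₜ[ℂ] (N.conjField (φ j) ⊗ₜ[ℂ] φ j)}

/-- Hermitean `σⱼ ∈ C^∞(Σ)` and hermitean pointlike fields `φⱼ` represent the projector `p` in a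
basis: `p = ∑ⱼ σⱼ( · ) φⱼ`, `σⱼ(φₖ) = δⱼₖ`. -/
def IsBasisOf (p : N.SmoothDual →L[ℂ] N.SmoothDual) {q : ℕ} (σ : Fin q → N.SmoothFunctional)
    (φ : Fin q → N.SmoothDual) : Prop :=
  (∀ j, N.conjSmooth (σ j) = σ j) ∧ (∀ j, N.conjField (φ j) = φ j) ∧
  (∀ j, φ j ∈ N.pointlikeFields) ∧ (∀ j k, φ k (σ j) = if j = k then 1 else 0) ∧
  ∀ χ : N.SmoothDual, p χ = ∑ j, (χ (σ j)) • φ j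

end LocalNet

end QI

end

noncomputable section

set_option linter.unusedSectionVars false

namespace QI

variable {n : ℕ} {𝓗 : Type*} [NormedAddCommGroup 𝓗] [InnerProductSpace ℂ 𝓗] [CompleteSpace 𝓗]

namespace LocalNet

variable (N : LocalNet n 𝓗)

/-! ### The resolvent of the Hamiltonian -/

/-! Write `Π = pΠ + (Π - pΠ)`. Applied to the second summand, the form `I_{ḡ,g}` is `o(d^α)` by the
very definition of an approximating projector. Hence everything rests on the positivity of
`I_{ḡ,g}(Π)` on the functionals `⟪u, · u⟫` with smooth `u`: subtraction then bounds the form of `pΠ`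
from below, and that form is real because `p` and `Π` are compatible with hermitean conjugation
(`conj_productDistribution`).

For positivity, move `s'` to `s' - iy` and take `u = P(E)u`. A field is `(1+H)^k M (1+H)^k` with `M`
bounded, and its regularized, translated two-point function is an inner product `⟪Ψ(s + s'/2), Ψ(s -
s'/2)⟫`, where `Ψ(t) = U(t) (1+H)^k e^{-yH/2} M (1+H)^k P(E) e^{yH/2} U(-t) u`
(`twoPointFn_translate_vecSmooth`). The kernel `K(t - t' - iy)` is positive definite; this follows
from positivity at the boundary by testing with Gaussians of complex centre and shifting contours
(`PositiveType.sum_nonneg`). By the Schur product theorem the product of both is positive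
semidefinite, so pairing it with `ḡ(t) g(t')` gives a nonnegative number
(`PositiveType.integral_diamond_nonneg`).

The limit `y → 0` exists for each `s` by the definition of `Π(s')`. To exchange it with the
`s`-integral one needs a bound uniform in `y`, which is the classical estimate that analytic
functions of moderate growth have distributional boundary values (`exists_boundary_bound`). The
restriction `u = P(E)u` is removed by `E → ∞` (`FieldBound.tendsto_convolInt_truncate`).

The operator theory is built on the resolvent: `1 + H` is shown to be bijective from strong
continuity and positivity of the energy (`exists_isResolvent`), and all functions of `H` are
continuous functions of `R` on `[0, 1]`. A single error function valid at all scales comes from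
`exists_rate`: general boundedness supplies some constant at each `d`, the approximation property
supplies small ones near `0`. -/

theorem timeU_zero : N.timeU 0 = 1 :=
  congrArg (fun V : unitary (𝓗 →L[ℂ] 𝓗) => (V : 𝓗 →L[ℂ] 𝓗)) N.U_one

theorem star_timeU (t : ℝ) : star (N.timeU t) = N.timeU (-t) := by
  calc star (N.timeU t) = star (N.timeU t) * (N.timeU t * N.timeU (-t)) := by
        rw [timeU_mul, add_neg_cancel, timeU_zero, mul_one]
    _ = N.timeU (-t) := by rw [← mul_assoc, star_timeU_mul, one_mul]

theorem timeU_apply_apply (s t : ℝ) (x : 𝓗) : N.timeU s (N.timeU t x) = N.timeU (s + t) x := by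
  rw [← timeU_mul]; rfl

theorem continuous_timeU (x : 𝓗) : Continuous fun t : ℝ => N.timeU t x :=
  (N.U_continuous x).comp (f := fun t : ℝ => (((t, 0) : Minkowski n), (1 : Lorentz n)))
    (by fun_prop)

theorem inner_timeU_left (t : ℝ) (x y : 𝓗) : ⟪N.timeU t x, y⟫_ℂ = ⟪x, N.timeU (-t) y⟫_ℂ := by
  rw [← star_timeU, ContinuousLinearMap.star_eq_adjoint, ContinuousLinearMap.adjoint_inner_right]

theorem norm_timeU_apply (t : ℝ) (x : 𝓗) : ‖N.timeU t x‖ = ‖x‖ := by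
  have h : ⟪N.timeU t x, N.timeU t x⟫_ℂ = ⟪x, x⟫_ℂ := by
    rw [inner_timeU_left, timeU_apply_apply, neg_add_cancel, timeU_zero]; rfl
  rw [inner_self_eq_norm_sq_to_K, inner_self_eq_norm_sq_to_K] at h
  have h2 : ‖N.timeU t x‖ ^ 2 = ‖x‖ ^ 2 := by exact_mod_cast h
  exact (sq_eq_sq₀ (norm_nonneg _) (norm_nonneg _)).1 h2

theorem norm_timeU_le (t : ℝ) : ‖N.timeU t‖ ≤ 1 :=
  ContinuousLinearMap.opNorm_le_bound _ zero_le_one fun x => by rw [norm_timeU_apply, one_mul]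

theorem hasDerivAt_timeU (x : N.hamiltonian.domain) (t : ℝ) :
    HasDerivAt (fun t : ℝ => N.timeU t (x : 𝓗)) (N.timeU t (Complex.I • N.hamiltonian x)) t := by
  have h0 : HasDerivAt (fun t : ℝ => N.timeU t (x : 𝓗)) (Complex.I • N.hamiltonian x) 0 := by
    have : Complex.I • N.hamiltonian x = deriv (fun t : ℝ => N.timeU t (x : 𝓗)) 0 := by
      change Complex.I • (-Complex.I • deriv (fun t : ℝ => N.timeU t (x : 𝓗)) 0) = _
      rw [smul_smul]
      simp
    rw [this]
    exact DifferentiableAt.hasDerivAt x.2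
  have h1 : HasDerivAt (fun s : ℝ => N.timeU (s - t) (x : 𝓗)) (Complex.I • N.hamiltonian x) t := by
    have h0' : HasDerivAt (fun t : ℝ => N.timeU t (x : 𝓗)) (Complex.I • N.hamiltonian x)
        (t - t) := by rwa [sub_self]
    have := HasDerivAt.scomp (h := fun s : ℝ => s - t) t h0' ((hasDerivAt_id t).sub_const t)
    simpa using! this
  have h2 := ((N.timeU t).restrictScalars ℝ).hasFDerivAt.comp_hasDerivAt t h1
  refine h2.congr_of_eventuallyEq (Eventually.of_forall fun s => ?_)
  change _ = N.timeU t (N.timeU (s - t) (x : 𝓗))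
  rw [timeU_apply_apply, add_sub_cancel]

theorem hamiltonian_of_hasDerivAt {x y : 𝓗}
    (h : HasDerivAt (fun t : ℝ => N.timeU t x) (Complex.I • y) 0) :
    ∃ hx : x ∈ N.hamiltonian.domain, N.hamiltonian ⟨x, hx⟩ = y := by
  refine ⟨h.differentiableAt, ?_⟩
  change -Complex.I • deriv (fun t : ℝ => N.timeU t x) 0 = y
  rw [h.deriv, smul_smul]
  simp

/-- By unitarity `⟪U(t)x, U(t)y⟫` is constant; symmetry is its vanishing derivative at `0`. -/
theorem hamiltonian_symm (x y : N.hamiltonian.domain) :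
    ⟪N.hamiltonian x, (y : 𝓗)⟫_ℂ = ⟪(x : 𝓗), N.hamiltonian y⟫_ℂ := by
  have h1 := N.hasDerivAt_timeU x 0
  have h2 := N.hasDerivAt_timeU y 0
  have h3 := h1.inner ℂ h2
  have h4 : (fun t : ℝ => ⟪N.timeU t (x : 𝓗), N.timeU t (y : 𝓗)⟫_ℂ) = fun _ => ⟪(x : 𝓗), (y : 𝓗)⟫_ℂ := by
    ext t
    rw [inner_timeU_left, timeU_apply_apply, neg_add_cancel, timeU_zero]; rfl
  rw [h4] at h3
  have h5 := h3.unique (hasDerivAt_const _ _)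
  simp only [timeU_zero, one_apply_eq_self, inner_smul_right, inner_smul_left,
    Complex.conj_I] at h5
  linear_combination Complex.I * h5 + (⟪N.hamiltonian x, (y : 𝓗)⟫_ℂ - ⟪(x : 𝓗), N.hamiltonian y⟫_ℂ) * Complex.I_sq

theorem hamiltonian_nonneg (x : N.hamiltonian.domain) :
    0 ≤ (⟪(x : 𝓗), N.hamiltonian x⟫_ℂ).re := by
  refine N.positiveEnergy (1, 0) (by simp [forwardCone]) _ _ ?_
  have := N.hasDerivAt_timeU x 0
  rw [timeU_zero] at this
  simpa [timeU] using! this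

theorem inner_self_hamiltonian_im (x : N.hamiltonian.domain) :
    (⟪(x : 𝓗), N.hamiltonian x⟫_ℂ).im = 0 := by
  rw [← Complex.conj_eq_iff_im, inner_conj_symm, hamiltonian_symm]

theorem timeU_sub_eq_integral (x : N.hamiltonian.domain) (t : ℝ) :
    ∫ s in (0 : ℝ)..t, N.timeU s (Complex.I • N.hamiltonian x) = N.timeU t (x : 𝓗) - x := by
  rw [intervalIntegral.integral_eq_sub_of_hasDerivAt (fun s _ => N.hasDerivAt_timeU x s)
    ((N.continuous_timeU _).intervalIntegrable _ _), timeU_zero]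
  rfl

theorem hasDerivAt_integral_timeU (y : 𝓗) :
    HasDerivAt (fun t : ℝ => ∫ s in (0 : ℝ)..t, N.timeU s y) y 0 := by
  have := intervalIntegral.integral_hasDerivAt_right
    ((N.continuous_timeU y).intervalIntegrable (0 : ℝ) 0)
    ((N.continuous_timeU y).stronglyMeasurableAtFilter _ _) (N.continuous_timeU y).continuousAt
  simpa [timeU_zero] using! this

/-- The identity `U(t)x - x = ∫₀ᵗ U(s) iHx ds` survives the limit along the sequence by dominated
convergence, and differentiating it at `0` recovers the generator. -/
theorem hamiltonian_closed {x : ℕ → N.hamiltonian.domain} {a b : 𝓗}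
    (hx : Tendsto (fun k => (x k : 𝓗)) atTop (𝓝 a))
    (hy : Tendsto (fun k => N.hamiltonian (x k)) atTop (𝓝 b)) :
    ∃ h : a ∈ N.hamiltonian.domain, N.hamiltonian ⟨a, h⟩ = b := by
  have key : ∀ t : ℝ, N.timeU t a = a + ∫ s in (0 : ℝ)..t, N.timeU s (Complex.I • b) := by
    intro t
    have h1 : Tendsto (fun k => N.timeU t (x k : 𝓗) - x k) atTop (𝓝 (N.timeU t a - a)) :=
      (((N.timeU t).continuous.tendsto a).comp hx).sub hx
    have h2 : Tendsto (fun k => ∫ s in (0 : ℝ)..t, N.timeU s (Complex.I • N.hamiltonian (x k)))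
        atTop (𝓝 (∫ s in (0 : ℝ)..t, N.timeU s (Complex.I • b))) := by
      obtain ⟨C, hC⟩ := hy.norm.bddAbove_range
      refine intervalIntegral.tendsto_integral_filter_of_dominated_convergence (fun _ => C)
        (Eventually.of_forall fun k => (N.continuous_timeU _).aestronglyMeasurable)
        (Eventually.of_forall fun k => Eventually.of_forall fun s _ => ?_)
        intervalIntegrable_const
        (Eventually.of_forall fun s _ => ((N.timeU s).continuous.tendsto _).comp
          (hy.const_smul Complex.I))
      rw [norm_timeU_apply, norm_smul, Complex.norm_I, one_mul]
      exact hC ⟨k, rfl⟩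
    simp only [timeU_sub_eq_integral] at h2
    rw [← tendsto_nhds_unique h1 h2]
    abel
  refine N.hamiltonian_of_hasDerivAt ?_
  rw [funext key]
  exact (N.hasDerivAt_integral_timeU _).const_add a

/-- Applying `U(t)` shifts the interval of integration, so the dependence on `t` is only through the
end points. -/
theorem integral_timeU_mem_domain (y : 𝓗) (ε : ℝ) :
    (∫ s in (0 : ℝ)..ε, N.timeU s y) ∈ N.hamiltonian.domain := by
  have hc := N.continuous_timeU y
  have key : ∀ t : ℝ, N.timeU t (∫ s in (0 : ℝ)..ε, N.timeU s y) =
      (∫ s in (0 : ℝ)..(t + ε), N.timeU s y) - ∫ s in (0 : ℝ)..t, N.timeU s y := by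
    intro t
    rw [intervalIntegral.integral_interval_sub_left (hc.intervalIntegrable _ _)
      (hc.intervalIntegrable _ _), ← (N.timeU t).intervalIntegral_comp_comm
      (hc.intervalIntegrable _ _)]
    simp only [timeU_apply_apply]
    rw [intervalIntegral.integral_comp_add_left (fun s => N.timeU s y) t, add_zero]
  change DifferentiableAt ℝ _ 0
  simp only [key]
  refine DifferentiableAt.sub ?_ (N.hasDerivAt_integral_timeU y).differentiableAt
  have h := intervalIntegral.integral_hasDerivAt_right
    (hc.intervalIntegrable (0 : ℝ) (0 + ε)) (hc.stronglyMeasurableAtFilter _ _) hc.continuousAt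
  exact (HasDerivAt.scomp (h := fun t : ℝ => t + ε) 0 h
    ((hasDerivAt_id (0 : ℝ)).add_const ε)).differentiableAt

/-- The averages `t⁻¹ ∫₀ᵗ U(s)y ds` lie in the domain and tend to `y`. -/
theorem dense_domain_hamiltonian : Dense (N.hamiltonian.domain : Set 𝓗) := by
  intro y
  have h := (N.hasDerivAt_integral_timeU y).tendsto_slope
  refine mem_closure_of_tendsto h (Eventually.of_forall fun t => ?_)
  rw [slope_def_module, intervalIntegral.integral_same, sub_zero, sub_zero]
  exact N.hamiltonian.domain.smul_of_tower_mem _ (N.integral_timeU_mem_domain y t)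

/-- Since `H ≥ 0`, `‖x‖² ≤ Re ⟪x, (1+H)x⟫`; Cauchy–Schwarz does the rest. Injectivity and closed
range of `1 + H` and the bound `‖R‖ ≤ 1` all come from here. -/
theorem norm_le_norm_add_hamiltonian (x : N.hamiltonian.domain) :
    ‖(x : 𝓗)‖ ≤ ‖(x : 𝓗) + N.hamiltonian x‖ := by
  have h1 : ‖(x : 𝓗)‖ ^ 2 ≤ ‖(x : 𝓗)‖ * ‖(x : 𝓗) + N.hamiltonian x‖ := by
    calc ‖(x : 𝓗)‖ ^ 2 = (⟪(x : 𝓗), (x : 𝓗)⟫_ℂ).re := by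
          rw [inner_self_eq_norm_sq_to_K]; norm_cast
      _ ≤ (⟪(x : 𝓗), (x : 𝓗) + N.hamiltonian x⟫_ℂ).re := by
          rw [inner_add_right, Complex.add_re]
          linarith [N.hamiltonian_nonneg x]
      _ ≤ _ := (Complex.re_le_norm _).trans (norm_inner_le_norm _ _)
  rcases (norm_nonneg (x : 𝓗)).eq_or_lt with h | h
  · rw [← h]; exact norm_nonneg _
  · nlinarith

/-- `1 + H` as a linear map on the domain of `H`. -/
def onePlusH : N.hamiltonian.domain →ₗ[ℂ] 𝓗 := N.hamiltonian.domain.subtype + N.hamiltonian.toFun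

theorem onePlusH_apply (x : N.hamiltonian.domain) :
    N.onePlusH x = (x : 𝓗) + N.hamiltonian x := rfl

/-- Such a `y` satisfies `H*y = -y` weakly. Integrated along orbits in the domain this gives `U(-t)y
= e^{it}y`, so `y` is itself in the domain with `Hy = -y`, which positivity of the energy forbids.
-/
theorem eq_zero_of_orthogonal_range {y : 𝓗} (hy : ∀ x, ⟪N.onePlusH x, y⟫_ℂ = 0) : y = 0 := by
  have h1 : ∀ t : ℝ, N.timeU (-t) y = Complex.exp (t * Complex.I) • y := by
    intro t
    refine N.dense_domain_hamiltonian.eq_of_inner_right (𝕜 := ℂ) fun z hz => ?_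
    obtain ⟨x, rfl⟩ : ∃ x : N.hamiltonian.domain, (x : 𝓗) = z := ⟨⟨z, hz⟩, rfl⟩
    have hd : ∀ s : ℝ, HasDerivAt (fun s : ℝ => Complex.exp (-(s * Complex.I)) *
        ⟪N.timeU s (x : 𝓗), y⟫_ℂ) 0 s := by
      intro s
      have e1 : HasDerivAt (fun s : ℝ => Complex.exp (-(s * Complex.I)))
          (Complex.exp (-(s * Complex.I)) * (-(1 * Complex.I))) s :=
        (((Complex.ofRealCLM.hasDerivAt (x := s)).mul_const Complex.I).neg).cexp
      have e2 := (N.hasDerivAt_timeU x s).inner ℂ (hasDerivAt_const s y)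
      refine (e1.mul e2).congr_deriv ?_
      -- The orbit stays in the domain, so orthogonality to the range is available at every `s` and
      -- cancels the derivative of the exponential factor.
      obtain ⟨h, h'⟩ := N.hamiltonian_timeU s x.2
      have e3 := hy ⟨_, h⟩
      rw [onePlusH_apply, h', inner_add_left] at e3
      rw [map_smul, inner_smul_left, inner_zero_right, Complex.conj_I]
      linear_combination -Complex.I * Complex.exp (-(s * Complex.I)) * e3
    have hc := is_const_of_deriv_eq_zero (fun s => (hd s).differentiableAt)
      (fun s => (hd s).deriv) t 0
    rw [inner_timeU_left, Complex.exp_neg, inv_mul_eq_iff_eq_mul₀ (Complex.exp_ne_zero _)] at hc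
    rw [hc, inner_smul_right]
    simp [timeU_zero]
  have h2 : HasDerivAt (fun t : ℝ => N.timeU t y) (Complex.I • (-y)) 0 := by
    have e1 : HasDerivAt (fun s : ℝ => Complex.exp (-(s * Complex.I)) • y)
        ((Complex.exp (-((0 : ℝ) * Complex.I)) * (-(1 * Complex.I))) • y) 0 :=
      ((((Complex.ofRealCLM.hasDerivAt (x := (0 : ℝ))).mul_const Complex.I).neg).cexp).smul_const y
    have e2 : (fun t : ℝ => N.timeU t y) = fun s : ℝ => Complex.exp (-(s * Complex.I)) • y := by
      ext s
      have := h1 (-s)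
      rw [neg_neg] at this
      simpa using this
    rw [e2]
    refine e1.congr_deriv ?_
    simp
  obtain ⟨h, h'⟩ := N.hamiltonian_of_hasDerivAt h2
  have h3 := N.norm_le_norm_add_hamiltonian ⟨y, h⟩
  rw [h', add_neg_cancel, norm_zero] at h3
  exact norm_le_zero_iff.1 h3

/-- The range is closed, because the lower bound turns Cauchy images into Cauchy preimages and `H`
is closed, and its orthogonal complement is trivial. -/
theorem surjective_onePlusH : Function.Surjective N.onePlusH := by
  have hcl : IsClosed (LinearMap.range N.onePlusH : Set 𝓗) := by
    refine isClosed_of_closure_subset fun y hy => ?_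
    obtain ⟨z, hz, hzy⟩ := mem_closure_iff_seq_limit.1 hy
    choose x hx using hz
    have hc : CauchySeq fun k => (x k : 𝓗) := by
      refine Metric.cauchySeq_iff'.2 fun ε hε => ?_
      obtain ⟨k, hk⟩ := Metric.cauchySeq_iff'.1 hzy.cauchySeq ε hε
      refine ⟨k, fun m hm => lt_of_le_of_lt ?_ (hk m hm)⟩
      rw [dist_eq_norm, dist_eq_norm, ← hx, ← hx, ← map_sub]
      exact N.norm_le_norm_add_hamiltonian (x m - x k)
    obtain ⟨a, ha⟩ := cauchySeq_tendsto_of_complete hc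
    have hH : Tendsto (fun k => N.hamiltonian (x k)) atTop (𝓝 (y - a)) := by
      refine (hzy.sub ha).congr fun k => ?_
      rw [← hx, onePlusH_apply, add_sub_cancel_left]
    obtain ⟨h, h'⟩ := N.hamiltonian_closed ha hH
    exact ⟨⟨a, h⟩, by rw [onePlusH_apply, h', add_sub_cancel]⟩
  rw [← LinearMap.range_eq_top]
  have : IsComplete (LinearMap.range N.onePlusH : Set 𝓗) := hcl.isComplete
  have : CompleteSpace (LinearMap.range N.onePlusH) := this.completeSpace_coe
  refine Submodule.orthogonal_eq_bot_iff.1 ((Submodule.eq_bot_iff _).2 fun y hy => ?_)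
  exact N.eq_zero_of_orthogonal_range fun x => (Submodule.mem_orthogonal _ _).1 hy _ ⟨x, rfl⟩

theorem injective_onePlusH : Function.Injective N.onePlusH := by
  refine (injective_iff_map_eq_zero _).2 fun x hx => ?_
  have := N.norm_le_norm_add_hamiltonian x
  rw [← onePlusH_apply, hx, norm_zero] at this
  exact Subtype.ext (norm_le_zero_iff.1 this)

/-- This excludes the fallback value `0` in the definition of `resolvent`. -/
theorem exists_isResolvent : ∃ R, N.IsResolvent R := by
  let e := LinearEquiv.ofBijective N.onePlusH ⟨N.injective_onePlusH, N.surjective_onePlusH⟩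
  let R : 𝓗 →L[ℂ] 𝓗 := LinearMap.mkContinuous (N.hamiltonian.domain.subtype ∘ₗ e.symm.toLinearMap) 1
    fun y => by
      rw [one_mul]
      refine (N.norm_le_norm_add_hamiltonian (e.symm y)).trans_eq ?_
      rw [← onePlusH_apply]
      exact congrArg _ (e.apply_symm_apply y)
  refine ⟨R, fun x y => ⟨?_, ?_⟩⟩
  · rintro rfl
    exact ⟨(e.symm y).2, e.apply_symm_apply y⟩
  · rintro ⟨h, rfl⟩
    exact congrArg Subtype.val (e.symm_apply_apply ⟨x, h⟩)

theorem isResolvent_resolvent : N.IsResolvent N.resolvent := by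
  rw [resolvent, dif_pos N.exists_isResolvent]
  exact N.exists_isResolvent.choose_spec

theorem resolvent_mem_domain (y : 𝓗) : N.resolvent y ∈ N.hamiltonian.domain :=
  ((N.isResolvent_resolvent _ y).1 rfl).1

theorem resolvent_add_hamiltonian (y : 𝓗) :
    N.resolvent y + N.hamiltonian ⟨N.resolvent y, N.resolvent_mem_domain y⟩ = y :=
  ((N.isResolvent_resolvent _ y).1 rfl).2

theorem resolvent_onePlusH (x : N.hamiltonian.domain) : N.resolvent (N.onePlusH x) = x :=
  (N.isResolvent_resolvent _ _).2 ⟨x.2, rfl⟩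

theorem norm_resolvent_le : ‖N.resolvent‖ ≤ 1 :=
  ContinuousLinearMap.opNorm_le_bound _ zero_le_one fun y => by
    have := N.norm_le_norm_add_hamiltonian ⟨_, N.resolvent_mem_domain y⟩
    rwa [resolvent_add_hamiltonian, ← one_mul ‖y‖] at this

/-- With `x = Ry`, the expectation value `⟪Ry, y⟫` equals `‖x‖² + ⟪x, Hx⟫`. -/
theorem resolvent_nonneg : 0 ≤ N.resolvent := by
  rw [ContinuousLinearMap.nonneg_iff_isPositive, ContinuousLinearMap.isPositive_iff_complex]
  intro y
  set x : N.hamiltonian.domain := ⟨_, N.resolvent_mem_domain y⟩ with hx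
  have h : ⟪N.resolvent y, y⟫_ℂ = ⟪(x : 𝓗), (x : 𝓗)⟫_ℂ + ⟪(x : 𝓗), N.hamiltonian x⟫_ℂ := by
    rw [← inner_add_right, resolvent_add_hamiltonian]
  have h1 : (⟪(x : 𝓗), (x : 𝓗)⟫_ℂ).im = 0 := inner_self_im (𝕜 := ℂ) (x : 𝓗)
  have h2 : 0 ≤ (⟪(x : 𝓗), (x : 𝓗)⟫_ℂ).re := inner_self_nonneg (𝕜 := ℂ) (x := (x : 𝓗))
  have h3 := N.inner_self_hamiltonian_im x
  have h4 := N.hamiltonian_nonneg x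
  rw [h]
  refine ⟨?_, ?_⟩
  · exact Complex.ext (by simp) (by rw [Complex.add_im, h1, h3, add_zero]; exact Complex.ofReal_im _)
  · simpa using add_nonneg h2 h4

/-- `U(s)x - x` is an integral of `U(t) iHx`, and `‖HRy‖ ≤ ‖y‖` because the cross term in `‖x +
Hx‖²` is nonnegative. This makes time translations Lipschitz at the cost of one power of `1 + H`. -/
theorem norm_timeU_sub_resolvent (s : ℝ) : ‖(N.timeU s - 1) * N.resolvent‖ ≤ |s| := by
  refine ContinuousLinearMap.opNorm_le_bound _ (abs_nonneg s) fun y => ?_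
  set x : N.hamiltonian.domain := ⟨_, N.resolvent_mem_domain y⟩ with hx
  have h1 : ((N.timeU s - 1) * N.resolvent) y = N.timeU s (x : 𝓗) - x := rfl
  have h2 : ‖N.hamiltonian x‖ ≤ ‖y‖ := by
    have e : y = x + N.hamiltonian x := (N.resolvent_add_hamiltonian y).symm
    have h3 : ‖y‖ ^ 2 = ‖(x : 𝓗)‖ ^ 2 + 2 * (⟪(x : 𝓗), N.hamiltonian x⟫_ℂ).re + ‖N.hamiltonian x‖ ^ 2 := by
      conv_lhs => rw [e]
      exact norm_add_sq (𝕜 := ℂ) _ _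
    have h4 := N.hamiltonian_nonneg x
    refine le_of_sq_le_sq ?_ (norm_nonneg _)
    nlinarith [sq_nonneg ‖(x : 𝓗)‖]
  rw [h1, ← timeU_sub_eq_integral]
  refine (intervalIntegral.norm_integral_le_of_norm_le_const (C := ‖y‖) fun t _ => ?_).trans_eq ?_
  · rwa [norm_timeU_apply, norm_smul, Complex.norm_I, one_mul]
  · rw [sub_zero, mul_comm]

end LocalNet

end QI

namespace QI

variable {n : ℕ} {𝓗 : Type*} [NormedAddCommGroup 𝓗] [InnerProductSpace ℂ 𝓗] [CompleteSpace 𝓗]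

namespace LocalNet

variable (N : LocalNet n 𝓗)

/-! ### Functional calculus of the resolvent -/

include N in
theorem nontrivial_space : Nontrivial 𝓗 :=
  ⟨⟨N.vacuum, 0, fun h => by simpa [h] using N.vacuum_norm⟩⟩

theorem isSelfAdjoint_resolvent : IsSelfAdjoint N.resolvent := .of_nonneg N.resolvent_nonneg

open scoped ComplexOrder in
theorem mem_spectrum_resolvent {z : ℂ} (hz : z ∈ spectrum ℂ N.resolvent) :
    z.re ∈ Set.Icc (0 : ℝ) 1 := by
  have := N.nontrivial_space
  have h0 : 0 ≤ z := spectrum_nonneg_of_nonneg N.resolvent_nonneg hz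
  exact ⟨(Complex.le_def.1 h0).1, (Complex.re_le_norm z).trans
    ((spectrum.norm_le_norm_of_mem hz).trans N.norm_resolvent_le)⟩

open scoped ComplexOrder in
theorem ofReal_re_of_mem_spectrum {z : ℂ} (hz : z ∈ spectrum ℂ N.resolvent) :
    (z.re : ℂ) = z := by
  have h0 : 0 ≤ z := spectrum_nonneg_of_nonneg N.resolvent_nonneg hz
  exact Complex.ext rfl (by simpa using (Complex.le_def.1 h0).2)

/-- The operator `f(R)`, for a complex function `f` on the spectrum `[0, 1]` of `R`. -/
def fcalc (f : ℝ → ℂ) : 𝓗 →L[ℂ] 𝓗 := cfc (fun z : ℂ => f z.re) N.resolvent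

variable {f g : ℝ → ℂ}

theorem continuousOn_spectrum (hf : ContinuousOn f (Set.Icc 0 1)) :
    ContinuousOn (fun z : ℂ => f z.re) (spectrum ℂ N.resolvent) :=
  hf.comp Complex.continuous_re.continuousOn fun _ hz => N.mem_spectrum_resolvent hz

theorem fcalc_congr (h : ∀ r ∈ Set.Icc (0 : ℝ) 1, f r = g r) : N.fcalc f = N.fcalc g :=
  cfc_congr fun _ hz => h _ (N.mem_spectrum_resolvent hz)

theorem cfc_eq_fcalc {f : ℂ → ℂ} (h : ∀ r ∈ Set.Icc (0 : ℝ) 1, f r = g r) :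
    cfc f N.resolvent = N.fcalc g :=
  cfc_congr fun z hz => by
    rw [← h _ (N.mem_spectrum_resolvent hz), N.ofReal_re_of_mem_spectrum hz]

theorem cfc_real_eq_fcalc (f : ℝ → ℝ) : cfc f N.resolvent = N.fcalc fun r => (f r : ℂ) :=
  cfc_real_eq_complex f N.isSelfAdjoint_resolvent

theorem fcalc_mul (hf : ContinuousOn f (Set.Icc 0 1)) (hg : ContinuousOn g (Set.Icc 0 1)) :
    N.fcalc (fun r => f r * g r) = N.fcalc f * N.fcalc g :=
  cfc_mul _ _ _ (N.continuousOn_spectrum hf) (N.continuousOn_spectrum hg)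

theorem fcalc_add (hf : ContinuousOn f (Set.Icc 0 1)) (hg : ContinuousOn g (Set.Icc 0 1)) :
    N.fcalc (fun r => f r + g r) = N.fcalc f + N.fcalc g :=
  cfc_add _ _ _ (N.continuousOn_spectrum hf) (N.continuousOn_spectrum hg)

theorem fcalc_smul (c : ℂ) (hf : ContinuousOn f (Set.Icc 0 1)) :
    N.fcalc (fun r => c * f r) = c • N.fcalc f :=
  cfc_const_mul _ _ _ (N.continuousOn_spectrum hf)

theorem fcalc_sub (hf : ContinuousOn f (Set.Icc 0 1)) (hg : ContinuousOn g (Set.Icc 0 1)) :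
    N.fcalc (fun r => f r - g r) = N.fcalc f - N.fcalc g :=
  cfc_sub _ _ _ (N.continuousOn_spectrum hf) (N.continuousOn_spectrum hg)

theorem fcalc_star (f : ℝ → ℂ) : star (N.fcalc f) = N.fcalc fun r => conj (f r) :=
  (cfc_star _ _).symm

theorem fcalc_one : N.fcalc (fun _ => 1) = 1 :=
  cfc_const_one ℂ N.resolvent N.isSelfAdjoint_resolvent.isStarNormal

theorem fcalc_zero : N.fcalc (fun _ => 0) = 0 := cfc_const_zero ℂ N.resolvent

theorem fcalc_id : N.fcalc (fun r => (r : ℂ)) = N.resolvent := by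
  rw [← cfc_real_eq_fcalc, cfc_id' ℝ N.resolvent N.isSelfAdjoint_resolvent]

theorem norm_fcalc_le {C : ℝ} (hC : 0 ≤ C) (h : ∀ r ∈ Set.Icc (0 : ℝ) 1, ‖f r‖ ≤ C) :
    ‖N.fcalc f‖ ≤ C :=
  norm_cfc_le hC fun _ hz => h _ (N.mem_spectrum_resolvent hz)

theorem fcalc_commute (f g : ℝ → ℂ) : Commute (N.fcalc f) (N.fcalc g) := cfc_commute_cfc _ _ _

theorem commute_fcalc_timeU (f : ℝ → ℂ) (t : ℝ) : Commute (N.fcalc f) (N.timeU t) := by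
  have h := N.commute_timeU_resolvent t
  refine Commute.cfc h ?_ _
  rw [N.isSelfAdjoint_resolvent.star_eq]
  exact h

theorem Rpow_eq_fcalc (ℓ : ℝ) : N.Rpow ℓ = N.fcalc fun r => ((r ^ ℓ : ℝ) : ℂ) := by
  rw [Rpow, CFC.rpow_eq_cfc_real N.resolvent_nonneg, cfc_real_eq_fcalc]

theorem Rpow_natCast (k : ℕ) : N.Rpow k = N.resolvent ^ k :=
  CFC.rpow_natCast _ _ N.resolvent_nonneg

theorem continuousOn_rpow {ℓ : ℝ} (hℓ : 0 ≤ ℓ) (s : Set ℝ) :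
    ContinuousOn (fun r : ℝ => ((r ^ ℓ : ℝ) : ℂ)) s :=
  (Complex.continuous_ofReal.comp (Real.continuous_rpow_const hℓ)).continuousOn

theorem Rpow_add {ℓ m : ℝ} (hℓ : 0 < ℓ) (hm : 0 < m) : N.Rpow (ℓ + m) = N.Rpow ℓ * N.Rpow m := by
  rw [Rpow_eq_fcalc, Rpow_eq_fcalc, Rpow_eq_fcalc,
    ← fcalc_mul _ (continuousOn_rpow hℓ.le _) (continuousOn_rpow hm.le _)]
  refine N.fcalc_congr fun r hr => ?_
  rw [Real.rpow_add' hr.1 (by positivity), Complex.ofReal_mul]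

theorem norm_Rpow_le {ℓ : ℝ} (hℓ : 0 ≤ ℓ) : ‖N.Rpow ℓ‖ ≤ 1 := by
  rw [Rpow_eq_fcalc]
  refine N.norm_fcalc_le zero_le_one fun r hr => ?_
  rw [Complex.norm_real, Real.norm_eq_abs, abs_of_nonneg (Real.rpow_nonneg hr.1 _)]
  exact Real.rpow_le_one hr.1 hr.2 hℓ

/-! ### Spectral projectors -/

/-- The range of `P(E)`, before taking the closure. -/
def energySubspace (E : ℝ) : Submodule ℂ 𝓗 :=
  ⨅ (f : C(ℝ, ℝ)) (_ : ∀ r ∈ Set.Icc (1 / (1 + E)) 1, f r = 0),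
    LinearMap.ker ((cfc f N.resolvent : 𝓗 →L[ℂ] 𝓗) : 𝓗 →ₗ[ℂ] 𝓗)

theorem mem_energySubspace {E : ℝ} {x : 𝓗} : x ∈ N.energySubspace E ↔
    ∀ f : C(ℝ, ℝ), (∀ r ∈ Set.Icc (1 / (1 + E)) 1, f r = 0) →
      (cfc f N.resolvent : 𝓗 →L[ℂ] 𝓗) x = 0 := by
  simp only [energySubspace, Submodule.mem_iInf]
  rfl

/-- The topological closure in the definition of `energyProj` therefore adds nothing. -/
theorem isClosed_energySubspace (E : ℝ) : IsClosed (N.energySubspace E : Set 𝓗) := by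
  have : (N.energySubspace E : Set 𝓗) = ⋂ (f : C(ℝ, ℝ))
      (_ : ∀ r ∈ Set.Icc (1 / (1 + E)) 1, f r = 0), {x | (cfc f N.resolvent : 𝓗 →L[ℂ] 𝓗) x = 0} := by
    ext x
    simp [mem_energySubspace]
  rw [this]
  exact isClosed_iInter fun f => isClosed_iInter fun _ =>
    isClosed_eq (ContinuousLinearMap.continuous _) continuous_const

theorem energyProj_mem (E : ℝ) (x : 𝓗) : N.energyProj E x ∈ N.energySubspace E := by
  have h : N.energyProj E x ∈ (N.energySubspace E).topologicalClosure :=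
    Submodule.starProjection_apply_mem _ _
  rwa [(N.isClosed_energySubspace E).submodule_topologicalClosure_eq] at h

theorem energyProj_eq_self {E : ℝ} {x : 𝓗} (hx : x ∈ N.energySubspace E) :
    N.energyProj E x = x :=
  Submodule.starProjection_eq_self_iff.2 ((N.energySubspace E).le_topologicalClosure hx)

theorem star_energyProj (E : ℝ) : star (N.energyProj E) = N.energyProj E :=
  isSelfAdjoint_starProjection _

theorem energyProj_mul_self (E : ℝ) : N.energyProj E * N.energyProj E = N.energyProj E :=
  ContinuousLinearMap.ext fun x => N.energyProj_eq_self (N.energyProj_mem E x)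

theorem norm_energyProj_le (E : ℝ) : ‖N.energyProj E‖ ≤ 1 := Submodule.starProjection_norm_le _

/-- The definition of `P(E)` tests only with real functions continuous on all of `ℝ`. A complex
function on `[0, 1]` is reduced to these by its real and imaginary parts, extended constantly beyond
the end points. -/
theorem fcalc_apply_eq_zero {E : ℝ} (hE : 0 < E) (hf : ContinuousOn f (Set.Icc 0 1))
    (h : ∀ r ∈ Set.Icc (1 / (1 + E)) 1, f r = 0) {x : 𝓗} (hx : x ∈ N.energySubspace E) :
    N.fcalc f x = 0 := by
  have hE1 : 0 ≤ 1 / (1 + E) := by positivity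
  have key : ∀ u : ℝ → ℝ, ContinuousOn u (Set.Icc 0 1) →
      (∀ r ∈ Set.Icc (1 / (1 + E)) 1, u r = 0) → N.fcalc (fun r => (u r : ℂ)) x = 0 := by
    intro u hu hu0
    have h1 := N.mem_energySubspace.1 hx
      ⟨Set.IccExtend zero_le_one (Set.domRestrict (Set.Icc 0 1) u),
        (continuousOn_iff_continuous_domRestrict.1 hu).Icc_extend'⟩ (fun r hr => by
        change Set.IccExtend zero_le_one (Set.domRestrict (Set.Icc 0 1) u) r = 0
        rw [Set.IccExtend_of_mem zero_le_one _ ⟨hE1.trans hr.1, hr.2⟩]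
        exact hu0 r hr)
    rw [cfc_real_eq_fcalc] at h1
    rw [← h1]
    congr 1
    refine N.fcalc_congr fun r hr => ?_
    rw [ContinuousMap.coe_mk, Set.IccExtend_of_mem zero_le_one _ hr]
    rfl
  have hre := Complex.continuous_re.comp_continuousOn hf
  have him := Complex.continuous_im.comp_continuousOn hf
  have hre' : ContinuousOn (fun r => ((f r).re : ℂ)) (Set.Icc 0 1) :=
    Complex.continuous_ofReal.comp_continuousOn hre
  have him' : ContinuousOn (fun r => ((f r).im : ℂ)) (Set.Icc 0 1) :=
    Complex.continuous_ofReal.comp_continuousOn him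
  have e : N.fcalc f = N.fcalc (fun r => ((f r).re : ℂ)) +
      Complex.I • N.fcalc (fun r => ((f r).im : ℂ)) := by
    rw [← fcalc_smul _ _ him', 
      ← N.fcalc_add (g := fun r => Complex.I * ((f r).im : ℂ)) hre' (continuousOn_const.mul him')]
    refine N.fcalc_congr fun r _ => ?_
    rw [mul_comm Complex.I, Complex.re_add_im]
  rw [e, add_apply, smul_apply,
    key (fun r => (f r).re) hre fun r hr => by rw [h r hr]; rfl,
    key (fun r => (f r).im) him fun r hr => by rw [h r hr]; rfl, smul_zero, add_zero]

theorem fcalc_mul_energyProj_eq_zero {E : ℝ} (hE : 0 < E) (hf : ContinuousOn f (Set.Icc 0 1))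
    (h : ∀ r ∈ Set.Icc (1 / (1 + E)) 1, f r = 0) : N.fcalc f * N.energyProj E = 0 :=
  ContinuousLinearMap.ext fun x => N.fcalc_apply_eq_zero hE hf h (N.energyProj_mem E x)

theorem fcalc_mul_energyProj_congr {E : ℝ} (hE : 0 < E) (hf : ContinuousOn f (Set.Icc 0 1))
    (hg : ContinuousOn g (Set.Icc 0 1)) (h : ∀ r ∈ Set.Icc (1 / (1 + E)) 1, f r = g r) :
    N.fcalc f * N.energyProj E = N.fcalc g * N.energyProj E := by
  rw [← sub_eq_zero, ← sub_mul, ← fcalc_sub _ hf hg]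
  exact N.fcalc_mul_energyProj_eq_zero hE (hf.sub hg) fun r hr => sub_eq_zero.2 (h r hr)

/-- If `u` vanishes where `f` may live, then `u f̄ = 0`; so the range of `f̄(R)` lies in that of
`P(E)`. Taking adjoints puts `P(E)` on the right. -/
theorem fcalc_mul_energyProj_eq_self {E : ℝ} (hf : ContinuousOn f (Set.Icc 0 1))
    (h : ∀ r ∈ Set.Icc 0 (1 / (1 + E)), f r = 0) : N.fcalc f * N.energyProj E = N.fcalc f := by
  have hc : ContinuousOn (fun r => conj (f r)) (Set.Icc 0 1) :=
    Complex.continuous_conj.comp_continuousOn hf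
  have h1 : N.energyProj E * N.fcalc (fun r => conj (f r)) = N.fcalc (fun r => conj (f r)) := by
    refine ContinuousLinearMap.ext fun x => N.energyProj_eq_self ?_
    refine N.mem_energySubspace.2 fun u hu => ?_
    change ((cfc u N.resolvent : 𝓗 →L[ℂ] 𝓗) * N.fcalc (fun r => conj (f r))) x = 0
    have hu' : ContinuousOn (fun r => (u r : ℂ)) (Set.Icc 0 1) :=
      (Complex.continuous_ofReal.comp u.continuous).continuousOn
    rw [cfc_real_eq_fcalc, ← fcalc_mul _ hu' hc]
    have : N.fcalc (fun r => (u r : ℂ) * conj (f r)) = 0 := by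
      rw [← N.fcalc_zero]
      refine N.fcalc_congr fun r hr => ?_
      rcases le_total r (1 / (1 + E)) with h2 | h2
      · rw [h r ⟨hr.1, h2⟩, map_zero, mul_zero]
      · rw [hu r ⟨h2, hr.2⟩, Complex.ofReal_zero, zero_mul]
    rw [this]
    rfl
  have h2 := congrArg star h1
  rw [star_mul, star_energyProj, fcalc_star] at h2
  simpa using h2

/-- Both `A` and `A*` leave the range of `P(E)` invariant, and a projector onto such a subspace
commutes with `A`. -/
theorem commute_energyProj {E : ℝ} {A : 𝓗 →L[ℂ] 𝓗}
    (h1 : ∀ f, Commute (N.fcalc f) A) (h2 : ∀ f, Commute (N.fcalc f) (star A)) :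
    Commute A (N.energyProj E) := by
  have key : ∀ B : 𝓗 →L[ℂ] 𝓗, (∀ f, Commute (N.fcalc f) B) →
      N.energyProj E * (B * N.energyProj E) = B * N.energyProj E := by
    intro B hB
    refine ContinuousLinearMap.ext fun x => N.energyProj_eq_self ?_
    refine N.mem_energySubspace.2 fun u hu => ?_
    have h3 := N.mem_energySubspace.1 (N.energyProj_mem E x) u hu
    rw [cfc_real_eq_fcalc] at h3 ⊢
    change (N.fcalc _ * B) (N.energyProj E x) = 0
    rw [(hB _).eq]
    change B (N.fcalc _ (N.energyProj E x)) = 0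
    rw [h3, map_zero]
  have h3 := key A h1
  have h4 := congrArg star (key (star A) h2)
  simp only [star_mul, star_star, star_energyProj] at h4
  change A * N.energyProj E = N.energyProj E * A
  rw [← h3, ← h4, mul_assoc]

theorem commute_fcalc_energyProj (f : ℝ → ℂ) (E : ℝ) : Commute (N.fcalc f) (N.energyProj E) :=
  N.commute_energyProj (fun g => N.fcalc_commute g f) fun g => by
    rw [fcalc_star]; exact N.fcalc_commute _ _

theorem commute_timeU_energyProj (t E : ℝ) : Commute (N.timeU t) (N.energyProj E) :=
  N.commute_energyProj (fun g => N.commute_fcalc_timeU g t) fun g => by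
    rw [star_timeU]; exact N.commute_fcalc_timeU _ _

/-- The function `r - min(r, (1+E)⁻¹)` is supported in the spectral interval of `P(E)`, so on the
complement of `P(E)` the operator `R` may be replaced by `min(R, (1+E)⁻¹)`. -/
theorem norm_resolvent_mul_one_sub_energyProj {E : ℝ} (hE : 0 < E) :
    ‖N.resolvent * (1 - N.energyProj E)‖ ≤ 1 / (1 + E) := by
  have ha : 0 ≤ 1 / (1 + E) := by positivity
  have hc1 : ContinuousOn (fun r : ℝ => (r : ℂ)) (Set.Icc 0 1) :=
    Complex.continuous_ofReal.continuousOn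
  have hc2 : ContinuousOn (fun r : ℝ => ((min r (1 / (1 + E)) : ℝ) : ℂ)) (Set.Icc 0 1) := by
    fun_prop
  have h1 : (N.resolvent - N.fcalc (fun r : ℝ => ((min r (1 / (1 + E)) : ℝ) : ℂ))) *
      (1 - N.energyProj E) = 0 := by
    rw [← N.fcalc_id, ← fcalc_sub _ hc1 hc2, mul_sub, mul_one, sub_eq_zero]
    refine (N.fcalc_mul_energyProj_eq_self (hc1.sub hc2) fun r hr => ?_).symm
    simp only [Pi.sub_apply, min_eq_left hr.2, sub_self]
  rw [sub_mul, sub_eq_zero] at h1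
  rw [h1]
  have h2 : ‖1 - N.energyProj E‖ ≤ 1 := by
    have : 1 - N.energyProj E = (N.energySubspace E).topologicalClosureᗮ.starProjection := by
      rw [Submodule.starProjection_orthogonal]; rfl
    rw [this]
    exact Submodule.starProjection_norm_le _
  have h3 : ‖N.fcalc (fun r : ℝ => ((min r (1 / (1 + E)) : ℝ) : ℂ))‖ ≤ 1 / (1 + E) := by
    refine N.norm_fcalc_le ha fun r hr => ?_
    rw [Complex.norm_real, Real.norm_eq_abs, abs_of_nonneg (le_min hr.1 ha)]
    exact min_le_right _ _
  calc _ ≤ _ := norm_mul_le _ _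
    _ ≤ 1 / (1 + E) * 1 := by gcongr
    _ = _ := mul_one _

/-- On the dense domain of `H` convergence is quantitative by the preceding bound; the contractions
`P(E)` carry it to all vectors. -/
theorem tendsto_energyProj (x : 𝓗) : Tendsto (fun E => N.energyProj E x) atTop (𝓝 x) := by
  rw [tendsto_iff_norm_sub_tendsto_zero]
  refine Metric.tendsto_atTop.2 fun ε hε => ?_
  obtain ⟨z, hz, hxz⟩ := Metric.mem_closure_iff.1 (N.dense_domain_hamiltonian x) (ε / 4) (by positivity)
  set y := N.onePlusH ⟨z, hz⟩ with hy
  have hzy : z = N.resolvent y := (N.resolvent_onePlusH ⟨z, hz⟩).symm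
  refine ⟨max 1 (4 * (‖y‖ + 1) / ε), fun E hE => ?_⟩
  have hE1 : 0 < E := lt_of_lt_of_le one_pos ((le_max_left _ _).trans hE)
  have hE2 : 4 * (‖y‖ + 1) / ε ≤ E := (le_max_right _ _).trans hE
  have e1 : ‖N.energyProj E z - z‖ ≤ 1 / (1 + E) * ‖y‖ := by
    have : N.energyProj E z - z = -((N.resolvent * (1 - N.energyProj E)) y) := by
      have hc : Commute N.resolvent (N.energyProj E) := by
        rw [← fcalc_id]; exact N.commute_fcalc_energyProj _ _
      rw [mul_sub, mul_one, hc.eq, hzy]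
      change _ = -(N.resolvent y - N.energyProj E (N.resolvent y))
      abel
    rw [this, norm_neg]
    exact (ContinuousLinearMap.le_opNorm _ _).trans
      (mul_le_mul_of_nonneg_right (N.norm_resolvent_mul_one_sub_energyProj hE1) (norm_nonneg _))
  have e2 : 1 / (1 + E) * ‖y‖ ≤ ε / 4 := by
    rw [div_le_iff₀ hε] at hE2
    rw [one_div, inv_mul_le_iff₀ (by positivity)]
    nlinarith [norm_nonneg y]
  have e3 : ‖N.energyProj E (x - z)‖ ≤ ‖x - z‖ := by
    have := (N.energyProj E).le_of_opNorm_le (N.norm_energyProj_le E) (x - z)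
    rwa [one_mul] at this
  have e4 : N.energyProj E x - x = N.energyProj E (x - z) + (N.energyProj E z - z) - (x - z) := by
    rw [map_sub]; abel
  rw [dist_eq_norm] at hxz
  rw [Real.dist_eq, sub_zero, abs_norm, e4]
  calc _ ≤ _ := norm_sub_le _ _
    _ ≤ ‖N.energyProj E (x - z)‖ + ‖N.energyProj E z - z‖ + ‖x - z‖ := by
      gcongr; exact norm_add_le _ _
    _ < ε := by linarith

/-- On the range of `P(E)`, the operator `(1+H)^ℓ` is bounded. -/
theorem Rpow_mul_cut_mul_energyProj {E : ℝ} (hE : 0 < E) {ℓ : ℝ} (hℓ : 0 ≤ ℓ) :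
    N.Rpow ℓ * (N.fcalc (fun r => (((max r (1 / (1 + E))) ^ (-ℓ) : ℝ) : ℂ)) * N.energyProj E) =
      N.energyProj E := by
  have ha : 0 < 1 / (1 + E) := by positivity
  have hc : ContinuousOn (fun r : ℝ => (((max r (1 / (1 + E))) ^ (-ℓ) : ℝ) : ℂ)) (Set.Icc 0 1) := by
    refine (Complex.continuous_ofReal.comp (Continuous.rpow_const (by fun_prop) fun r => ?_)).continuousOn
    exact Or.inl (lt_of_lt_of_le ha (le_max_right _ _)).ne'
  rw [← mul_assoc, Rpow_eq_fcalc, ← fcalc_mul _ (continuousOn_rpow hℓ _) hc]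
  conv_rhs => rw [← one_mul (N.energyProj E), ← N.fcalc_one]
  refine N.fcalc_mul_energyProj_congr hE ((continuousOn_rpow hℓ _).mul hc) continuousOn_const
    fun r hr => ?_
  have hr0 : 0 < r := lt_of_lt_of_le ha hr.1
  rw [max_eq_left hr.1, ← Complex.ofReal_mul, ← Real.rpow_add hr0, add_neg_cancel, Real.rpow_zero,
    Complex.ofReal_one]

theorem energyProj_mem_smoothVectors {E : ℝ} (hE : 0 < E) (x : 𝓗) :
    N.energyProj E x ∈ N.smoothVectors := by
  simp only [smoothVectors, Submodule.mem_iInf]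
  intro ℓ hℓ
  refine ⟨(N.fcalc (fun r => (((max r (1 / (1 + E))) ^ (-ℓ) : ℝ) : ℂ)) * N.energyProj E) x, ?_⟩
  conv_rhs => rw [← N.Rpow_mul_cut_mul_energyProj hE hℓ.le]
  rfl

theorem dense_smoothVectors : Dense (N.smoothVectors : Set 𝓗) := fun x =>
  mem_closure_of_tendsto (N.tendsto_energyProj x)
    ((eventually_gt_atTop 0).mono fun _ hE => N.energyProj_mem_smoothVectors hE x)

theorem smoothVectors_of_commute {A : 𝓗 →L[ℂ] 𝓗} (hA : ∀ ℓ, 0 < ℓ → Commute (N.Rpow ℓ) A) {x : 𝓗}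
    (hx : x ∈ N.smoothVectors) : A x ∈ N.smoothVectors := by
  simp only [smoothVectors, Submodule.mem_iInf] at hx ⊢
  intro ℓ hℓ
  obtain ⟨y, hy⟩ := hx ℓ hℓ
  refine ⟨A y, ?_⟩
  rw [← hy]
  exact congrArg (fun B : 𝓗 →L[ℂ] 𝓗 => B y) (hA ℓ hℓ).eq

theorem fcalc_mem_smoothVectors (f : ℝ → ℂ) {x : 𝓗} (hx : x ∈ N.smoothVectors) :
    N.fcalc f x ∈ N.smoothVectors :=
  N.smoothVectors_of_commute (fun ℓ _ => by rw [Rpow_eq_fcalc]; exact N.fcalc_commute _ _) hx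

theorem injective_resolvent : Function.Injective N.resolvent := by
  refine (injective_iff_map_eq_zero _).2 fun y hy => ?_
  have h := N.resolvent_add_hamiltonian y
  have h0 : (⟨N.resolvent y, N.resolvent_mem_domain y⟩ : N.hamiltonian.domain) = 0 :=
    Subtype.ext hy
  rw [h0, LinearPMap.map_zero, hy, add_zero] at h
  exact h.symm

theorem injective_Rpow {ℓ : ℝ} (hℓ : 0 < ℓ) : Function.Injective (N.Rpow ℓ) := by
  refine (injective_iff_map_eq_zero _).2 fun y hy => ?_
  obtain ⟨k, hk⟩ := exists_nat_gt ℓ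
  have h1 : N.Rpow k y = 0 := by
    have := N.Rpow_add (ℓ := k - ℓ) (m := ℓ) (by linarith) hℓ
    rw [sub_add_cancel] at this
    rw [this]
    change N.Rpow _ (N.Rpow ℓ y) = 0
    rw [hy, map_zero]
  rw [Rpow_natCast] at h1
  have h2 : ∀ m : ℕ, ∀ z : 𝓗, (N.resolvent ^ m) z = 0 → z = 0 := by
    intro m
    induction m with
    | zero => intro z hz; simpa using hz
    | succ m ih =>
      intro z hz
      rw [pow_succ] at hz
      exact (injective_iff_map_eq_zero _).1 N.injective_resolvent z (ih _ hz)
  exact h2 k y h1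

/-- `(1+H)^ℓ` preserves smoothness. -/
theorem exists_Rpow_eq {ℓ : ℝ} (hℓ : 0 < ℓ) {x : 𝓗} (hx : x ∈ N.smoothVectors) :
    ∃ y ∈ N.smoothVectors, N.Rpow ℓ y = x := by
  simp only [smoothVectors, Submodule.mem_iInf] at hx ⊢
  obtain ⟨y, hy⟩ := hx ℓ hℓ
  refine ⟨y, fun m hm => ?_, hy⟩
  -- Now `R^ℓ y = x = R^ℓ R^m z`, and injectivity of `R^ℓ` identifies `y` with `R^m z`.
  obtain ⟨z, hz⟩ := hx (m + ℓ) (by positivity)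
  refine ⟨z, N.injective_Rpow hℓ ?_⟩
  refine Eq.trans ?_ (hz.trans hy.symm)
  rw [add_comm m, N.Rpow_add hℓ hm]
  rfl

end LocalNet

end QI

namespace QI

variable {n : ℕ} {𝓗 : Type*} [NormedAddCommGroup 𝓗] [InnerProductSpace ℂ 𝓗] [CompleteSpace 𝓗]

namespace LocalNet

variable (N : LocalNet n 𝓗)

/-! ### Estimates for smooth functionals and fields -/

variable {N} in
theorem SmoothFunctional.val_sub_apply (σ τ : N.SmoothFunctional) (A : 𝓗 →L[ℂ] 𝓗) :
    (σ - τ).val A = σ.val A - τ.val A := rfl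

theorem energyBound_normFun {ℓ : ℝ} (hℓ : 0 < ℓ) (σ : N.SmoothFunctional) :
    N.EnergyBound ℓ σ.val (N.normFun ℓ σ.val) :=
  N.normFun_spec (N.mem_smooth_iff.1 σ.2 ℓ hℓ).2

theorem normFun_nonneg {ℓ : ℝ} (hℓ : 0 < ℓ) (σ : N.SmoothFunctional) : 0 ≤ N.normFun ℓ σ.val :=
  (N.energyBound_normFun hℓ σ).1

theorem norm_val_apply_le {ℓ : ℝ} (hℓ : 0 < ℓ) (σ : N.SmoothFunctional) (B : 𝓗 →L[ℂ] 𝓗) :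
    ‖σ.val B‖ ≤ N.normFun ℓ σ.val * ‖N.Rpow ℓ * B * N.Rpow ℓ‖ :=
  (N.energyBound_normFun hℓ σ).2 B

theorem norm_mul₃_le_of_le {A B C : 𝓗 →L[ℂ] 𝓗} {a c : ℝ} (hA : ‖A‖ ≤ a) (hC : ‖C‖ ≤ c) :
    ‖A * B * C‖ ≤ a * c * ‖B‖ := by
  have ha : 0 ≤ a := (norm_nonneg _).trans hA
  calc _ ≤ ‖A‖ * ‖B‖ * ‖C‖ := norm_mul₃_le
    _ ≤ a * ‖B‖ * c := by gcongr
    _ = _ := by ring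

theorem normFun_mono {ℓ m : ℝ} (hℓ : 0 < ℓ) (h : ℓ ≤ m) (σ : N.SmoothFunctional) :
    N.normFun ℓ σ.val ≤ N.normFun m σ.val := by
  rcases h.eq_or_lt with rfl | h
  · exact le_rfl
  refine N.normFun_le ⟨N.normFun_nonneg (hℓ.trans h) σ, fun B => ?_⟩
  refine (N.norm_val_apply_le (hℓ.trans h) σ B).trans ?_
  refine mul_le_mul_of_nonneg_left ?_ (N.normFun_nonneg (hℓ.trans h) σ)
  have e1 : N.Rpow m = N.Rpow (m - ℓ) * N.Rpow ℓ := by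
    rw [← N.Rpow_add (sub_pos.2 h) hℓ, sub_add_cancel]
  have e2 : N.Rpow m = N.Rpow ℓ * N.Rpow (m - ℓ) := by
    rw [← N.Rpow_add hℓ (sub_pos.2 h), add_sub_cancel]
  have e3 : N.Rpow m * B * N.Rpow m =
      N.Rpow (m - ℓ) * (N.Rpow ℓ * B * N.Rpow ℓ) * N.Rpow (m - ℓ) := by
    conv_lhs => rw [e2]
    conv_lhs => enter [1, 1]; rw [← e2, e1]
    simp only [mul_assoc]
  rw [e3]
  have h1 := N.norm_Rpow_le (sub_pos.2 h).le
  refine (norm_mul₃_le_of_le h1 h1).trans_eq (by ring)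

theorem commute_Rpow_energyProj (ℓ E : ℝ) : Commute (N.Rpow ℓ) (N.energyProj E) := by
  rw [Rpow_eq_fcalc]
  exact N.commute_fcalc_energyProj _ _

theorem normFun_sandwich_le {ℓ : ℝ} (hℓ : 0 < ℓ) (σ : N.SmoothFunctional) {C D : 𝓗 →L[ℂ] 𝓗}
    (hC : Commute (N.Rpow ℓ) C) (hD : Commute (N.Rpow ℓ) D) (hC1 : ‖C‖ ≤ 1) (hD1 : ‖D‖ ≤ 1) :
    N.EnergyBound ℓ (sandwichFunctional C D σ.val) (N.normFun ℓ σ.val) := by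
  refine ⟨N.normFun_nonneg hℓ σ, fun B => ?_⟩
  rw [sandwichFunctional_apply]
  refine (N.norm_val_apply_le hℓ σ _).trans ?_
  refine mul_le_mul_of_nonneg_left ?_ (N.normFun_nonneg hℓ σ)
  have : N.Rpow ℓ * (C * B * D) * N.Rpow ℓ = C * (N.Rpow ℓ * B * N.Rpow ℓ) * D := by
    calc _ = (N.Rpow ℓ * C) * B * (D * N.Rpow ℓ) := by simp only [mul_assoc]
      _ = _ := by rw [hC.eq, ← hD.eq]; simp only [mul_assoc]
  rw [this]
  exact (norm_mul₃_le_of_le hC1 hD1).trans_eq (by ring)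

/-- The energy-bounded functional `σ(P(E) · P(E))`. -/
def truncate (E : ℝ) (σ : N.SmoothFunctional) : N.SmoothFunctional :=
  ⟨sandwichFunctional (N.energyProj E) (N.energyProj E) σ.val, N.mem_smooth_iff.2 fun ℓ hℓ =>
    ⟨sandwichFunctional_mem _ _ (N.mem_smooth_iff.1 σ.2 ℓ hℓ).1, _,
      N.normFun_sandwich_le hℓ σ (N.commute_Rpow_energyProj _ _) (N.commute_Rpow_energyProj _ _)
        (N.norm_energyProj_le E) (N.norm_energyProj_le E)⟩⟩

theorem truncate_val (E : ℝ) (σ : N.SmoothFunctional) (A : 𝓗 →L[ℂ] 𝓗) :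
    (N.truncate E σ).val A = σ.val (N.energyProj E * A * N.energyProj E) := rfl

theorem translate_val (s : ℝ) (σ : N.SmoothFunctional) (A : 𝓗 →L[ℂ] 𝓗) :
    (N.translate s σ).val A = σ.val (N.timeU s * A * star (N.timeU s)) := rfl

theorem energyBounded_truncate (E : ℝ) (σ : N.SmoothFunctional) :
    N.EnergyBounded E (N.truncate E σ) :=
  ⟨σ.val, (N.mem_smooth_iff.1 σ.2 1 one_pos).1, fun A => N.truncate_val E σ A⟩

theorem truncate_translate (E s : ℝ) (σ : N.SmoothFunctional) :
    N.truncate E (N.translate s σ) = N.translate s (N.truncate E σ) := by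
  refine SmoothFunctional.ext fun A => ?_
  rw [truncate_val, translate_val, translate_val, truncate_val]
  have h1 := (N.commute_timeU_energyProj s E).eq
  have h2 : star (N.timeU s) * N.energyProj E = N.energyProj E * star (N.timeU s) := by
    rw [star_timeU]; exact N.commute_timeU_energyProj _ _
  congr 1
  calc _ = (N.timeU s * N.energyProj E) * A * (N.energyProj E * star (N.timeU s)) := by
        simp only [mul_assoc]
    _ = _ := by rw [h1, ← h2]; simp only [mul_assoc]

theorem normFun_translate_le {ℓ : ℝ} (hℓ : 0 < ℓ) (s : ℝ) (σ : N.SmoothFunctional) :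
    N.normFun ℓ (N.translate s σ).val ≤ N.normFun ℓ σ.val :=
  N.normFun_le (N.normFun_sandwich_le hℓ σ (N.commute_timeU_Rpow s ℓ)
    (by rw [star_timeU]; exact N.commute_timeU_Rpow _ ℓ) (N.norm_timeU_le s)
    (by rw [star_timeU]; exact N.norm_timeU_le _))

/-- The functionals `σ` and `σ(C · D)` are close in `‖ · ‖_ℓ` if `R (C - 1)` and `(D - 1) R` are
small. -/
theorem normFun_sub_sandwich_le {ℓ : ℝ} (hℓ : 0 < ℓ) (σ τ : N.SmoothFunctional)
    {C D : 𝓗 →L[ℂ] 𝓗} {a : ℝ} (hτ : ∀ A, τ.val A = σ.val (C * A * D))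
    (hC : Commute (N.Rpow ℓ) C) (hD : Commute (N.Rpow ℓ) D) (hD1 : ‖D‖ ≤ 1)
    (hCa : ‖N.Rpow 1 * (1 - C)‖ ≤ a) (hDa : ‖(1 - D) * N.Rpow 1‖ ≤ a) :
    N.normFun ℓ (σ - τ).val ≤ 2 * a * N.normFun (ℓ + 1) σ.val := by
  have ha : 0 ≤ a := (norm_nonneg _).trans hCa
  have hσ := N.normFun_nonneg (add_pos hℓ one_pos) σ
  refine N.normFun_le ⟨by positivity, fun B => ?_⟩
  have hR1 : ‖N.Rpow 1‖ ≤ 1 := N.norm_Rpow_le zero_le_one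
  have e1 : N.Rpow (ℓ + 1) = N.Rpow ℓ * N.Rpow 1 := N.Rpow_add hℓ one_pos
  have e2 : N.Rpow (ℓ + 1) = N.Rpow 1 * N.Rpow ℓ := by
    rw [add_comm, N.Rpow_add one_pos hℓ]
  have hC' : Commute (N.Rpow ℓ) (1 - C) := (Commute.one_right _).sub_right hC
  have hD' : Commute (N.Rpow ℓ) (1 - D) := (Commute.one_right _).sub_right hD
  -- Telescoping `B - CBD = (1-C)BD + B(1-D)`: after commuting past `R^ℓ`, the spare factor `R`
  -- meets the small difference in each term.
  have e3 : N.Rpow (ℓ + 1) * (B - C * B * D) * N.Rpow (ℓ + 1) =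
      (N.Rpow 1 * (1 - C)) * (N.Rpow ℓ * B * N.Rpow ℓ) * (D * N.Rpow 1) +
        N.Rpow 1 * (N.Rpow ℓ * B * N.Rpow ℓ) * ((1 - D) * N.Rpow 1) := by
    calc _ = N.Rpow 1 * N.Rpow ℓ * ((1 - C) * B * D + B * (1 - D)) * (N.Rpow ℓ * N.Rpow 1) := by
          rw [← e1, ← e2]
          congr 2
          noncomm_ring
      _ = N.Rpow 1 * (N.Rpow ℓ * (1 - C)) * B * (D * N.Rpow ℓ) * N.Rpow 1 +
          N.Rpow 1 * N.Rpow ℓ * B * ((1 - D) * N.Rpow ℓ) * N.Rpow 1 := by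
          rw [mul_add, add_mul]
          simp only [mul_assoc]
      _ = _ := by
          rw [hC'.eq, ← hD'.eq, ← hD.eq]
          simp only [mul_assoc]
  have hDR : ‖D * N.Rpow 1‖ ≤ 1 := by
    calc _ ≤ ‖D‖ * ‖N.Rpow 1‖ := norm_mul_le _ _
      _ ≤ 1 * 1 := by gcongr
      _ = 1 := one_mul 1
  rw [SmoothFunctional.val_sub_apply, hτ, ← map_sub]
  refine (N.norm_val_apply_le (add_pos hℓ one_pos) σ _).trans ?_
  rw [e3]
  calc _ ≤ N.normFun (ℓ + 1) σ.val * (a * 1 * ‖N.Rpow ℓ * B * N.Rpow ℓ‖ +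
        1 * a * ‖N.Rpow ℓ * B * N.Rpow ℓ‖) := by
        gcongr
        refine (norm_add_le _ _).trans (add_le_add ?_ ?_)
        · exact norm_mul₃_le_of_le hCa hDR
        · exact norm_mul₃_le_of_le hR1 hDa
    _ = _ := by ring

theorem Rpow_one : N.Rpow 1 = N.resolvent := CFC.rpow_one _ N.resolvent_nonneg

theorem normFun_sub_truncate_le {ℓ : ℝ} (hℓ : 0 < ℓ) {E : ℝ} (hE : 0 < E)
    (σ : N.SmoothFunctional) :
    N.normFun ℓ (σ - N.truncate E σ).val ≤ 2 * (1 / (1 + E)) * N.normFun (ℓ + 1) σ.val := by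
  have h := N.norm_resolvent_mul_one_sub_energyProj hE
  refine N.normFun_sub_sandwich_le hℓ σ _ (fun A => rfl) (N.commute_Rpow_energyProj _ _)
    (N.commute_Rpow_energyProj _ _) (N.norm_energyProj_le E) (by rwa [Rpow_one]) ?_
  have hc : Commute (1 - N.energyProj E) (N.Rpow 1) :=
    ((Commute.one_right _).sub_right (N.commute_Rpow_energyProj 1 E)).symm
  rwa [hc.eq, Rpow_one]

theorem normFun_sub_translate_le {ℓ : ℝ} (hℓ : 0 < ℓ) (s : ℝ) (σ : N.SmoothFunctional) :
    N.normFun ℓ (σ - N.translate s σ).val ≤ 2 * |s| * N.normFun (ℓ + 1) σ.val := by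
  have key : ∀ t : ℝ, ‖(1 - N.timeU t) * N.Rpow 1‖ ≤ |t| := fun t => by
    have := N.norm_timeU_sub_resolvent t
    rwa [← norm_neg, ← neg_mul, neg_sub, ← Rpow_one] at this
  refine N.normFun_sub_sandwich_le hℓ σ _ (fun A => rfl) (N.commute_timeU_Rpow _ _)
    (by rw [star_timeU]; exact N.commute_timeU_Rpow _ _)
    (by rw [star_timeU]; exact N.norm_timeU_le _) ?_ ?_
  · have hc : Commute (N.Rpow 1) (1 - N.timeU s) :=
      (Commute.one_right _).sub_right (N.commute_timeU_Rpow s 1)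
    rw [hc.eq]
    exact key s
  · rw [star_timeU]
    simpa using key (-s)

theorem translate_translate (s t : ℝ) (σ : N.SmoothFunctional) :
    N.translate s (N.translate t σ) = N.translate (t + s) σ := by
  refine SmoothFunctional.ext fun A => ?_
  rw [translate_val, translate_val, translate_val, ← timeU_mul, star_mul]
  simp only [mul_assoc]

theorem translate_sub (s : ℝ) (σ τ : N.SmoothFunctional) :
    N.translate s (σ - τ) = N.translate s σ - N.translate s τ := rfl

theorem translate_add (s : ℝ) (σ τ : N.SmoothFunctional) :
    N.translate s (σ + τ) = N.translate s σ + N.translate s τ := rfl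

theorem translate_smul (s : ℝ) (c : ℂ) (σ : N.SmoothFunctional) :
    N.translate s (c • σ) = c • N.translate s σ := rfl

theorem normFun_translate_sub_translate_le {ℓ : ℝ} (hℓ : 0 < ℓ) (s t : ℝ)
    (σ : N.SmoothFunctional) :
    N.normFun ℓ (N.translate s σ - N.translate t σ).val ≤
      2 * |t - s| * N.normFun (ℓ + 1) σ.val := by
  have e : N.translate s σ - N.translate t σ = N.translate s (σ - N.translate (t - s) σ) := by
    rw [translate_sub, translate_translate, sub_add_cancel]
  rw [e]
  exact (N.normFun_translate_le hℓ s _).trans (N.normFun_sub_translate_le hℓ (t - s) σ)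

theorem vecSmooth_val (u v : N.smoothVectors) (A : 𝓗 →L[ℂ] 𝓗) :
    (N.vecSmooth u v).val A = ⟪(u : 𝓗), A (v : 𝓗)⟫_ℂ := rfl

theorem inner_Rpow_left (ℓ : ℝ) (x y : 𝓗) : ⟪N.Rpow ℓ x, y⟫_ℂ = ⟪x, N.Rpow ℓ y⟫_ℂ := by
  conv_lhs => rw [← N.star_Rpow ℓ, ContinuousLinearMap.star_eq_adjoint,
    ContinuousLinearMap.adjoint_inner_left]

theorem normFun_vecSmooth_le (ℓ : ℝ) (u v : N.smoothVectors) {u' v' : 𝓗}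
    (hu : N.Rpow ℓ u' = u) (hv : N.Rpow ℓ v' = v) :
    N.normFun ℓ (N.vecSmooth u v).val ≤ ‖u'‖ * ‖v'‖ := by
  refine N.normFun_le ⟨by positivity, fun B => ?_⟩
  rw [vecSmooth_val, ← hu, ← hv, inner_Rpow_left]
  calc _ ≤ ‖u'‖ * ‖(N.Rpow ℓ * B * N.Rpow ℓ) v'‖ := norm_inner_le_norm _ _
    _ ≤ ‖u'‖ * (‖N.Rpow ℓ * B * N.Rpow ℓ‖ * ‖v'‖) := by
      gcongr
      exact ContinuousLinearMap.le_opNorm _ _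
    _ = _ := by ring

theorem truncate_vecSmooth (E : ℝ) (u v : N.smoothVectors)
    (hu : N.energyProj E u ∈ N.smoothVectors) (hv : N.energyProj E v ∈ N.smoothVectors) :
    N.truncate E (N.vecSmooth u v) = N.vecSmooth ⟨_, hu⟩ ⟨_, hv⟩ := by
  refine SmoothFunctional.ext fun A => ?_
  rw [truncate_val, vecSmooth_val, vecSmooth_val]
  change ⟪(u : 𝓗), N.energyProj E (A (N.energyProj E v))⟫_ℂ = _
  conv_lhs => rw [← N.star_energyProj E, ContinuousLinearMap.star_eq_adjoint,
    ContinuousLinearMap.adjoint_inner_right, ← ContinuousLinearMap.star_eq_adjoint,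
    N.star_energyProj E]

theorem conjSmooth_val (σ : N.SmoothFunctional) (A : 𝓗 →L[ℂ] 𝓗) :
    (N.conjSmooth σ).val A = conj (σ.val (star A)) := rfl

theorem conjSmooth_conjSmooth (σ : N.SmoothFunctional) : N.conjSmooth (N.conjSmooth σ) = σ := by
  refine SmoothFunctional.ext fun A => ?_
  rw [conjSmooth_val, conjSmooth_val, star_star, Complex.conj_conj]

theorem conjSmooth_vecSmooth (u v : N.smoothVectors) :
    N.conjSmooth (N.vecSmooth u v) = N.vecSmooth v u := by
  refine SmoothFunctional.ext fun A => ?_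
  rw [conjSmooth_val, vecSmooth_val, vecSmooth_val, inner_conj_symm,
    ContinuousLinearMap.star_eq_adjoint, ContinuousLinearMap.adjoint_inner_left]

theorem conjSmooth_translate (s : ℝ) (σ : N.SmoothFunctional) :
    N.conjSmooth (N.translate s σ) = N.translate s (N.conjSmooth σ) := by
  refine SmoothFunctional.ext fun A => ?_
  rw [conjSmooth_val, translate_val, translate_val, conjSmooth_val]
  simp [mul_assoc]

theorem conjSmooth_truncate (E : ℝ) (σ : N.SmoothFunctional) :
    N.conjSmooth (N.truncate E σ) = N.truncate E (N.conjSmooth σ) := by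
  refine SmoothFunctional.ext fun A => ?_
  rw [conjSmooth_val, truncate_val, truncate_val, conjSmooth_val]
  simp [mul_assoc, star_energyProj]

theorem conjField_apply (φ : N.SmoothDual) (σ : N.SmoothFunctional) :
    N.conjField φ σ = conj (φ (N.conjSmooth σ)) := rfl

/-- Continuity in the Fréchet topology involves finitely many norms, and these increase with `ℓ`, so
one index suffices. An integer is chosen because the damping operators below carry integer powers of
`1 + H`. -/
theorem exists_dualBound (φ : N.SmoothDual) :
    ∃ k : ℕ, 0 < k ∧ ∃ C : ℝ, 0 ≤ C ∧ N.DualBound k φ C := by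
  let q : Seminorm ℂ N.SmoothFunctional :=
    (normSeminorm ℂ ℂ).comp ((WeakDual.toStrongDual φ : N.SmoothFunctional →L[ℂ] ℂ) :
      N.SmoothFunctional →ₗ[ℂ] ℂ)
  have hq : Continuous q := (map_continuous φ).norm
  obtain ⟨s, C, -, hC⟩ := Seminorm.bound_of_continuous N.withSeminorms q hq
  obtain ⟨M, hM⟩ := (s.image (Subtype.val : {ℓ : ℝ // 0 < ℓ} → ℝ)).exists_le
  obtain ⟨k, hk⟩ := exists_nat_ge M
  have hk1 : (0 : ℝ) < (k + 1 : ℕ) := by positivity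
  have hs : s.sup N.energySeminorm ≤ N.energySeminorm ⟨(k + 1 : ℕ), hk1⟩ := by
    refine Finset.sup_le fun i hi => ?_
    intro σ
    refine N.normFun_mono i.2 ?_ σ
    have := hM i (Finset.mem_image_of_mem _ hi)
    push_cast
    linarith
  refine ⟨k + 1, k.succ_pos, C, C.2, fun σ => ?_⟩
  calc ‖φ σ‖ = q σ := rfl
    _ ≤ C * s.sup N.energySeminorm σ := hC σ
    _ ≤ C * N.energySeminorm ⟨(k + 1 : ℕ), hk1⟩ σ := mul_le_mul_of_nonneg_left (hs σ) C.2
    _ = _ := rfl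

theorem continuous_field_translate (φ : N.SmoothDual) (σ : N.SmoothFunctional) :
    Continuous fun s : ℝ => φ (N.translate s σ) := by
  obtain ⟨k, hk, C, hC, h⟩ := N.exists_dualBound φ
  have hk' : (0 : ℝ) < k := by exact_mod_cast hk
  refine (LipschitzWith.of_dist_le_mul (K := ⟨C * (2 * N.normFun (k + 1) σ.val),
    mul_nonneg hC (mul_nonneg zero_le_two (N.normFun_nonneg (by positivity) σ))⟩)
    fun s t => ?_).continuous
  rw [dist_eq_norm, ← map_sub]
  refine (h _).trans ((mul_le_mul_of_nonneg_left
    (N.normFun_translate_sub_translate_le hk' s t σ) hC).trans_eq ?_)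
  rw [dist_comm, Real.dist_eq]
  change _ = C * (2 * N.normFun (k + 1) σ.val) * |t - s|
  ring

end LocalNet

end QI

namespace QI

variable {n : ℕ} {𝓗 : Type*} [NormedAddCommGroup 𝓗] [InnerProductSpace ℂ 𝓗] [CompleteSpace 𝓗]

/-! ### Bounded forms on dense subspaces -/

/-- The Riesz theorem represents `x ↦ b x y` for each fixed `y`; density makes the representing
vector linear in `y` and extends it. -/
theorem exists_operator_of_form {S : Submodule ℂ 𝓗} (hS : Dense (S : Set 𝓗)) (b : S → S → ℂ)
    (hl : ∀ x x' y, b (x + x') y = b x y + b x' y) (hl' : ∀ (c : ℂ) x y, b (c • x) y = conj c * b x y)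
    (hr : ∀ x y y', b x (y + y') = b x y + b x y') (hr' : ∀ (c : ℂ) x y, b x (c • y) = c * b x y)
    {C : ℝ} (hb : ∀ x y, ‖b x y‖ ≤ C * (‖x‖ * ‖y‖)) :
    ∃ B : 𝓗 →L[ℂ] 𝓗, ∀ x y : S, ⟪(x : 𝓗), B y⟫_ℂ = b x y := by
  have hd : DenseRange S.subtype := by
    rw [DenseRange, Submodule.coe_subtype, Subtype.range_coe]
    exact hS
  have h1 : ∀ y : S, ∃ z : 𝓗, (∀ x : S, ⟪(x : 𝓗), z⟫_ℂ = b x y) ∧ ‖z‖ ≤ |C| * ‖y‖ := by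
    intro y
    let F : S →ₗ[ℂ] ℂ :=
      { toFun := fun x => conj (b x y)
        map_add' := fun x x' => by rw [hl, map_add]
        map_smul' := fun c x => by rw [hl', map_mul, Complex.conj_conj]; rfl }
    have hF : ∀ x : S, ‖F x‖ ≤ |C| * ‖y‖ * ‖S.subtype x‖ := fun x => by
      change ‖conj (b x y)‖ ≤ _
      rw [RCLike.norm_conj]
      refine (hb x y).trans ?_
      change _ ≤ |C| * ‖y‖ * ‖x‖
      have := mul_le_mul_of_nonneg_right (le_abs_self C) (mul_nonneg (norm_nonneg x) (norm_nonneg y))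
      linarith
    refine ⟨(InnerProductSpace.toDual ℂ 𝓗).symm (F.extendOfNorm S.subtype), fun x => ?_, ?_⟩
    · rw [← inner_conj_symm, InnerProductSpace.toDual_symm_apply]
      have := LinearMap.extendOfNorm_eq hd ⟨_, hF⟩ x
      rw [show (x : 𝓗) = S.subtype x from rfl, this]
      exact Complex.conj_conj _
    · rw [LinearIsometryEquiv.norm_map]
      exact LinearMap.opNorm_extendOfNorm_le hd (by positivity) hF
  choose z hz hz' using h1
  let B : S →ₗ[ℂ] 𝓗 :=
    { toFun := z
      map_add' := fun y y' => hS.eq_of_inner_right (𝕜 := ℂ) fun x hx => by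
        rw [inner_add_right, hz _ ⟨x, hx⟩, hz _ ⟨x, hx⟩, hz _ ⟨x, hx⟩, hr]
      map_smul' := fun c y => hS.eq_of_inner_right (𝕜 := ℂ) fun x hx => by
        rw [RingHom.id_apply, inner_smul_right, hz _ ⟨x, hx⟩, hz _ ⟨x, hx⟩, hr'] }
  refine ⟨B.extendOfNorm S.subtype, fun x y => ?_⟩
  have := LinearMap.extendOfNorm_eq (f := B) hd ⟨|C|, hz'⟩ y
  rw [show (y : 𝓗) = S.subtype y from rfl, this]
  exact hz y x

namespace LocalNet

variable (N : LocalNet n 𝓗)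

/-! ### Fields as bounded operators between powers of `1 + H` -/

theorem vecSmooth_add_left (u u' v : N.smoothVectors) :
    N.vecSmooth (u + u') v = N.vecSmooth u v + N.vecSmooth u' v :=
  SmoothFunctional.ext fun _ => inner_add_left _ _ _

theorem vecSmooth_add_right (u v v' : N.smoothVectors) :
    N.vecSmooth u (v + v') = N.vecSmooth u v + N.vecSmooth u v' :=
  SmoothFunctional.ext fun A => by
    rw [vecSmooth_val, Submodule.coe_add, map_add]
    exact inner_add_right _ _ _

theorem vecSmooth_smul_left (c : ℂ) (u v : N.smoothVectors) :
    N.vecSmooth (c • u) v = (conj c) • N.vecSmooth u v :=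
  SmoothFunctional.ext fun _ => inner_smul_left _ _ _

theorem vecSmooth_smul_right (c : ℂ) (u v : N.smoothVectors) :
    N.vecSmooth u (c • v) = c • N.vecSmooth u v :=
  SmoothFunctional.ext fun A => by
    rw [vecSmooth_val, Submodule.coe_smul, map_smul]
    exact inner_smul_right _ _ _

theorem Rpow_mem_smoothVectors (ℓ : ℝ) (x : N.smoothVectors) :
    N.Rpow ℓ (x : 𝓗) ∈ N.smoothVectors := by
  rw [Rpow_eq_fcalc]
  exact N.fcalc_mem_smoothVectors _ x.2

/-- `R^ℓ` as a map of smooth vectors. -/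
def smoothRpow (ℓ : ℝ) (x : N.smoothVectors) : N.smoothVectors :=
  ⟨N.Rpow ℓ (x : 𝓗), N.Rpow_mem_smoothVectors ℓ x⟩

/-- A form on smooth functionals that is additive, homogeneous and bounded with respect to
`‖ · ‖_ℓ` on vector functionals is given by a bounded operator. -/
theorem exists_operator_of_dualBound (ℓ : ℝ) (Φ : N.SmoothFunctional → ℂ)
    (h1 : ∀ u u' v, Φ (N.vecSmooth u v + N.vecSmooth u' v) =
      Φ (N.vecSmooth u v) + Φ (N.vecSmooth u' v))
    (h2 : ∀ u v v', Φ (N.vecSmooth u v + N.vecSmooth u v') =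
      Φ (N.vecSmooth u v) + Φ (N.vecSmooth u v'))
    (h3 : ∀ (c : ℂ) u v, Φ (c • N.vecSmooth u v) = c * Φ (N.vecSmooth u v)) {C : ℝ} (hC : 0 ≤ C)
    (hb : ∀ u v, ‖Φ (N.vecSmooth u v)‖ ≤ C * N.normFun ℓ (N.vecSmooth u v).val) :
    ∃ B : 𝓗 →L[ℂ] 𝓗, ∀ x y : N.smoothVectors, ⟪(x : 𝓗), B y⟫_ℂ =
      Φ (N.vecSmooth (N.smoothRpow ℓ x) (N.smoothRpow ℓ y)) := by
  have ha : ∀ x y, N.smoothRpow ℓ (x + y) = N.smoothRpow ℓ x + N.smoothRpow ℓ y := fun x y =>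
    Subtype.ext (map_add (N.Rpow ℓ) _ _)
  have hs : ∀ (c : ℂ) x, N.smoothRpow ℓ (c • x) = c • N.smoothRpow ℓ x := fun c x =>
    Subtype.ext (map_smul (N.Rpow ℓ) _ _)
  refine exists_operator_of_form N.dense_smoothVectors
    (fun x y => Φ (N.vecSmooth (N.smoothRpow ℓ x) (N.smoothRpow ℓ y))) (fun x x' y => ?_)
    (fun c x y => ?_) (fun x y y' => ?_) (fun c x y => ?_) (C := C) fun x y => ?_
  · rw [ha, vecSmooth_add_left, h1]
  · rw [hs, vecSmooth_smul_left, h3]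
  · rw [ha, vecSmooth_add_right, h2]
  · rw [hs, vecSmooth_smul_right, h3]
  · exact (hb _ _).trans (mul_le_mul_of_nonneg_left (N.normFun_vecSmooth_le ℓ _ _ rfl rfl) hC)

/-- The bounded operator `M` is `R^ℓ φ R^ℓ`. -/
def IsFormOperator (ℓ : ℝ) (φ : N.SmoothDual) (M : 𝓗 →L[ℂ] 𝓗) : Prop :=
  ∀ (u v : N.smoothVectors) (u' v' : 𝓗), N.Rpow ℓ u' = u → N.Rpow ℓ v' = v →
    φ (N.vecSmooth u v) = ⟪u', M v'⟫_ℂ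

theorem exists_isFormOperator {ℓ : ℝ} (hℓ : 0 < ℓ) {φ : N.SmoothDual} {C : ℝ} (hC : 0 ≤ C)
    (h : N.DualBound ℓ φ C) : ∃ M, N.IsFormOperator ℓ φ M := by
  obtain ⟨M, hM⟩ := N.exists_operator_of_dualBound ℓ φ (fun _ _ _ => map_add φ _ _)
    (fun _ _ _ => map_add φ _ _) (fun c _ _ => map_smul φ c _) hC fun u v => h _
  -- The preimages are a priori only vectors in `𝓗`. A smooth preimage exists, and injectivity of
  -- `R^ℓ` shows that it is the given one.
  have key : ∀ (u : N.smoothVectors) (u' : 𝓗), N.Rpow ℓ u' = u → ∃ x : N.smoothVectors,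
      (x : 𝓗) = u' ∧ N.smoothRpow ℓ x = u := by
    intro u u' hu
    obtain ⟨y, hy, hy'⟩ := N.exists_Rpow_eq hℓ u.2
    have : y = u' := N.injective_Rpow hℓ (hy'.trans hu.symm)
    exact ⟨⟨y, hy⟩, this, Subtype.ext hy'⟩
  refine ⟨M, fun u v u' v' hu hv => ?_⟩
  obtain ⟨x, rfl, rfl⟩ := key u u' hu
  obtain ⟨y, rfl, rfl⟩ := key v v' hv
  exact (hM x y).symm

theorem IsFormOperator.conj {N : LocalNet n 𝓗} {ℓ : ℝ} {φ : N.SmoothDual} {M : 𝓗 →L[ℂ] 𝓗}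
    (h : N.IsFormOperator ℓ φ M) : N.IsFormOperator ℓ (N.conjField φ) (star M) := by
  intro u v u' v' hu hv
  rw [conjField_apply, conjSmooth_vecSmooth, h v u v' u' hv hu, inner_conj_symm,
    ContinuousLinearMap.star_eq_adjoint, ContinuousLinearMap.adjoint_inner_right]

/-- Matrix elements between smooth vectors determine the operator by density, so the choice in
`weakProduct` is immaterial. -/
theorem weakProduct_eq {A B C : 𝓗 →L[ℂ] 𝓗} {Φ : N.SmoothFunctional → ℂ}
    (h : N.IsWeakProduct A Φ B C) : N.weakProduct A Φ B = C := by
  have hex : ∃ C, N.IsWeakProduct A Φ B C := ⟨C, h⟩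
  rw [weakProduct, dif_pos hex]
  have h1 := hex.choose_spec
  refine DFunLike.coe_injective (Continuous.ext_on N.dense_smoothVectors
    (ContinuousLinearMap.continuous _) (ContinuousLinearMap.continuous _) fun y hy => ?_)
  refine N.dense_smoothVectors.eq_of_inner_right (𝕜 := ℂ) fun x hx => ?_
  obtain ⟨_, _, e1⟩ := h1 ⟨x, hx⟩ ⟨y, hy⟩
  obtain ⟨_, _, e2⟩ := h ⟨x, hx⟩ ⟨y, hy⟩
  exact e1.trans e2.symm

/-- Formally `φ = (1+H)^ℓ M (1+H)^ℓ`. The factorizations of `A` and `B` through `R^ℓ` say that they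
absorb the two unbounded powers. -/
theorem IsFormOperator.weakProduct_eq {N : LocalNet n 𝓗} {ℓ : ℝ} {φ : N.SmoothDual}
    {M A B A₁ B₁ : 𝓗 →L[ℂ] 𝓗} (h : N.IsFormOperator ℓ φ M) (hA : A₁ * N.Rpow ℓ = A)
    (hB : N.Rpow ℓ * B₁ = B) (hA' : ∀ x ∈ N.smoothVectors, star A x ∈ N.smoothVectors)
    (hB' : ∀ x ∈ N.smoothVectors, B x ∈ N.smoothVectors) :
    N.weakProduct A φ B = A₁ * M * B₁ := by
  have hA₁ : ∀ x : 𝓗, N.Rpow ℓ (star A₁ x) = star A x := fun x => by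
    rw [← hA, star_mul, star_Rpow]; rfl
  have hB₁ : ∀ x : 𝓗, N.Rpow ℓ (B₁ x) = B x := fun x => by rw [← hB]; rfl
  refine LocalNet.weakProduct_eq N fun x y => ⟨hA' x x.2, hB' y y.2, ?_⟩
  rw [h ⟨star A (x : 𝓗), hA' x x.2⟩ ⟨B (y : 𝓗), hB' y y.2⟩ (star A₁ (x : 𝓗)) (B₁ (y : 𝓗))
    (hA₁ x) (hB₁ y),
    ContinuousLinearMap.star_eq_adjoint, ContinuousLinearMap.adjoint_inner_left]
  rfl

/-! ### Exponentials of the Hamiltonian -/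

/-- The function `r ↦ r^(-k) exp(-w (r⁻¹ - 1))`, which represents `(1+H)^k e^{-wH}`. -/
def damp (k : ℕ) (w : ℂ) (r : ℝ) : ℂ :=
  if r = 0 then 0 else (r : ℂ)⁻¹ ^ k * Complex.exp (-w * ((r : ℂ)⁻¹ - 1))

/-- This is `x^k ≤ k! e^x` at `x = Re w / r`. The rate `(Re w)^{-k}` is what later bounds the growth
at the real axis. -/
theorem norm_damp_le (k : ℕ) {w : ℂ} (hw : 0 < w.re) {r : ℝ} (hr : 0 ≤ r) :
    ‖damp k w r‖ ≤ k.factorial * Real.exp w.re * w.re⁻¹ ^ k := by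
  rw [damp]
  split_ifs with h
  · rw [norm_zero]; positivity
  have hr' : 0 < r := lt_of_le_of_ne hr (Ne.symm h)
  have h1 := Real.pow_div_factorial_le_exp (x := w.re * r⁻¹) (by positivity) k
  rw [div_le_iff₀ (by positivity)] at h1
  have e1 : (-w * ((r : ℂ)⁻¹ - 1)).re = w.re - w.re * r⁻¹ := by
    rw [← Complex.ofReal_inv, ← Complex.ofReal_one, ← Complex.ofReal_sub, Complex.re_mul_ofReal,
      Complex.neg_re]
    ring
  rw [norm_mul, norm_pow, ← Complex.ofReal_inv, Complex.norm_real, Real.norm_eq_abs,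
    abs_of_pos (inv_pos.2 hr'), Complex.norm_exp, Complex.ofReal_inv, e1, Real.exp_sub]
  have e2 : r⁻¹ ^ k = (w.re * r⁻¹) ^ k * w.re⁻¹ ^ k := by
    rw [← mul_pow]
    congr 1
    field_simp
  rw [e2, div_eq_mul_inv]
  calc (w.re * r⁻¹) ^ k * w.re⁻¹ ^ k * (Real.exp w.re * (Real.exp (w.re * r⁻¹))⁻¹)
      ≤ (Real.exp (w.re * r⁻¹) * k.factorial) * w.re⁻¹ ^ k *
        (Real.exp w.re * (Real.exp (w.re * r⁻¹))⁻¹) := by gcongr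
    _ = _ := by
      field_simp

theorem damp_succ (k : ℕ) (w : ℂ) (r : ℝ) : damp (k + 1) w r * r = damp k w r := by
  rw [damp, damp]
  split_ifs with h
  · rw [zero_mul]
  · have : (r : ℂ) ≠ 0 := by exact_mod_cast h
    rw [pow_succ]
    field_simp

theorem damp_mul_pow (k : ℕ) (w : ℂ) (r : ℝ) : damp k w r * (r : ℂ) ^ k = damp 0 w r := by
  induction k with
  | zero => rw [pow_zero, mul_one]
  | succ k ih => rw [pow_succ', ← mul_assoc, damp_succ, ih]

theorem conj_damp (k : ℕ) (w : ℂ) (r : ℝ) : conj (damp k w r) = damp k (conj w) r := by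
  rw [damp, damp]
  split_ifs with h
  · exact map_zero _
  · simp [← Complex.exp_conj]

/-- At `r = 0` use that the function is `r` times its successor in `k`, which is bounded; this
justifies the value `0` there. -/
theorem continuousOn_damp (k : ℕ) {w : ℂ} (hw : 0 < w.re) :
    ContinuousOn (damp k w) (Set.Icc 0 1) := by
  intro r hr
  rcases hr.1.eq_or_lt with rfl | hr0
  · rw [ContinuousWithinAt, damp, if_pos rfl, tendsto_zero_iff_norm_tendsto_zero]
    set C := (k + 1).factorial * Real.exp w.re * w.re⁻¹ ^ (k + 1)
    have h1 : Tendsto (fun r : ℝ => C * r) (𝓝[Set.Icc 0 1] 0) (𝓝 0) := by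
      have : Continuous fun r : ℝ => C * r := by fun_prop
      simpa using (this.tendsto 0).mono_left nhdsWithin_le_nhds
    refine squeeze_zero' (Eventually.of_forall fun _ => norm_nonneg _) ?_ h1
    filter_upwards [self_mem_nhdsWithin] with r hr
    rw [← damp_succ, norm_mul, Complex.norm_real, Real.norm_eq_abs, abs_of_nonneg hr.1]
    exact mul_le_mul_of_nonneg_right (norm_damp_le _ hw hr.1) hr.1
  · have h1 : ContinuousAt (fun r : ℝ => (r : ℂ)⁻¹ ^ k * Complex.exp (-w * ((r : ℂ)⁻¹ - 1))) r := by
      have h2 : ContinuousAt (fun r : ℝ => (r : ℂ)⁻¹) r :=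
        Complex.continuous_ofReal.continuousAt.inv₀ (by exact_mod_cast hr0.ne')
      fun_prop
    refine (h1.congr ?_).continuousWithinAt
    filter_upwards [lt_mem_nhds hr0] with s hs
    rw [damp, if_neg hs.ne']

theorem norm_exp_sub_one_sub_id_le (z : ℂ) : ‖Complex.exp z - 1 - z‖ ≤ ‖z‖ ^ 2 * Real.exp ‖z‖ := by
  have := Complex.norm_exp_sub_sum_le_norm_mul_exp z 2
  simpa [Finset.sum_range_succ, sub_sub] using this

theorem hasDerivAt_of_norm_le_sq {𝕜 E : Type*} [NontriviallyNormedField 𝕜]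
    [NormedAddCommGroup E] [NormedSpace 𝕜 E]
    {F : 𝕜 → E} {F' : E} {w : 𝕜} {C δ : ℝ} (hδ : 0 < δ)
    (h : ∀ z : 𝕜, ‖z‖ ≤ δ → ‖F (w + z) - F w - z • F'‖ ≤ C * ‖z‖ ^ 2) : HasDerivAt F F' w := by
  rw [hasDerivAt_iff_isLittleO_nhds_zero]
  have h1 : (fun z : 𝕜 => F (w + z) - F w - z • F') =O[𝓝 0] fun z : 𝕜 => ‖z‖ ^ 2 := by
    refine Asymptotics.IsBigO.of_bound C ?_
    filter_upwards [Metric.closedBall_mem_nhds (0 : 𝕜) hδ] with z hz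
    rw [Real.norm_eq_abs, abs_of_nonneg (by positivity)]
    exact h z (by simpa using hz)
  exact h1.trans_isLittleO ((Asymptotics.isLittleO_pow_id one_lt_two).comp_tendsto
    (tendsto_norm_zero (E := 𝕜)) |>.trans_isBigO (Asymptotics.isBigO_norm_left.2 (Asymptotics.isBigO_refl _ _)))

/-- The bounded operator `(1+H)^k e^{-wH}`, for `Re w > 0`. -/
def dampOp (k : ℕ) (w : ℂ) : 𝓗 →L[ℂ] 𝓗 := N.fcalc (damp k w)

theorem expNeg_eq (w : ℂ) : N.expNeg w = N.dampOp 0 w :=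
  N.cfc_eq_fcalc fun r _ => by simp [damp]

theorem norm_dampOp_le (k : ℕ) {w : ℂ} (hw : 0 < w.re) :
    ‖N.dampOp k w‖ ≤ k.factorial * Real.exp w.re * w.re⁻¹ ^ k :=
  N.norm_fcalc_le (by positivity) fun _ hr => norm_damp_le k hw hr.1

theorem star_dampOp (k : ℕ) (w : ℂ) : star (N.dampOp k w) = N.dampOp k (conj w) := by
  rw [dampOp, fcalc_star, dampOp]
  exact N.fcalc_congr fun r _ => conj_damp k w r

theorem dampOp_mul_Rpow (k : ℕ) {w : ℂ} (hw : 0 < w.re) :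
    N.dampOp k w * N.Rpow k = N.expNeg w := by
  rw [dampOp, Rpow_eq_fcalc, ← fcalc_mul _ (continuousOn_damp k hw)
    (continuousOn_rpow (Nat.cast_nonneg k) _), expNeg_eq, dampOp]
  refine N.fcalc_congr fun r _ => ?_
  rw [Real.rpow_natCast, Complex.ofReal_pow, damp_mul_pow]

/-- The derivative of `e^{-wH}` brings down `-H = 1 - (1+H)`. -/
theorem hasDerivAt_dampOp (k : ℕ) {w : ℂ} (hw : 0 < w.re) :
    HasDerivAt (N.dampOp k) (N.dampOp k w - N.dampOp (k + 1) w) w := by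
  set C := (k + 2).factorial * Real.exp (w.re / 2) * (w.re / 2)⁻¹ ^ (k + 2) with hC
  refine hasDerivAt_of_norm_le_sq (C := C) (δ := w.re / 2) (by positivity) fun z hz => ?_
  have hz1 : -(w.re / 2) ≤ z.re := by
    have := (Complex.abs_re_le_norm z).trans hz
    exact (abs_le.1 this).1
  have hwz : 0 < (w + z).re := by rw [Complex.add_re]; linarith
  have c1 := continuousOn_damp k hwz
  have c2 := continuousOn_damp k hw
  have c3 := continuousOn_damp (k + 1) hw
  have c4 : ContinuousOn (fun r => damp k w r - damp (k + 1) w r) (Set.Icc 0 1) := c2.sub c3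
  have c5 : ContinuousOn (fun r => damp k (w + z) r - damp k w r) (Set.Icc 0 1) := c1.sub c2
  have c6 : ContinuousOn (fun r => z * (damp k w r - damp (k + 1) w r)) (Set.Icc 0 1) :=
    continuousOn_const.mul c4
  rw [dampOp, dampOp, dampOp, ← N.fcalc_sub c2 c3, ← N.fcalc_smul z c4,
    ← N.fcalc_sub c1 c2, ← N.fcalc_sub c5 c6]
  refine N.norm_fcalc_le (by positivity) fun r hr => ?_
  rcases hr.1.eq_or_lt with rfl | hr0
  · simp [damp]
    positivity
  have hrc : (r : ℂ) ≠ 0 := by exact_mod_cast hr0.ne'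
  have hx1 : 0 ≤ r⁻¹ - 1 := by
    rw [sub_nonneg]; exact (one_le_inv₀ hr0).2 hr.2
  have e1 : damp k (w + z) r - damp k w r - z * (damp k w r - damp (k + 1) w r) =
      damp k w r * (Complex.exp (-z * ((r⁻¹ - 1 : ℝ) : ℂ)) - 1 - (-z * ((r⁻¹ - 1 : ℝ) : ℂ))) := by
    simp only [damp, if_neg hr0.ne']
    rw [neg_add, add_mul, Complex.exp_add, pow_succ]
    push_cast
    ring
  have hn : ‖-z * ((r⁻¹ - 1 : ℝ) : ℂ)‖ = ‖z‖ * (r⁻¹ - 1) := by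
    rw [norm_mul, norm_neg, Complex.norm_real, Real.norm_eq_abs, abs_of_nonneg hx1]
  have h2 := norm_exp_sub_one_sub_id_le (-z * ((r⁻¹ - 1 : ℝ) : ℂ))
  rw [hn] at h2
  have h3 : ‖damp (k + 2) ((w.re / 2 : ℝ) : ℂ) r‖ ≤ C :=
    norm_damp_le (k + 2) (w := ((w.re / 2 : ℝ) : ℂ)) (by simpa using hw) hr.1
  -- Half of the damping absorbs the growth `e^{|z|H}`, as `|z| ≤ Re w / 2`; the quadratic factor
  -- raises `k` by two.
  have h4 : ‖damp k w r‖ * ((r⁻¹ - 1) ^ 2 * Real.exp (‖z‖ * (r⁻¹ - 1))) ≤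
      ‖damp (k + 2) ((w.re / 2 : ℝ) : ℂ) r‖ := by
    simp only [damp, if_neg hr0.ne']
    rw [norm_mul, norm_mul, norm_pow, norm_pow, Complex.norm_exp, Complex.norm_exp,
      ← Complex.ofReal_inv, Complex.norm_real, Real.norm_eq_abs, abs_of_pos (inv_pos.2 hr0),
      ← Complex.ofReal_one, ← Complex.ofReal_sub, Complex.re_mul_ofReal, Complex.re_mul_ofReal,
      Complex.neg_re, Complex.neg_re, Complex.ofReal_re, pow_add]
    have h5 : Real.exp (‖z‖ * (r⁻¹ - 1)) ≤ Real.exp (w.re / 2 * (r⁻¹ - 1)) :=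
      Real.exp_le_exp.2 (mul_le_mul_of_nonneg_right hz hx1)
    have h6 : (r⁻¹ - 1) ^ 2 ≤ r⁻¹ ^ 2 := by
      have : 0 < r⁻¹ := inv_pos.2 hr0
      gcongr
      linarith
    calc r⁻¹ ^ k * Real.exp (-w.re * (r⁻¹ - 1)) * ((r⁻¹ - 1) ^ 2 * Real.exp (‖z‖ * (r⁻¹ - 1)))
        ≤ r⁻¹ ^ k * Real.exp (-w.re * (r⁻¹ - 1)) *
          (r⁻¹ ^ 2 * Real.exp (w.re / 2 * (r⁻¹ - 1))) := by
          gcongr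
      _ = r⁻¹ ^ k * r⁻¹ ^ 2 * (Real.exp (-w.re * (r⁻¹ - 1)) * Real.exp (w.re / 2 * (r⁻¹ - 1))) := by
          ring
      _ = _ := by
          rw [← Real.exp_add]
          congr 2
          ring
  rw [e1, norm_mul]
  calc _ ≤ ‖damp k w r‖ * ((‖z‖ * (r⁻¹ - 1)) ^ 2 * Real.exp (‖z‖ * (r⁻¹ - 1))) := by gcongr
    _ = (‖damp k w r‖ * ((r⁻¹ - 1) ^ 2 * Real.exp (‖z‖ * (r⁻¹ - 1)))) * ‖z‖ ^ 2 := by ring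
    _ ≤ C * ‖z‖ ^ 2 := by
      gcongr
      exact h4.trans h3

/-- The energy `min(H, E)` as a function of `R`. -/
def cutEnergy (E r : ℝ) : ℝ := (max r (1 / (1 + E)))⁻¹ - 1

theorem cutEnergy_nonneg {E r : ℝ} (hE : 0 < E) (hr : r ≤ 1) : 0 ≤ cutEnergy E r := by
  have ha : 0 < 1 / (1 + E) := by positivity
  have ha1 : 1 / (1 + E) ≤ 1 := by rw [div_le_one (by positivity)]; linarith
  rw [cutEnergy, sub_nonneg]
  exact (one_le_inv₀ (lt_of_lt_of_le ha (le_max_right _ _))).2 (max_le hr ha1)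

theorem cutEnergy_le {E r : ℝ} (hE : 0 < E) : cutEnergy E r ≤ E := by
  have ha : 0 < 1 / (1 + E) := by positivity
  have : (max r (1 / (1 + E)))⁻¹ ≤ (1 / (1 + E))⁻¹ := inv_anti₀ ha (le_max_right _ _)
  rw [cutEnergy]
  rw [one_div, inv_inv] at this
  rw [one_div]
  linarith

theorem continuous_cutEnergy {E : ℝ} (hE : 0 < E) : Continuous (cutEnergy E) := by
  have ha : 0 < 1 / (1 + E) := by positivity
  exact (Continuous.inv₀ (by fun_prop) fun r =>
    (lt_of_lt_of_le ha (le_max_right _ _)).ne').sub continuous_const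

theorem expCut_eq (E : ℝ) (w : ℂ) :
    N.expCut E w = N.fcalc fun r => Complex.exp (w * (cutEnergy E r : ℝ)) := rfl

theorem continuousOn_expCut {E : ℝ} (hE : 0 < E) (w : ℂ) (s : Set ℝ) :
    ContinuousOn (fun r : ℝ => Complex.exp (w * (cutEnergy E r : ℝ))) s := by
  have := continuous_cutEnergy hE
  exact Continuous.continuousOn (by fun_prop)

theorem star_expCut (E : ℝ) (w : ℂ) : star (N.expCut E w) = N.expCut E (conj w) := by
  rw [expCut_eq, fcalc_star, expCut_eq]
  exact N.fcalc_congr fun r _ => by rw [← Complex.exp_conj, map_mul, Complex.conj_ofReal]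

theorem expCut_add {E : ℝ} (hE : 0 < E) (w z : ℂ) :
    N.expCut E (w + z) = N.expCut E w * N.expCut E z := by
  rw [expCut_eq, expCut_eq, expCut_eq, ← N.fcalc_mul (continuousOn_expCut hE w _)
    (continuousOn_expCut hE z _)]
  exact N.fcalc_congr fun r _ => by rw [add_mul, Complex.exp_add]

theorem expCut_zero (E : ℝ) : N.expCut E 0 = 1 := by
  rw [expCut_eq, ← N.fcalc_one]
  exact N.fcalc_congr fun r _ => by simp

theorem norm_expCut_le {E : ℝ} (hE : 0 < E) {w : ℂ} (hw : 0 ≤ w.re) :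
    ‖N.expCut E w‖ ≤ Real.exp (w.re * E) := by
  rw [expCut_eq]
  refine N.norm_fcalc_le (by positivity) fun r hr => ?_
  rw [Complex.norm_exp, Complex.re_mul_ofReal, Real.exp_le_exp]
  exact mul_le_mul_of_nonneg_left (cutEnergy_le hE) hw

/-- The bounded operator `min(H, E)`. -/
def cutHamiltonian (E : ℝ) : 𝓗 →L[ℂ] 𝓗 := N.fcalc fun r => (cutEnergy E r : ℂ)

theorem hasDerivAt_expCut {E : ℝ} (hE : 0 < E) (w : ℂ) :
    HasDerivAt (N.expCut E) (N.expCut E w * N.cutHamiltonian E) w := by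
  refine hasDerivAt_of_norm_le_sq (C := Real.exp (‖w‖ * E) * (E ^ 2 * Real.exp E)) (δ := 1) one_pos
    fun z hz => ?_
  have c1 := continuousOn_expCut hE w (Set.Icc 0 1)
  have c2 := continuousOn_expCut hE (w + z) (Set.Icc 0 1)
  have c3 : ContinuousOn (fun r : ℝ => (cutEnergy E r : ℂ)) (Set.Icc 0 1) :=
    (Complex.continuous_ofReal.comp (continuous_cutEnergy hE)).continuousOn
  have c4 : ContinuousOn (fun r : ℝ => Complex.exp (w * (cutEnergy E r : ℝ)) * (cutEnergy E r : ℂ))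
    (Set.Icc 0 1) := c1.mul c3
  have c5 : ContinuousOn (fun r : ℝ => Complex.exp ((w + z) * (cutEnergy E r : ℝ)) -
    Complex.exp (w * (cutEnergy E r : ℝ))) (Set.Icc 0 1) := c2.sub c1
  have c6 : ContinuousOn (fun r : ℝ => z * (Complex.exp (w * (cutEnergy E r : ℝ)) *
    (cutEnergy E r : ℂ))) (Set.Icc 0 1) := continuousOn_const.mul c4
  rw [expCut_eq, expCut_eq, cutHamiltonian, ← N.fcalc_mul c1 c3, ← N.fcalc_smul z c4,
    ← N.fcalc_sub c2 c1, ← N.fcalc_sub c5 c6]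
  refine N.norm_fcalc_le (by positivity) fun r hr => ?_
  have h0 := cutEnergy_nonneg hE hr.2
  have h1 : cutEnergy E r ≤ E := cutEnergy_le hE
  set x := cutEnergy E r
  have e1 : Complex.exp ((w + z) * (x : ℂ)) - Complex.exp (w * (x : ℂ)) -
      z * (Complex.exp (w * (x : ℂ)) * (x : ℂ)) =
      Complex.exp (w * (x : ℂ)) * (Complex.exp (z * x) - 1 - z * x) := by
    rw [add_mul, Complex.exp_add]
    ring
  have h2 := norm_exp_sub_one_sub_id_le (z * x)
  have hn : ‖z * (x : ℂ)‖ = ‖z‖ * x := by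
    rw [norm_mul, Complex.norm_real, Real.norm_eq_abs, abs_of_nonneg h0]
  rw [hn] at h2
  have h3 : ‖Complex.exp (w * (x : ℂ))‖ ≤ Real.exp (‖w‖ * E) := by
    rw [Complex.norm_exp, Complex.re_mul_ofReal, Real.exp_le_exp]
    exact mul_le_mul (Complex.re_le_norm w) h1 h0 (norm_nonneg w)
  change ‖Complex.exp ((w + z) * (x : ℂ)) - Complex.exp (w * (x : ℂ)) -
      z * (Complex.exp (w * (x : ℂ)) * (x : ℂ))‖ ≤ _
  rw [e1, norm_mul]
  calc _ ≤ Real.exp (‖w‖ * E) * ((‖z‖ * x) ^ 2 * Real.exp (‖z‖ * x)) := by gcongr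
    _ ≤ Real.exp (‖w‖ * E) * ((‖z‖ * E) ^ 2 * Real.exp (1 * E)) := by gcongr
    _ = _ := by rw [one_mul]; ring

end LocalNet

end QI

namespace QI

variable {n : ℕ} {𝓗 : Type*} [NormedAddCommGroup 𝓗] [InnerProductSpace ℂ 𝓗] [CompleteSpace 𝓗]

namespace LocalNet

variable (N : LocalNet n 𝓗)

/-! ### Time translations and the functional calculus -/

/-- The function `r (1 + min(r⁻¹ - 1, E))` equals `1` on the spectral interval of `P(E)`, so `P(E)x
= R(1 + min(H,E))P(E)x` lies in the range of `R`. -/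
theorem hamiltonian_energyProj {E : ℝ} (hE : 0 < E) (x : 𝓗) :
    ∃ h : N.energyProj E x ∈ N.hamiltonian.domain,
      N.hamiltonian ⟨_, h⟩ = N.cutHamiltonian E (N.energyProj E x) := by
  have hc1 : ContinuousOn (fun r : ℝ => (r : ℂ)) (Set.Icc 0 1) :=
    Complex.continuous_ofReal.continuousOn
  have hc2 : ContinuousOn (fun r : ℝ => (cutEnergy E r : ℂ)) (Set.Icc 0 1) :=
    (Complex.continuous_ofReal.comp (continuous_cutEnergy hE)).continuousOn
  have hc3 : ContinuousOn (fun r : ℝ => 1 + (cutEnergy E r : ℂ)) (Set.Icc 0 1) :=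
    continuousOn_const.add hc2
  have h1 : N.resolvent * (1 + N.cutHamiltonian E) * N.energyProj E = N.energyProj E := by
    rw [← N.fcalc_id, ← N.fcalc_one, cutHamiltonian, ← N.fcalc_add continuousOn_const hc2,
      ← N.fcalc_mul hc1 hc3]
    conv_rhs => rw [← one_mul (N.energyProj E), ← N.fcalc_one]
    refine N.fcalc_mul_energyProj_congr hE (hc1.mul hc3) continuousOn_const fun r hr => ?_
    have hr0 : 0 < r := lt_of_lt_of_le (by positivity) hr.1
    have : (r : ℂ) ≠ 0 := by exact_mod_cast hr0.ne'
    rw [cutEnergy, max_eq_left hr.1]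
    push_cast
    field_simp
    ring
  obtain ⟨h, h'⟩ := (N.isResolvent_resolvent (N.energyProj E x)
    (N.energyProj E x + N.cutHamiltonian E (N.energyProj E x))).1
    (congrArg (fun B : 𝓗 →L[ℂ] 𝓗 => B x) h1)
  exact ⟨h, add_left_cancel h'⟩

theorem hasDerivAt_expCut_apply {E : ℝ} (hE : 0 < E) (y : 𝓗) (t : ℝ) :
    HasDerivAt (fun t : ℝ => N.expCut E (Complex.I * t) y)
      (Complex.I • N.cutHamiltonian E (N.expCut E (Complex.I * t) y)) t := by
  have h1 : HasDerivAt (fun t : ℝ => Complex.I * (t : ℂ)) Complex.I t := by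
    simpa using! (Complex.ofRealCLM.hasDerivAt (x := t)).const_mul Complex.I
  have h2 := HasDerivAt.scomp (h := fun t : ℝ => Complex.I * (t : ℂ)) t
    (N.hasDerivAt_expCut hE (Complex.I * t)) h1
  have h3 := (((ContinuousLinearMap.apply ℂ 𝓗 y).restrictScalars ℝ).hasFDerivAt).comp_hasDerivAt t h2
  refine h3.congr_deriv ?_
  have hc : N.expCut E (Complex.I * t) * N.cutHamiltonian E =
      N.cutHamiltonian E * N.expCut E (Complex.I * t) := by
    rw [expCut_eq, cutHamiltonian]; exact N.fcalc_commute _ _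
  rw [hc]
  rfl

/-- Uniqueness of the Schrödinger evolution: `⟪e^{is min(H,E)}y, U(s)u⟫` has zero derivative, since
on `u = P(E)x` both groups have the same self-adjoint generator. This ties the abstract group `U` to
the functional calculus. -/
theorem timeU_mul_energyProj {E : ℝ} (hE : 0 < E) (t : ℝ) :
    N.timeU t * N.energyProj E = N.expCut E (Complex.I * t) * N.energyProj E := by
  refine ContinuousLinearMap.ext fun x => ?_
  obtain ⟨hu, hu'⟩ := N.hamiltonian_energyProj hE x
  set u := N.energyProj E x with hudef
  have key : N.expCut E (Complex.I * (-t : ℝ)) (N.timeU t u) = u := by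
    refine ext_inner_left ℂ fun y => ?_
    have hstar : ∀ t : ℝ, ∀ a b : 𝓗, ⟪N.expCut E (Complex.I * t) a, b⟫_ℂ =
        ⟪a, N.expCut E (Complex.I * (-t : ℝ)) b⟫_ℂ := by
      intro t a b
      have : N.expCut E (Complex.I * (-t : ℝ)) = star (N.expCut E (Complex.I * t)) := by
        rw [star_expCut]; simp
      rw [this, ContinuousLinearMap.star_eq_adjoint, ContinuousLinearMap.adjoint_inner_right]
    have hH : ∀ a b : 𝓗, ⟪N.cutHamiltonian E a, b⟫_ℂ = ⟪a, N.cutHamiltonian E b⟫_ℂ := by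
      intro a b
      have : star (N.cutHamiltonian E) = N.cutHamiltonian E := by
        rw [cutHamiltonian, fcalc_star]
        exact N.fcalc_congr fun r _ => Complex.conj_ofReal _
      conv_rhs => rw [← this]
      rw [ContinuousLinearMap.star_eq_adjoint, ContinuousLinearMap.adjoint_inner_right]
    have hd : ∀ s : ℝ, HasDerivAt (fun s : ℝ => ⟪N.expCut E (Complex.I * s) y, N.timeU s u⟫_ℂ) 0 s := by
      intro s
      have := (N.hasDerivAt_expCut_apply hE y s).inner ℂ (N.hasDerivAt_timeU ⟨u, hu⟩ s)
      refine this.congr_deriv ?_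
      have hc : N.timeU s (N.cutHamiltonian E u) = N.cutHamiltonian E (N.timeU s u) :=
        congrArg (fun B : 𝓗 →L[ℂ] 𝓗 => B u) (N.commute_fcalc_timeU _ s).eq.symm
      rw [hu', map_smul, hc, inner_smul_left, inner_smul_right, hH, Complex.conj_I]
      ring
    have hconst := is_const_of_deriv_eq_zero (fun s => (hd s).differentiableAt)
      (fun s => (hd s).deriv) t 0
    rw [hstar] at hconst
    rw [hconst]
    simp [timeU_zero, expCut_zero]
  have h2 : N.expCut E (Complex.I * t) (N.expCut E (Complex.I * (-t : ℝ)) (N.timeU t u)) =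
      N.timeU t u := by
    change (N.expCut E (Complex.I * t) * N.expCut E (Complex.I * (-t : ℝ))) _ = _
    rw [← N.expCut_add hE]
    simp [expCut_zero]
  rw [key] at h2
  exact h2.symm

theorem eq_of_mul_energyProj {A B : 𝓗 →L[ℂ] 𝓗}
    (h : ∀ E, 0 < E → A * N.energyProj E = B * N.energyProj E) : A = B := by
  refine ContinuousLinearMap.ext fun x => ?_
  refine tendsto_nhds_unique ((A.continuous.tendsto x).comp (N.tendsto_energyProj x))
    (((B.continuous.tendsto x).comp (N.tendsto_energyProj x)).congr' ?_)
  filter_upwards [eventually_gt_atTop 0] with E hE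
  exact congrArg (fun C : 𝓗 →L[ℂ] 𝓗 => C x) (h E hE).symm

/-- Both sides are compared on the ranges of the `P(E)`, where `U(t)` is a function of `R`. -/
theorem timeU_mul_dampOp (k : ℕ) {w : ℂ} (hw : 0 < w.re) (t : ℝ) :
    N.timeU t * N.dampOp k w = N.dampOp k (w - Complex.I * t) := by
  refine N.eq_of_mul_energyProj fun E hE => ?_
  have hw' : 0 < (w - Complex.I * t).re := by simpa using hw
  have hc := continuousOn_expCut hE (Complex.I * t) (Set.Icc 0 1)
  have hc' : ContinuousOn (fun r => damp k w r * Complex.exp (Complex.I * t * (cutEnergy E r : ℝ)))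
    (Set.Icc 0 1) := (continuousOn_damp k hw).mul hc
  rw [dampOp, ← (N.commute_fcalc_timeU _ t).eq, mul_assoc, N.timeU_mul_energyProj hE, ← mul_assoc,
    expCut_eq, ← N.fcalc_mul (continuousOn_damp k hw) hc]
  refine N.fcalc_mul_energyProj_congr hE hc' (continuousOn_damp k hw') fun r hr => ?_
  have hr0 : 0 < r := lt_of_lt_of_le (by positivity) hr.1
  simp only [damp, if_neg hr0.ne', cutEnergy, max_eq_left hr.1]
  rw [mul_assoc, ← Complex.exp_add]
  congr 2
  push_cast
  ring

/-! ### The two-point function -/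

/-- On the range of `P(E)`, the bounded operator `(1+H)^k`. -/
def cutInv (k : ℕ) (E : ℝ) : 𝓗 →L[ℂ] 𝓗 :=
  N.fcalc (fun r => (((max r (1 / (1 + E))) ^ (-(k : ℝ)) : ℝ) : ℂ)) * N.energyProj E

theorem Rpow_mul_cutInv (k : ℕ) {E : ℝ} (hE : 0 < E) :
    N.Rpow k * N.cutInv k E = N.energyProj E :=
  N.Rpow_mul_cut_mul_energyProj hE (Nat.cast_nonneg k)

/-- The operator whose vector functionals give the two-point function of `φ* ⊗ φ`. -/
def twoPointOp (k : ℕ) (E : ℝ) (M : 𝓗 →L[ℂ] 𝓗) (w : ℂ) : 𝓗 →L[ℂ] 𝓗 :=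
  N.expCut E w * (star (M * N.cutInv k E) * N.dampOp k w) *
    (N.dampOp k w * (M * N.cutInv k E)) * N.expCut E w

/-- Replacing the weak products by explicit bounded operators gives access to analyticity, growth
and adjoints. For `Im z < 0` the parameter `w = iz/2` has positive real part, as the damping needs.
-/
theorem twoPointFn_eq {k : ℕ} {E : ℝ} (hE : 0 < E) {φ : N.SmoothDual} {M : 𝓗 →L[ℂ] 𝓗}
    (hM : N.IsFormOperator k φ M) (σ : N.SmoothFunctional) {z : ℂ} (hz : z.im < 0) :
    N.twoPointFn E σ (N.conjField φ) φ z = σ.val (N.twoPointOp k E M (Complex.I * z / 2)) := by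
  have hw : 0 < (Complex.I * z / 2).re := by simpa using hz
  have hP : ∀ x ∈ N.smoothVectors, N.energyProj E x ∈ N.smoothVectors := fun x _ =>
    N.energyProj_mem_smoothVectors hE x
  have hX : ∀ w : ℂ, ∀ x ∈ N.smoothVectors, N.expNeg w x ∈ N.smoothVectors := fun w x hx => by
    rw [expNeg_eq]; exact N.fcalc_mem_smoothVectors _ hx
  have hXs : ∀ w : ℂ, ∀ x ∈ N.smoothVectors, star (N.expNeg w) x ∈ N.smoothVectors :=
    fun w x hx => by
      rw [expNeg_eq, star_dampOp]; exact N.fcalc_mem_smoothVectors _ hx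
  have h1 : N.weakProduct (N.expNeg (Complex.I * z / 2)) φ (N.energyProj E) =
      N.dampOp k (Complex.I * z / 2) * M * N.cutInv k E :=
    hM.weakProduct_eq (N.dampOp_mul_Rpow k hw) (N.Rpow_mul_cutInv k hE) (hXs _) hP
  have h2 : N.weakProduct (N.energyProj E) (N.conjField φ) (N.expNeg (Complex.I * z / 2)) =
      star (N.cutInv k E) * star M * N.dampOp k (Complex.I * z / 2) := by
    refine hM.conj.weakProduct_eq ?_ ?_ (by rwa [star_energyProj]) (hX _)
    · have := congrArg star (N.Rpow_mul_cutInv k hE)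
      rwa [star_mul, star_Rpow, star_energyProj] at this
    · rw [← N.dampOp_mul_Rpow k hw, Rpow_eq_fcalc]
      exact N.fcalc_commute _ _
  simp only [twoPointFn]
  rw [h1, h2, twoPointOp, star_mul]
  simp only [mul_assoc]

theorem star_twoPointOp (k : ℕ) (E : ℝ) (M : 𝓗 →L[ℂ] 𝓗) (w : ℂ) :
    star (N.twoPointOp k E M w) = N.twoPointOp k E M (conj w) := by
  simp only [twoPointOp, star_mul, star_star, star_expCut, star_dampOp, mul_assoc]

/-- Each of the two damping factors costs `(Re w)^{-k}`; the growing exponentials are bounded on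
energies up to `E`. -/
theorem norm_twoPointOp_le (k : ℕ) {E : ℝ} (hE : 0 < E) (M : 𝓗 →L[ℂ] 𝓗) :
    ∃ C, 0 ≤ C ∧ ∀ w : ℂ, 0 < w.re → w.re ≤ 1 →
      ‖N.twoPointOp k E M w‖ ≤ C * w.re⁻¹ ^ (2 * k) := by
  set V := M * N.cutInv k E
  refine ⟨Real.exp E * (‖V‖ * (k.factorial * Real.exp 1)) * ((k.factorial * Real.exp 1) * ‖V‖) *
    Real.exp E, by positivity, fun w hw hw1 => ?_⟩
  have h1 : ‖N.expCut E w‖ ≤ Real.exp E := (N.norm_expCut_le hE hw.le).trans (by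
    rw [Real.exp_le_exp]; nlinarith)
  have h2 : ‖N.dampOp k w‖ ≤ k.factorial * Real.exp 1 * w.re⁻¹ ^ k :=
    (N.norm_dampOp_le k hw).trans (by gcongr)
  rw [twoPointOp]
  calc _ ≤ ‖N.expCut E w‖ * (‖star V‖ * ‖N.dampOp k w‖) * (‖N.dampOp k w‖ * ‖V‖) *
        ‖N.expCut E w‖ := by
        refine (norm_mul_le _ _).trans ?_
        gcongr
        refine (norm_mul_le _ _).trans ?_
        gcongr
        · refine (norm_mul_le _ _).trans ?_
          gcongr
          exact norm_mul_le _ _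
        · exact norm_mul_le _ _
    _ ≤ Real.exp E * (‖V‖ * (k.factorial * Real.exp 1 * w.re⁻¹ ^ k)) *
        ((k.factorial * Real.exp 1 * w.re⁻¹ ^ k) * ‖V‖) * Real.exp E := by
        rw [norm_star]
        gcongr
    _ = _ := by ring

theorem differentiableAt_twoPointOp (k : ℕ) {E : ℝ} (hE : 0 < E) (M : 𝓗 →L[ℂ] 𝓗) {w : ℂ}
    (hw : 0 < w.re) : DifferentiableAt ℂ (N.twoPointOp k E M) w := by
  have h1 := (N.hasDerivAt_expCut hE w).differentiableAt
  have h2 := (N.hasDerivAt_dampOp k hw).differentiableAt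
  unfold twoPointOp
  exact ((h1.mul (h2.const_mul _)).mul (h2.mul_const _)).mul h1

/-! ### Regularized two-point functions as inner products -/

theorem continuous_timeU_apply {x : ℝ → 𝓗} (hx : Continuous x) :
    Continuous fun t => N.timeU t (x t) := by
  rw [continuous_iff_continuousAt]
  intro t₀
  rw [ContinuousAt, tendsto_iff_norm_sub_tendsto_zero]
  have h1 : Tendsto (fun t => ‖x t - x t₀‖ + ‖N.timeU t (x t₀) - N.timeU t₀ (x t₀)‖) (𝓝 t₀) (𝓝 0) := by
    have a := tendsto_iff_norm_sub_tendsto_zero.1 (hx.tendsto t₀)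
    have b := tendsto_iff_norm_sub_tendsto_zero.1 ((N.continuous_timeU (x t₀)).tendsto t₀)
    simpa using a.add b
  refine squeeze_zero (fun _ => norm_nonneg _) (fun t => ?_) h1
  have : N.timeU t (x t) - N.timeU t₀ (x t₀) =
      N.timeU t (x t - x t₀) + (N.timeU t (x t₀) - N.timeU t₀ (x t₀)) := by
    rw [map_sub]; abel
  rw [this]
  refine (norm_add_le _ _).trans_eq ?_
  rw [norm_timeU_apply]

/-- The regularized field `φ`, translated in time and applied to a vector. -/
def fieldVector (k : ℕ) (E : ℝ) (M : 𝓗 →L[ℂ] 𝓗) (u : 𝓗) (y t : ℝ) : 𝓗 :=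
  N.timeU t (N.dampOp k (y / 2 : ℝ) ((M * N.cutInv k E)
    (N.expCut E (y / 2 : ℝ) (N.timeU (-t) u))))

theorem continuous_fieldVector (k : ℕ) (E : ℝ) (M : 𝓗 →L[ℂ] 𝓗) (u : 𝓗) (y : ℝ) :
    Continuous (N.fieldVector k E M u y) := by
  have h := (N.continuous_timeU u).comp continuous_neg
  have h2 := (N.dampOp k (y / 2 : ℝ)).continuous.comp ((M * N.cutInv k E).continuous.comp
    ((N.expCut E (y / 2 : ℝ)).continuous.comp h))
  exact N.continuous_timeU_apply h2

/-- The imaginary part of `w` is a time translation: `e^{-wH} = U(-s'/2) e^{-yH/2}`, and `e^{wH}`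
contributes `U(s'/2)` on the range of `P(E)`. What remains in front is a common `U(-s)`. -/
theorem dampOp_expCut_timeU (k : ℕ) {E : ℝ} (hE : 0 < E) (M : 𝓗 →L[ℂ] 𝓗) {u : 𝓗}
    (hu : N.energyProj E u = u) {y : ℝ} (hy : 0 < y) (s s' : ℝ) :
    N.dampOp k ((y / 2 : ℝ) + Complex.I * (s' / 2 : ℝ)) ((M * N.cutInv k E)
      (N.expCut E ((y / 2 : ℝ) + Complex.I * (s' / 2 : ℝ)) (N.timeU (-s) u))) =
    N.timeU (-s) (N.fieldVector k E M u y (s - s' / 2)) := by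
  have hy' : 0 < (((y / 2 : ℝ)) : ℂ).re := by simpa using hy
  have h1 := N.timeU_mul_dampOp k hy' (-(s' / 2))
  have h2 : N.expCut E ((y / 2 : ℝ) + Complex.I * (s' / 2 : ℝ)) (N.timeU (-s) u) =
      N.expCut E (y / 2 : ℝ) (N.timeU (-(s - s' / 2)) u) := by
    have e1 : N.timeU (-s) u = N.energyProj E (N.timeU (-s) u) := by
      conv_lhs => rw [← hu]
      exact congrArg (fun B : 𝓗 →L[ℂ] 𝓗 => B u) (N.commute_timeU_energyProj (-s) E).eq
    rw [N.expCut_add hE]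
    change N.expCut E (y / 2 : ℝ) (N.expCut E (Complex.I * (s' / 2 : ℝ)) (N.timeU (-s) u)) = _
    rw [e1]
    have e2 := congrArg (fun B : 𝓗 →L[ℂ] 𝓗 => B (N.timeU (-s) u)) (N.timeU_mul_energyProj hE (s' / 2))
    change N.timeU (s' / 2) (N.energyProj E _) = N.expCut E _ (N.energyProj E _) at e2
    rw [← e2, ← e1, timeU_apply_apply]
    congr 3
    ring
  rw [h2, fieldVector, timeU_apply_apply]
  have e3 : (((y / 2 : ℝ)) : ℂ) - Complex.I * ((-(s' / 2) : ℝ) : ℂ) =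
      (y / 2 : ℝ) + Complex.I * (s' / 2 : ℝ) := by
    push_cast; ring
  rw [e3] at h1
  rw [← h1, show -s + (s - s' / 2) = -(s' / 2) by ring]
  rfl

/-- The left half of the operator is the adjoint of the right half with `w` replaced by `w̄`, i.e.
`s'` by `-s'`. So the two vectors sit at `s + s'/2` and `s - s'/2`, and the common `U(-s)` cancels.
-/
theorem twoPointFn_translate_vecSmooth {k : ℕ} {E : ℝ} (hE : 0 < E) {φ : N.SmoothDual}
    {M : 𝓗 →L[ℂ] 𝓗} (hM : N.IsFormOperator k φ M) (u : N.smoothVectors)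
    (hu : N.energyProj E (u : 𝓗) = u) {y : ℝ} (hy : 0 < y) (s s' : ℝ) :
    N.twoPointFn E (N.translate s (N.vecSmooth u u)) (N.conjField φ) φ (s' - y * Complex.I) =
      ⟪N.fieldVector k E M u y (s + s' / 2), N.fieldVector k E M u y (s - s' / 2)⟫_ℂ := by
  have hw : Complex.I * ((s' : ℂ) - y * Complex.I) / 2 =
      (y / 2 : ℝ) + Complex.I * (s' / 2 : ℝ) := by
    push_cast
    linear_combination (-(y : ℂ) / 2) * Complex.I_sq
  have hwc : conj (((y / 2 : ℝ) : ℂ) + Complex.I * (s' / 2 : ℝ)) =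
      (y / 2 : ℝ) + Complex.I * ((-s') / 2 : ℝ) := by
    simp only [map_add, map_mul, Complex.conj_ofReal, Complex.conj_I]
    push_cast
    ring
  rw [N.twoPointFn_eq hE hM _ (by simpa using hy), translate_val, vecSmooth_val, hw, star_timeU]
  set w : ℂ := (y / 2 : ℝ) + Complex.I * (s' / 2 : ℝ) with hwdef
  have h1 := N.dampOp_expCut_timeU k hE M hu hy s s'
  have h2 := N.dampOp_expCut_timeU k hE M hu hy s (-s')
  rw [← hwdef] at h1
  rw [← hwc] at h2
  have h3 : (N.timeU s * N.twoPointOp k E M w * N.timeU (-s)) u =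
      star (N.dampOp k (conj w) * (M * N.cutInv k E) * N.expCut E (conj w) * N.timeU (-s))
        (N.dampOp k w ((M * N.cutInv k E) (N.expCut E w (N.timeU (-s) u)))) := by
    simp only [star_mul, star_dampOp, star_expCut, star_timeU, Complex.conj_conj, neg_neg,
      twoPointOp, mul_assoc]
    rfl
  rw [h3, ContinuousLinearMap.star_eq_adjoint, ContinuousLinearMap.adjoint_inner_right, h1]
  change ⟪N.dampOp k (conj w) ((M * N.cutInv k E) (N.expCut E (conj w) (N.timeU (-s) u))), _⟫_ℂ = _
  rw [h2, inner_timeU_left, timeU_apply_apply, neg_neg, add_neg_cancel, timeU_zero,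
    one_apply_eq_self, show s - -s' / 2 = s + s' / 2 by ring]

end LocalNet

end QI

namespace QI

/-! ### Complex Gaussians -/

/-- The Gaussian `exp(-β (z - a)²)`, with complex `a`. -/
def gauss (β : ℝ) (a z : ℂ) : ℂ := Complex.exp (-β * (z - a) ^ 2)

theorem differentiable_gauss (β : ℝ) (a : ℂ) : Differentiable ℂ (gauss β a) := by
  unfold gauss
  fun_prop

theorem norm_gauss (β : ℝ) (a z : ℂ) :
    ‖gauss β a z‖ = Real.exp (β * (z.im - a.im) ^ 2) * Real.exp (-β * (z.re - a.re) ^ 2) := by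
  rw [gauss, Complex.norm_exp, ← Real.exp_add]
  congr 1
  have : -(β : ℂ) * (z - a) ^ 2 = ((-β : ℝ) : ℂ) * (z - a) ^ 2 := by push_cast; ring
  rw [this, Complex.re_ofReal_mul, sq, Complex.mul_re, Complex.sub_re, Complex.sub_im]
  ring

theorem exists_bound_polynomial (p : Polynomial ℂ) :
    ∃ C : ℝ, 0 ≤ C ∧ ∀ t : ℝ, ‖p.eval (t : ℂ)‖ ≤ C * Real.exp |t| := by
  induction p using Polynomial.induction_on' with
  | add p q hp hq =>
    obtain ⟨C, hC, h⟩ := hp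
    obtain ⟨D, hD, h'⟩ := hq
    refine ⟨C + D, by positivity, fun t => ?_⟩
    rw [Polynomial.eval_add, add_mul]
    exact (norm_add_le _ _).trans (add_le_add (h t) (h' t))
  | monomial k a =>
    refine ⟨‖a‖ * k.factorial, by positivity, fun t => ?_⟩
    rw [Polynomial.eval_monomial, norm_mul, norm_pow, Complex.norm_real, Real.norm_eq_abs, mul_assoc]
    have := Real.pow_div_factorial_le_exp |t| (abs_nonneg t) k
    rw [div_le_iff₀ (by positivity)] at this
    gcongr
    linarith

theorem exp_abs_mul_gauss_le {β : ℝ} (hβ : 0 < β) (a t : ℝ) :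
    Real.exp |t| * Real.exp (-β * (t - a) ^ 2) ≤ Real.exp (|a| + 1 / (4 * β)) := by
  rw [← Real.exp_add, Real.exp_le_exp]
  have h1 : |t| ≤ |t - a| + |a| := by
    calc |t| = |(t - a) + a| := by rw [sub_add_cancel]
      _ ≤ _ := abs_add_le _ _
  have h2 : |t - a| - β * |t - a| ^ 2 ≤ 1 / (4 * β) := by
    rw [le_div_iff₀ (by positivity)]
    nlinarith [sq_nonneg (2 * β * |t - a| - 1)]
  rw [sq_abs] at h2
  linarith

theorem exists_bound_polynomial_mul_gauss {β : ℝ} (hβ : 0 < β) (a : ℂ) (p : Polynomial ℂ) :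
    ∃ C : ℝ, ∀ t : ℝ, ‖p.eval (t : ℂ) * gauss β a t‖ ≤ C := by
  obtain ⟨C, hC, h⟩ := exists_bound_polynomial p
  refine ⟨C * (Real.exp (β * (0 - a.im) ^ 2) * Real.exp (|a.re| + 1 / (4 * β))), fun t => ?_⟩
  rw [norm_mul, norm_gauss, Complex.ofReal_re, Complex.ofReal_im]
  calc _ ≤ C * Real.exp |t| * (Real.exp (β * (0 - a.im) ^ 2) * Real.exp (-β * (t - a.re) ^ 2)) := by
        gcongr
        exact h t
    _ = C * (Real.exp (β * (0 - a.im) ^ 2) * (Real.exp |t| * Real.exp (-β * (t - a.re) ^ 2))) := by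
        ring
    _ ≤ _ := by
        gcongr
        exact exp_abs_mul_gauss_le hβ _ _

theorem hasDerivAt_polynomial_mul_gauss (β : ℝ) (a : ℂ) (p : Polynomial ℂ) (t : ℝ) :
    HasDerivAt (fun t : ℝ => p.eval (t : ℂ) * gauss β a t)
      ((p.derivative - Polynomial.C (2 * (β : ℂ)) * (Polynomial.X - Polynomial.C a) * p).eval (t : ℂ) *
        gauss β a t) t := by
  have h1 : HasDerivAt (fun z : ℂ => p.eval z * gauss β a z)
      ((p.derivative - Polynomial.C (2 * (β : ℂ)) * (Polynomial.X - Polynomial.C a) * p).eval (t : ℂ) *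
        gauss β a t) (t : ℂ) := by
    have e1 := p.hasDerivAt (t : ℂ)
    have e2 : HasDerivAt (gauss β a) (gauss β a t * (-β * (2 * ((t : ℂ) - a)))) (t : ℂ) := by
      have := (((((hasDerivAt_id (t : ℂ)).sub_const a).pow 2).const_mul (-(β : ℂ))).cexp)
      refine this.congr_deriv ?_
      simp [gauss]
    refine (e1.mul e2).congr_deriv ?_
    simp
    ring
  exact h1.comp_ofReal

/-- Polynomials times a fixed Gaussian are closed under differentiation, and this yields the
Schwartz decay. -/
theorem iteratedDeriv_polynomial_mul_gauss (β : ℝ) (a : ℂ) (k : ℕ) (p : Polynomial ℂ) :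
    ∃ q : Polynomial ℂ, iteratedDeriv k (fun t : ℝ => p.eval (t : ℂ) * gauss β a t) =
      fun t : ℝ => q.eval (t : ℂ) * gauss β a t := by
  induction k generalizing p with
  | zero => exact ⟨p, iteratedDeriv_zero⟩
  | succ k ih =>
    rw [iteratedDeriv_succ', funext fun t => (hasDerivAt_polynomial_mul_gauss β a p t).deriv]
    exact ih _

/-- The complex Gaussian as a Schwartz function. -/
def gaussSchwartz {β : ℝ} (hβ : 0 < β) (a : ℂ) : SchwartzMap ℝ ℂ where
  toFun t := gauss β a t
  smooth' := by
    unfold gauss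
    exact Complex.contDiff_exp.comp (contDiff_const.mul
      ((Complex.ofRealCLM.contDiff.sub contDiff_const).pow 2))
  decay' := by
    intro k m
    obtain ⟨q, hq⟩ := iteratedDeriv_polynomial_mul_gauss β a m 1
    obtain ⟨C, hC⟩ := exists_bound_polynomial_mul_gauss hβ a (Polynomial.X ^ k * q)
    refine ⟨C, fun t => ?_⟩
    rw [norm_iteratedFDeriv_eq_norm_iteratedDeriv]
    simp only [Polynomial.eval_one, one_mul] at hq
    rw [hq]
    refine le_of_eq_of_le ?_ (hC t)
    rw [Polynomial.eval_mul, mul_assoc, norm_mul]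
    simp

theorem integrable_exp_neg_sq {β : ℝ} (hβ : 0 < β) (a : ℝ) :
    Integrable fun t : ℝ => Real.exp (-β * (t - a) ^ 2) :=
  (integrable_exp_neg_mul_sq hβ).comp_sub_right a

theorem integrable_gauss {β : ℝ} (hβ : 0 < β) (a : ℂ) (y : ℝ) :
    Integrable fun t : ℝ => gauss β a (t - y * Complex.I) := by
  refine Integrable.mono' ((integrable_exp_neg_sq hβ a.re).const_mul (Real.exp (β * (-y - a.im) ^ 2)))
    ?_ (Eventually.of_forall fun t => ?_)
  · have := (differentiable_gauss β a).continuous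
    exact Continuous.aestronglyMeasurable (by fun_prop)
  · rw [norm_gauss]
    simp

/-! ### Shifting the line of integration -/

/-- Cauchy's theorem on rectangles over `[-T, T]`; the vertical sides vanish as `T → ∞` because `B`
tends to zero. -/
theorem integral_shift {Φ : ℂ → ℂ} {y₁ y₂ : ℝ} (h : y₁ ≤ y₂)
    (hΦ : ∀ z : ℂ, -y₂ ≤ z.im → z.im ≤ -y₁ → DifferentiableAt ℂ Φ z) {B : ℝ → ℝ}
    (hB : Integrable B) (hB1 : Tendsto B atTop (𝓝 0)) (hB2 : Tendsto B atBot (𝓝 0))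
    (hb : ∀ x y : ℝ, y₁ ≤ y → y ≤ y₂ → ‖Φ (x - y * Complex.I)‖ ≤ B x) :
    ∫ x : ℝ, Φ (x - y₁ * Complex.I) = ∫ x : ℝ, Φ (x - y₂ * Complex.I) := by
  have hcont : ∀ y, y₁ ≤ y → y ≤ y₂ → Continuous fun x : ℝ => Φ (x - y * Complex.I) := by
    intro y h1 h2
    rw [continuous_iff_continuousAt]
    intro x
    exact ContinuousAt.comp (f := fun x : ℝ => (x : ℂ) - y * Complex.I)
      (hΦ _ (by simpa using h2) (by simpa using h1)).continuousAt (by fun_prop)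
  have hint : ∀ y, y₁ ≤ y → y ≤ y₂ → Integrable fun x : ℝ => Φ (x - y * Complex.I) := fun y h1 h2 =>
    hB.mono' (hcont y h1 h2).aestronglyMeasurable (Eventually.of_forall fun x => hb x y h1 h2)
  have hrect : ∀ T : ℝ, (∫ x in (-T)..T, Φ (x - y₁ * Complex.I)) -
      (∫ x in (-T)..T, Φ (x - y₂ * Complex.I)) +
      Complex.I • (∫ y in (-y₁)..(-y₂), Φ (T + y * Complex.I)) -
      Complex.I • (∫ y in (-y₁)..(-y₂), Φ (-T + y * Complex.I)) = 0 := by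
    intro T
    have := Complex.integral_boundary_rect_eq_zero_of_differentiableOn Φ ⟨-T, -y₁⟩ ⟨T, -y₂⟩ (by
      intro z hz
      obtain ⟨-, hz2⟩ := hz
      change z.im ∈ Set.uIcc (-y₁) (-y₂) at hz2
      rw [Set.uIcc_of_ge (neg_le_neg h)] at hz2
      exact (hΦ z hz2.1 hz2.2).differentiableWithinAt)
    simpa [sub_eq_add_neg] using this
  have hv : ∀ T : ℝ, ‖∫ y in (-y₁)..(-y₂), Φ (T + y * Complex.I)‖ ≤ B T * |-y₂ - -y₁| := fun T => by
    refine intervalIntegral.norm_integral_le_of_norm_le_const fun y hy => ?_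
    rw [Set.uIoc_of_ge (neg_le_neg h)] at hy
    have := hb T (-y) (by linarith [hy.2]) (by linarith [hy.1])
    simpa using this
  have hv1 : Tendsto (fun T : ℝ => ∫ y in (-y₁)..(-y₂), Φ (T + y * Complex.I)) atTop (𝓝 0) := by
    refine squeeze_zero_norm (fun T => hv T) ?_
    simpa using hB1.mul_const (|-y₂ - -y₁|)
  have hv2 : Tendsto (fun T : ℝ => ∫ y in (-y₁)..(-y₂), Φ (-T + y * Complex.I)) atTop (𝓝 0) := by
    refine squeeze_zero_norm (fun T => by simpa using hv (-T)) ?_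
    simpa using (hB2.comp tendsto_neg_atTop_atBot).mul_const (|-y₂ - -y₁|)
  have hl : ∀ y, y₁ ≤ y → y ≤ y₂ → Tendsto (fun T : ℝ => ∫ x in (-T)..T, Φ (x - y * Complex.I)) atTop
      (𝓝 (∫ x : ℝ, Φ (x - y * Complex.I))) := fun y h1 h2 =>
    intervalIntegral_tendsto_integral (hint y h1 h2) tendsto_neg_atTop_atBot tendsto_id
  have := (((hl y₁ le_rfl h).sub (hl y₂ h le_rfl)).add (hv1.const_smul Complex.I)).sub
    (hv2.const_smul Complex.I)
  simp only [hrect, smul_zero, add_zero, sub_zero] at this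
  exact sub_eq_zero.1 (tendsto_nhds_unique tendsto_const_nhds this).symm

/-! ### Kernels of positive type -/

theorem Kernel.differentiableAt (K : Kernel) {z : ℂ} (hz : z.im < 0) :
    DifferentiableAt ℂ (K : ℂ → ℂ) z :=
  K.2.1.differentiableAt ((isOpen_lt Complex.continuous_im continuous_const).mem_nhds hz)

theorem Kernel.continuous_line (K : Kernel) {y : ℝ} (hy : 0 < y) :
    Continuous fun x : ℝ => (K : ℂ → ℂ) (x - y * Complex.I) := by
  rw [continuous_iff_continuousAt]
  intro x
  exact ContinuousAt.comp (f := fun x : ℝ => (x : ℂ) - y * Complex.I)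
    (Kernel.differentiableAt K (by simpa using hy)).continuousAt (by fun_prop)

theorem Kernel.exists_bound (K : Kernel) : ∃ k : ℕ, ∃ C : ℝ, 0 ≤ C ∧ ∀ x y : ℝ, 0 < y → y ≤ 1 →
    ‖(K : ℂ → ℂ) (x - y * Complex.I)‖ ≤ C * y⁻¹ ^ k := by
  obtain ⟨-, -, ℓ, hℓ, C, hC⟩ := K.2
  obtain ⟨k, hk⟩ := exists_nat_ge ℓ
  refine ⟨k, max C 0, le_max_right _ _, fun x y hy hy1 => ?_⟩
  have h1 := hC (x - y * Complex.I) (by simpa using hy1) (by simpa using hy)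
  have h2 : |((x : ℂ) - y * Complex.I).im| = y := by simp [abs_of_pos hy]
  rw [h2] at h1
  have h3 : y ^ k ≤ y ^ ℓ := by
    rw [← Real.rpow_natCast]
    exact Real.rpow_le_rpow_of_exponent_ge hy hy1 hk
  rw [inv_pow, ← div_eq_mul_inv, le_div_iff₀ (by positivity)]
  calc _ ≤ ‖(K : ℂ → ℂ) (x - y * Complex.I)‖ * y ^ ℓ := by gcongr
    _ ≤ C := h1
    _ ≤ _ := le_max_left _ _

theorem tendsto_exp_neg_sq_atTop {β : ℝ} (hβ : 0 < β) (a : ℝ) :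
    Tendsto (fun t : ℝ => Real.exp (-β * (t - a) ^ 2)) atTop (𝓝 0) := by
  refine Real.tendsto_exp_atBot.comp ?_
  have h1 : Tendsto (fun t : ℝ => (t - a) ^ 2) atTop atTop :=
    (tendsto_pow_atTop two_ne_zero).comp (tendsto_atTop_add_const_right _ (-a) tendsto_id)
  exact h1.const_mul_atTop_of_neg (neg_lt_zero.2 hβ)

theorem tendsto_exp_neg_sq_atBot {β : ℝ} (hβ : 0 < β) (a : ℝ) :
    Tendsto (fun t : ℝ => Real.exp (-β * (t - a) ^ 2)) atBot (𝓝 0) := by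
  have := (tendsto_exp_neg_sq_atTop hβ (-a)).comp tendsto_neg_atBot_atTop
  refine this.congr fun t => ?_
  simp only [Function.comp_apply]
  congr 2
  ring

/-- Shifting the line of integration in the pairing of a kernel with a Gaussian. -/
theorem Kernel.integral_gauss_shift (K : Kernel) {β : ℝ} (hβ : 0 < β) (x : ℝ) {y η : ℝ}
    (hy : 0 < y) (hη : 0 ≤ η) (hyη : y + η ≤ 1) :
    ∫ s : ℝ, gauss β (x - η * Complex.I) s * (K : ℂ → ℂ) (s - y * Complex.I) =
      ∫ s : ℝ, gauss β x s * (K : ℂ → ℂ) (s - (y + η : ℝ) * Complex.I) := by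
  obtain ⟨k, C, hC, hK⟩ := Kernel.exists_bound K
  set Φ : ℂ → ℂ := fun z => gauss β (x - ((y + η : ℝ) : ℂ) * Complex.I) z * (K : ℂ → ℂ) z with hΦ
  have key := integral_shift (Φ := Φ) (y₁ := y) (y₂ := y + η) (by linarith)
    (fun z _ hz => ((differentiable_gauss _ _) z).mul (Kernel.differentiableAt K (by linarith)))
    (B := fun s => (Real.exp β * (C * y⁻¹ ^ k)) * Real.exp (-β * (s - x) ^ 2))
    ((integrable_exp_neg_sq hβ x).const_mul _)
    (by simpa using (tendsto_exp_neg_sq_atTop hβ x).const_mul (Real.exp β * (C * y⁻¹ ^ k)))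
    (by simpa using (tendsto_exp_neg_sq_atBot hβ x).const_mul (Real.exp β * (C * y⁻¹ ^ k)))
    (fun s v h1 h2 => by
      have hv : 0 < v := by linarith
      have e1 := hK s v hv (by linarith)
      have e2 : v⁻¹ ^ k ≤ y⁻¹ ^ k := by gcongr
      have e3 : ‖gauss β (x - ((y + η : ℝ) : ℂ) * Complex.I) (s - v * Complex.I)‖ ≤
          Real.exp β * Real.exp (-β * (s - x) ^ 2) := by
        rw [norm_gauss]
        have a1 : ((s : ℂ) - v * Complex.I).im - ((x : ℂ) - ((y + η : ℝ) : ℂ) * Complex.I).im =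
            y + η - v := by simp; ring
        have a2 : ((s : ℂ) - v * Complex.I).re - ((x : ℂ) - ((y + η : ℝ) : ℂ) * Complex.I).re =
            s - x := by simp
        rw [a1, a2]
        gcongr
        have : (y + η - v) ^ 2 ≤ 1 := by
          rw [sq_le_one_iff_abs_le_one, abs_le]
          constructor <;> linarith
        nlinarith
      calc _ = ‖gauss β (x - ((y + η : ℝ) : ℂ) * Complex.I) (s - v * Complex.I)‖ *
            ‖(K : ℂ → ℂ) (s - v * Complex.I)‖ := norm_mul _ _
        _ ≤ (Real.exp β * Real.exp (-β * (s - x) ^ 2)) * (C * y⁻¹ ^ k) := by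
          gcongr
          exact e1.trans (by gcongr)
        _ = _ := by ring)
  have h1 : ∀ s : ℝ, gauss β (x - η * Complex.I) s * (K : ℂ → ℂ) (s - y * Complex.I) =
      Φ (s - y * Complex.I) := fun s => by
    simp only [hΦ, gauss]
    congr 3
    push_cast
    ring
  have h2 : ∀ s : ℝ, gauss β x s * (K : ℂ → ℂ) (s - (y + η : ℝ) * Complex.I) =
      Φ (s - (y + η : ℝ) * Complex.I) := fun s => by
    simp only [hΦ, gauss]
    congr 3
    push_cast
    ring
  simp only [h1, h2, key]

/-- Completing squares in mean and difference variables: the imaginary shift cancels in `s` and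
doubles in `s'`. -/
theorem gauss_mul_gauss (β η a b s s' : ℝ) :
    conj (gauss β (a + η * Complex.I) (s + s' / 2 : ℝ)) * gauss β (b + η * Complex.I) (s - s' / 2 : ℝ) =
      gauss (2 * β) ((a + b) / 2 : ℝ) s * gauss (β / 2) ((a - b : ℝ) - (2 * η : ℝ) * Complex.I) s' := by
  simp only [gauss]
  rw [← Complex.exp_conj, ← Complex.exp_add, ← Complex.exp_add]
  congr 1
  simp only [map_mul, map_neg, map_pow, map_sub, map_add, Complex.conj_ofReal, Complex.conj_I]
  push_cast
  ring

theorem integral_gauss_pos {β : ℝ} (hβ : 0 < β) :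
    ∃ κ : ℝ, 0 < κ ∧ ∀ a : ℝ, ∫ s : ℝ, gauss β a s = κ := by
  refine ⟨√(Real.pi / β), by positivity, fun a => ?_⟩
  rw [← integral_gaussian, ← integral_sub_right_eq_self (fun s : ℝ => Real.exp (-β * s ^ 2)) a,
    ← integral_complex_ofReal]
  refine integral_congr_ae (Eventually.of_forall fun s => ?_)
  simp [gauss]

theorem continuous_gauss_ofReal (β : ℝ) (a : ℂ) : Continuous fun s : ℝ => gauss β a s :=
  (differentiable_gauss β a).continuous.comp Complex.continuous_ofReal

theorem integrable_gauss_mul_kernel (K : Kernel) {β : ℝ} (hβ : 0 < β) (a : ℂ) {y : ℝ} (hy : 0 < y)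
    (hy1 : y ≤ 1) : Integrable fun s : ℝ => gauss β a s * (K : ℂ → ℂ) (s - y * Complex.I) := by
  obtain ⟨k, C, hC, hK⟩ := Kernel.exists_bound K
  have h := integrable_gauss hβ a 0
  simp only [Complex.ofReal_zero, zero_mul, sub_zero] at h
  refine h.mul_bdd (c := C * y⁻¹ ^ k)
    (Kernel.continuous_line K hy).aestronglyMeasurable (Eventually.of_forall fun s => ?_)
  exact hK s y hy hy1

/-- Positivity of a kernel, smeared with Gaussians. -/
theorem PositiveType.gauss_sum {K : Kernel} (hK : PositiveType K) {β : ℝ} (hβ : 0 < β) {y : ℝ}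
    (hy : 0 < y) (hy1 : y < 1) {ι : Type*} [Fintype ι] (x : ι → ℝ) (c : ι → ℂ) :
    ∃ r : ℝ, 0 ≤ r ∧ ∑ i, ∑ j, conj (c i) * c j *
      ∫ s : ℝ, gauss (β / 2) (x i - x j : ℝ) s * (K : ℂ → ℂ) (s - y * Complex.I) = r := by
  have hβ2 : 0 < 2 * β := by positivity
  have hβ' : 0 < β / 2 := by positivity
  obtain ⟨κ, hκ, hκ'⟩ := integral_gauss_pos hβ2
  -- The imaginary part `y/2` gives `ḡ ⋄ g` the centres `x i - x j - iy` in `s'`; a contour shift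
  -- then turns this into depth `y` in the argument of `K`.
  set g : SchwartzMap ℝ ℂ := ∑ i, c i • gaussSchwartz hβ (x i + (y / 2 : ℝ) * Complex.I) with hg
  have hgv : ∀ t : ℝ, g t = ∑ i, c i * gauss β (x i + (y / 2 : ℝ) * Complex.I) t := by
    intro t
    rw [hg]
    simp only [sum_apply, smul_apply, smul_eq_mul]
    rfl
  have hdiam : ∀ s s' : ℝ, diamond (fun t => conj (g t)) g s s' =
      ∑ i, ∑ j, conj (c i) * c j * (gauss (2 * β) ((x i + x j) / 2 : ℝ) s *
        gauss (β / 2) ((x i - x j : ℝ) - y * Complex.I) s') := by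
    intro s s'
    rw [diamond, hgv, hgv, map_sum, Finset.sum_mul_sum]
    refine Finset.sum_congr rfl fun i _ => Finset.sum_congr rfl fun j _ => ?_
    have := gauss_mul_gauss β (y / 2) (x i) (x j) s s'
    rw [show 2 * (y / 2) = y by ring] at this
    rw [← this, map_mul]
    ring
  have hinner : ∀ s' : ℝ, ∫ s : ℝ, diamond (fun t => conj (g t)) g s s' =
      ∑ i, ∑ j, conj (c i) * c j * (κ * gauss (β / 2) ((x i - x j : ℝ) - y * Complex.I) s') := by
    intro s'
    simp only [hdiam]
    have hi : ∀ i j, Integrable fun s : ℝ => conj (c i) * c j *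
        (gauss (2 * β) ((x i + x j) / 2 : ℝ) s *
        gauss (β / 2) ((x i - x j : ℝ) - y * Complex.I) s') := fun i j => by
      have h := integrable_gauss hβ2 ((x i + x j) / 2 : ℝ) 0
      simp only [Complex.ofReal_zero, zero_mul, sub_zero] at h
      exact (h.mul_const _).const_mul _
    rw [integral_finsetSum _ fun i _ => integrable_finsetSum _ fun j _ => hi i j]
    refine Finset.sum_congr rfl fun i _ => ?_
    rw [integral_finsetSum _ fun j _ => hi i j]
    refine Finset.sum_congr rfl fun j _ => ?_
    rw [integral_const_mul, integral_mul_const, hκ']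
  obtain ⟨r, hr, hlim⟩ := hK g
  have houter : ∀ v : ℝ, 0 < v → v + y ≤ 1 → (∫ s' : ℝ, (K : ℂ → ℂ) (s' - v * Complex.I) *
      ∫ s : ℝ, diamond (fun t => conj (g t)) g s s') = κ * ∑ i, ∑ j, conj (c i) * c j *
        ∫ s : ℝ, gauss (β / 2) (x i - x j : ℝ) s * (K : ℂ → ℂ) (s - (v + y : ℝ) * Complex.I) := by
    intro v hv hvy
    have e : ∀ s' : ℝ, (K : ℂ → ℂ) (s' - v * Complex.I) *
        ∫ s : ℝ, diamond (fun t => conj (g t)) g s s' = ∑ i, ∑ j, (κ * (conj (c i) * c j)) *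
        (gauss (β / 2) ((x i - x j : ℝ) - y * Complex.I) s' * (K : ℂ → ℂ) (s' - v * Complex.I)) := by
      intro s'
      rw [hinner, Finset.mul_sum]
      refine Finset.sum_congr rfl fun i _ => ?_
      rw [Finset.mul_sum]
      refine Finset.sum_congr rfl fun j _ => ?_
      ring
    have hi : ∀ i j, Integrable fun s' : ℝ => (κ * (conj (c i) * c j)) *
        (gauss (β / 2) ((x i - x j : ℝ) - y * Complex.I) s' * (K : ℂ → ℂ) (s' - v * Complex.I)) :=
      fun i j => (integrable_gauss_mul_kernel K hβ' _ hv (by linarith)).const_mul _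
    simp only [e]
    rw [integral_finsetSum _ fun i _ => integrable_finsetSum _ fun j _ => hi i j, Finset.mul_sum]
    refine Finset.sum_congr rfl fun i _ => ?_
    rw [integral_finsetSum _ fun j _ => hi i j, Finset.mul_sum]
    refine Finset.sum_congr rfl fun j _ => ?_
    rw [integral_const_mul, Kernel.integral_gauss_shift K hβ' _ hv hy.le hvy]
    ring
  -- After the shift the limit `v → 0` ends at the interior line `Im z = -y`, where `K` is
  -- continuous and bounded.
  have hcont : ∀ a : ℝ, Tendsto (fun v : ℝ => ∫ s : ℝ, gauss (β / 2) a s *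
      (K : ℂ → ℂ) (s - (v + y : ℝ) * Complex.I)) (𝓝[>] 0)
      (𝓝 (∫ s : ℝ, gauss (β / 2) a s * (K : ℂ → ℂ) (s - y * Complex.I))) := by
    intro a
    obtain ⟨k, C, hC, hKb⟩ := Kernel.exists_bound K
    have h := integrable_gauss hβ' a 0
    simp only [Complex.ofReal_zero, zero_mul, sub_zero] at h
    refine tendsto_integral_filter_of_dominated_convergence
      (fun s => ‖gauss (β / 2) a s‖ * (C * y⁻¹ ^ k)) ?_ ?_ (h.norm.mul_const _) ?_
    · filter_upwards [self_mem_nhdsWithin] with v hv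
      exact ((continuous_gauss_ofReal _ _).mul
        (Kernel.continuous_line K (add_pos hv hy))).aestronglyMeasurable
    · filter_upwards [self_mem_nhdsWithin,
        nhdsWithin_le_nhds (gt_mem_nhds (show (0 : ℝ) < 1 - y by linarith))] with v hv hv1
      have hv0 : (0 : ℝ) < v := hv
      refine Eventually.of_forall fun s => ?_
      rw [norm_mul]
      gcongr
      refine (hKb s (v + y) (by positivity) (by linarith)).trans ?_
      gcongr
      linarith
    · refine Eventually.of_forall fun s => Tendsto.const_mul _ ?_
      have h1 : ContinuousAt (fun v : ℝ => (K : ℂ → ℂ) (s - (v + y : ℝ) * Complex.I)) 0 :=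
        ContinuousAt.comp (f := fun v : ℝ => (s : ℂ) - (v + y : ℝ) * Complex.I)
          (Kernel.differentiableAt K (by simpa using hy)).continuousAt (by fun_prop)
      have h2 := h1.tendsto.mono_left (nhdsWithin_le_nhds (s := Set.Ioi 0))
      simpa using h2
  have hlim2 : Tendsto (fun v : ℝ => (κ : ℂ) * ∑ i, ∑ j, conj (c i) * c j *
      ∫ s : ℝ, gauss (β / 2) (x i - x j : ℝ) s * (K : ℂ → ℂ) (s - (v + y : ℝ) * Complex.I)) (𝓝[>] 0)
      (𝓝 (κ * ∑ i, ∑ j, conj (c i) * c j *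
      ∫ s : ℝ, gauss (β / 2) (x i - x j : ℝ) s * (K : ℂ → ℂ) (s - y * Complex.I))) :=
    Tendsto.const_mul _ (tendsto_finsetSum _ fun i _ => tendsto_finsetSum _ fun j _ =>
      (hcont _).const_mul _)
  have hlim3 := hlim.congr' (by
    filter_upwards [self_mem_nhdsWithin,
      nhdsWithin_le_nhds (gt_mem_nhds (show (0 : ℝ) < 1 - y by linarith))] with v hv hv1
    exact houter v hv (by linarith))
  have := tendsto_nhds_unique hlim2 hlim3
  refine ⟨κ⁻¹ * r, by positivity, ?_⟩
  rw [Complex.ofReal_mul, ← this, Complex.ofReal_inv, inv_mul_cancel_left₀]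
  exact_mod_cast hκ.ne'

/-- Below the real axis, a kernel of positive type is a function of positive type. -/
theorem PositiveType.sum_nonneg {K : Kernel} (hK : PositiveType K) {y : ℝ}
    (hy : 0 < y) (hy1 : y < 1) {ι : Type*} [Fintype ι] (x : ι → ℝ) (c : ι → ℂ) :
    ∃ r : ℝ, 0 ≤ r ∧ ∑ i, ∑ j, conj (c i) * c j * (K : ℂ → ℂ) ((x i - x j : ℝ) - y * Complex.I) = r := by
  obtain ⟨κ, hκ, hκ'⟩ := integral_gauss_pos (β := 1) one_pos
  obtain ⟨k, C, hC, hKb⟩ := Kernel.exists_bound K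
  have hg := integrable_gauss one_pos 0 0
  simp only [Complex.ofReal_zero, zero_mul, sub_zero] at hg
  -- Gaussians of width `1/(m+1)`, rescaled to a fixed one, form an approximate identity. The
  -- parameter `2(m+1)²` allows for the halving of `β` in the difference variable.
  have hscale : ∀ (m : ℕ) (a : ℝ), ((m : ℂ) + 1) * ∫ s : ℝ, gauss ((2 * (m + 1 : ℝ) ^ 2) / 2) a s *
      (K : ℂ → ℂ) (s - y * Complex.I) =
      ∫ s : ℝ, gauss 1 0 s * (K : ℂ → ℂ) ((a + ((m : ℝ) + 1)⁻¹ * s : ℝ) - y * Complex.I) := by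
    intro m a
    have hm : (0 : ℝ) < m + 1 := by positivity
    have e1 := Measure.integral_comp_mul_left (fun s : ℝ => gauss ((m + 1 : ℝ) ^ 2) a (a + s : ℝ) *
      (K : ℂ → ℂ) ((a + s : ℝ) - y * Complex.I)) ((m : ℝ) + 1)⁻¹
    rw [integral_add_left_eq_self (fun s : ℝ => gauss ((m + 1 : ℝ) ^ 2) a s *
      (K : ℂ → ℂ) (s - y * Complex.I)) a, inv_inv, abs_of_pos hm] at e1
    rw [show (2 * (m + 1 : ℝ) ^ 2) / 2 = (m + 1 : ℝ) ^ 2 by ring]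
    rw [Complex.real_smul] at e1
    push_cast at e1 ⊢
    rw [← e1]
    refine integral_congr_ae (Eventually.of_forall fun s => ?_)
    have hmc : (m : ℂ) + 1 ≠ 0 := by exact_mod_cast hm.ne'
    simp only [gauss]
    congr 2
    push_cast
    field_simp
    ring
  have hlim : ∀ a : ℝ, Tendsto (fun m : ℕ => ∫ s : ℝ, gauss 1 0 s *
      (K : ℂ → ℂ) ((a + ((m : ℝ) + 1)⁻¹ * s : ℝ) - y * Complex.I)) atTop
      (𝓝 (κ * (K : ℂ → ℂ) (a - y * Complex.I))) := by
    intro a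
    have e : (κ : ℂ) * (K : ℂ → ℂ) (a - y * Complex.I) =
        ∫ s : ℝ, gauss 1 0 s * (K : ℂ → ℂ) (a - y * Complex.I) := by
      rw [integral_mul_const]
      have := hκ' 0
      rw [Complex.ofReal_zero] at this
      rw [this]
    rw [e]
    refine tendsto_integral_of_dominated_convergence (fun s => ‖gauss 1 0 s‖ * (C * y⁻¹ ^ k))
      (fun m => ?_) (hg.norm.mul_const _) (fun m => Eventually.of_forall fun s => ?_)
      (Eventually.of_forall fun s => ?_)
    · exact ((continuous_gauss_ofReal _ _).mul ((Kernel.continuous_line K hy).comp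
        (g := fun x : ℝ => (K : ℂ → ℂ) (x - y * Complex.I))
        (f := fun s : ℝ => a + ((m : ℝ) + 1)⁻¹ * s) (by fun_prop))).aestronglyMeasurable
    · rw [norm_mul]
      gcongr
      exact hKb _ y hy hy1.le
    · refine Tendsto.const_mul _ ?_
      have h1 : Tendsto (fun m : ℕ => a + ((m : ℝ) + 1)⁻¹ * s) atTop (𝓝 a) := by
        have h2 : Tendsto (fun m : ℕ => ((m : ℝ) + 1)⁻¹) atTop (𝓝 0) := by
          simpa using tendsto_one_div_add_atTop_nhds_zero_nat (𝕜 := ℝ)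
        simpa using (h2.mul_const s).const_add a
      exact ((Kernel.continuous_line K hy).tendsto a).comp h1
  have hpos : ∀ m : ℕ, ∃ r : ℝ, 0 ≤ r ∧ ∑ i, ∑ j, conj (c i) * c j *
      ∫ s : ℝ, gauss 1 0 s * (K : ℂ → ℂ) (((x i - x j : ℝ) + ((m : ℝ) + 1)⁻¹ * s : ℝ) - y * Complex.I)
        = r := by
    intro m
    obtain ⟨r, hr, h⟩ := hK.gauss_sum (β := 2 * (m + 1 : ℝ) ^ 2) (by positivity) hy hy1 x c
    refine ⟨(m + 1) * r, by positivity, ?_⟩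
    push_cast
    rw [← h, Finset.mul_sum]
    refine Finset.sum_congr rfl fun i _ => ?_
    rw [Finset.mul_sum]
    refine Finset.sum_congr rfl fun j _ => ?_
    have := hscale m (x i - x j)
    push_cast at this ⊢
    rw [← this]
    ring
  choose r hr hr' using hpos
  have hl : Tendsto (fun m => (r m : ℂ)) atTop (𝓝 (∑ i, ∑ j, conj (c i) * c j *
      (κ * (K : ℂ → ℂ) ((x i - x j : ℝ) - y * Complex.I)))) := by
    simp only [← hr']
    exact tendsto_finsetSum _ fun i _ => tendsto_finsetSum _ fun j _ => (hlim _).const_mul _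
  have hre := (Complex.continuous_re.tendsto _).comp hl
  have him := (Complex.continuous_im.tendsto _).comp hl
  simp only [Function.comp_def, Complex.ofReal_re, Complex.ofReal_im] at hre him
  set S := ∑ i, ∑ j, conj (c i) * c j * (κ * (K : ℂ → ℂ) ((x i - x j : ℝ) - y * Complex.I)) with hS
  have h1 : 0 ≤ S.re := ge_of_tendsto' hre hr
  have h2 : S.im = 0 := (tendsto_nhds_unique tendsto_const_nhds him).symm
  refine ⟨κ⁻¹ * S.re, by positivity, ?_⟩
  have h3 : (S.re : ℂ) = S := Complex.ext rfl (by simp [h2])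
  rw [Complex.ofReal_mul, h3, hS, Finset.mul_sum]
  refine Finset.sum_congr rfl fun i _ => ?_
  rw [Finset.mul_sum]
  refine Finset.sum_congr rfl fun j _ => ?_
  have : (κ : ℂ) ≠ 0 := by exact_mod_cast hκ.ne'
  push_cast
  field_simp

end QI

namespace QI

/-! ### Positive semidefinite kernels -/

open scoped ComplexOrder in
-- Moore–Aronszajn: the vectors are the kernel functions in the reproducing kernel Hilbert space of
-- `k`.
theorem exists_feature_map {k : Matrix ℝ ℝ ℂ} (hk : k.PosSemidef) :
    ∃ (F : Type) (_ : NormedAddCommGroup F) (_ : InnerProductSpace ℂ F) (_ : CompleteSpace F)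
      (v : ℝ → F), ∀ s t, ⟪v s, v t⟫_ℂ = k s t := by
  set κ : Matrix ℝ ℝ (ℂ →L[ℂ] ℂ) := Matrix.of fun s t => k s t • (1 : ℂ →L[ℂ] ℂ) with hκ
  have hpos : κ.PosSemidef := by
    have htfae := (RKHS.posSemidef_tfae (K := κ)).out 0 2
    refine htfae.2 ⟨?_, fun w => ?_⟩
    · ext s t
      rw [Matrix.conjTranspose_apply, hκ, Matrix.of_apply, Matrix.of_apply, star_smul, star_one,
        ← hk.isHermitian.apply t s, star_star]
    · have h1 := hk.2 w
      -- The inner product is conjugate linear in its first slot, so the operator-valued criterion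
      -- gives the conjugate of the matrix form.
      have h2 : (w.sum fun x a => w.sum fun x' b => ⟪κ x' x a, b⟫_ℂ) =
          conj (w.sum fun i xi => w.sum fun j xj => star xi * k i j * xj) := by
        rw [Finsupp.sum_comm]
        simp only [Finsupp.sum, map_sum]
        refine Finset.sum_congr rfl fun i _ => Finset.sum_congr rfl fun j _ => ?_
        simp [hκ]
        ring
      rw [h2]
      have := (Complex.le_def.1 h1).1
      simpa using this
  have : Fact κ.PosSemidef := ⟨hpos⟩
  refine ⟨RKHS.OfKernel κ, inferInstance, inferInstance, inferInstance,
    fun t => RKHS.kerFun (RKHS.OfKernel κ) t 1, fun s t => ?_⟩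
  rw [← RKHS.kernel_inner, RKHS.OfKernel.kernel_ofKernel]
  simp [hκ, ← hk.isHermitian.apply t s]

/-- `‖v s - v t‖²` is an expression in `k`, continuous in `s` and zero at `s = t`. -/
theorem continuous_of_inner {F : Type*} [NormedAddCommGroup F] [InnerProductSpace ℂ F]
    {v : ℝ → F} {k : ℝ → ℝ → ℂ} (hk : Continuous (Function.uncurry k))
    (h : ∀ s t, ⟪v s, v t⟫_ℂ = k s t) : Continuous v := by
  rw [continuous_iff_continuousAt]
  intro t
  rw [ContinuousAt, tendsto_iff_norm_sub_tendsto_zero]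
  have h1 : ∀ s, ‖v s - v t‖ = √((k s s).re - 2 * (k s t).re + (k t t).re) := fun s => by
    rw [← Real.sqrt_sq (norm_nonneg (v s - v t)), norm_sub_sq (𝕜 := ℂ), h,
      ← inner_self_eq_norm_sq (𝕜 := ℂ), ← inner_self_eq_norm_sq (𝕜 := ℂ), h, h]
    rfl
  simp only [h1]
  have hc : Continuous fun s => √((k s s).re - 2 * (k s t).re + (k t t).re) := by
    have a : Continuous fun s => k s s := hk.comp (continuous_id.prodMk continuous_id)
    have b : Continuous fun s => k s t := hk.comp (continuous_id.prodMk continuous_const)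
    fun_prop
  have := hc.tendsto t
  rwa [show (k t t).re - 2 * (k t t).re + (k t t).re = 0 by ring, Real.sqrt_zero] at this

open scoped ComplexOrder in
/-- A continuous positive semidefinite kernel defines a positive quadratic form on test functions. -/
theorem integral_integral_nonneg {k : ℝ → ℝ → ℂ} (hk : Continuous (Function.uncurry k))
    (hp : (Matrix.of k).PosSemidef) {f : ℝ → ℂ} (hf : Continuous f) (hf' : HasCompactSupport f) :
    ∃ r : ℝ, 0 ≤ r ∧ ∫ t, ∫ t', conj (f t) * f t' * k t t' = r := by
  obtain ⟨F, _, _, _, v, hv⟩ := exists_feature_map hp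
  have hvc : Continuous v := continuous_of_inner hk hv
  have hint : Integrable fun t => f t • v t :=
    (hf.smul hvc).integrable_of_hasCompactSupport hf'.smul_right
  -- The feature map turns the double integral into a squared norm.
  refine ⟨‖∫ t, f t • v t‖ ^ 2, by positivity, ?_⟩
  have h1 : ∀ t, ∫ t', conj (f t) * f t' * k t t' = ⟪f t • v t, ∫ t', f t' • v t'⟫_ℂ := fun t => by
    rw [← integral_inner hint]
    refine integral_congr_ae (Eventually.of_forall fun t' => ?_)
    simp only [inner_smul_left, inner_smul_right, hv]
    change _ = f t' * (conj (f t) * k t t')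
    ring
  simp only [h1]
  have h2 : ∀ t, ⟪f t • v t, ∫ t', f t' • v t'⟫_ℂ = conj ⟪∫ t', f t' • v t', f t • v t⟫_ℂ := fun t =>
    (inner_conj_symm _ _).symm
  simp only [h2]
  rw [integral_conj, integral_inner hint, inner_self_eq_norm_sq_to_K]
  simp

theorem eq_zero_of_hasCompactSupport {f : ℝ → ℂ} (hf : HasCompactSupport f) :
    ∃ d : ℝ, 0 < d ∧ ∀ t, d ≤ |t| → f t = 0 := by
  obtain ⟨r, hr, h⟩ := hf.isCompact.isBounded.subset_ball_lt 0 0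
  refine ⟨r, hr, fun t ht => ?_⟩
  by_contra hne
  have := h (subset_tsupport f hne)
  rw [mem_ball_zero_iff, Real.norm_eq_abs] at this
  linarith

open scoped ComplexOrder in
/-- The form of the previous result, in the variables `s = (t + t') / 2`, `s' = t - t'`. -/
theorem integral_diamond_nonneg {k : ℝ → ℝ → ℂ} (hk : Continuous (Function.uncurry k))
    (hp : (Matrix.of k).PosSemidef) {f : ℝ → ℂ} (hf : Continuous f) (hf' : HasCompactSupport f) :
    ∃ r : ℝ, 0 ≤ r ∧ ∫ s, ∫ s', diamond (fun t => conj (f t)) f s s' * k (s + s' / 2) (s - s' / 2) = r := by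
  obtain ⟨d, hd, hfd⟩ := eq_zero_of_hasCompactSupport hf'
  obtain ⟨r, hr, h⟩ := integral_integral_nonneg hk hp hf hf'
  refine ⟨r, hr, ?_⟩
  rw [← h]
  have hcont : ∀ A B : ℝ × ℝ → ℝ, Continuous A → Continuous B →
      Continuous fun x => conj (f (A x)) * f (B x) * k (A x) (B x) := fun A B hA hB => by
    have := hk.comp (hA.prodMk hB)
    have e : Continuous fun x => k (A x) (B x) := this
    fun_prop
  -- The planar change of variables is split into exchanges of integrals, the translation `t = s +
  -- s'/2` at fixed `s'`, and the reflection `t' = t - s'` at fixed `t`.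
  calc _ = ∫ s', ∫ s, diamond (fun t => conj (f t)) f s s' * k (s + s' / 2) (s - s' / 2) := by
        refine integral_integral_swap_of_hasCompactSupport
          (hcont (fun x => x.1 + x.2 / 2) (fun x => x.1 - x.2 / 2) (by fun_prop) (by fun_prop))
          (HasCompactSupport.intro (K := Set.Icc (-(2 * d)) (2 * d) ×ˢ Set.Icc (-(2 * d)) (2 * d))
            (isCompact_Icc.prod isCompact_Icc) ?_)
        rintro ⟨s, s'⟩ hx
        simp only [Function.uncurry, diamond]
        by_contra hne
        have h1 : |s + s' / 2| < d := lt_of_not_ge fun hh => hne (by simp [hfd _ hh])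
        have h2 : |s - s' / 2| < d := lt_of_not_ge fun hh => hne (by simp [hfd _ hh])
        rw [abs_lt] at h1 h2
        exact hx ⟨⟨by linarith, by linarith⟩, ⟨by linarith, by linarith⟩⟩
    _ = ∫ s', ∫ t, conj (f t) * f (t - s') * k t (t - s') := by
        refine integral_congr_ae (Eventually.of_forall fun s' => ?_)
        have := integral_add_right_eq_self (μ := volume)
          (fun t => conj (f t) * f (t - s') * k t (t - s')) (s' / 2)
        refine Eq.trans ?_ this
        refine integral_congr_ae (Eventually.of_forall fun s => ?_)
        simp only [diamond]
        rw [show s + s' / 2 - s' = s - s' / 2 by ring]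
    _ = ∫ t, ∫ s', conj (f t) * f (t - s') * k t (t - s') := by
        refine integral_integral_swap_of_hasCompactSupport
          (hcont (fun x => x.2) (fun x => x.2 - x.1) (by fun_prop) (by fun_prop))
          (HasCompactSupport.intro (K := Set.Icc (-(2 * d)) (2 * d) ×ˢ Set.Icc (-(2 * d)) (2 * d))
            (isCompact_Icc.prod isCompact_Icc) ?_)
        rintro ⟨s', t⟩ hx
        simp only [Function.uncurry]
        by_contra hne
        have h1 : |t| < d := lt_of_not_ge fun hh => hne (by simp [hfd _ hh])
        have h2 : |t - s'| < d := lt_of_not_ge fun hh => hne (by simp [hfd _ hh])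
        rw [abs_lt] at h1 h2
        exact hx ⟨⟨by linarith, by linarith⟩, ⟨by linarith, by linarith⟩⟩
    _ = _ := by
        refine integral_congr_ae (Eventually.of_forall fun t => ?_)
        exact integral_sub_left_eq_self (fun t' => conj (f t) * f t' * k t t') volume t

/-! ### Positivity of the classically positive products -/

/-- Positivity at the two points `0, x` forces the quadratic form to be real; the coefficients `c =
0, 1, i` extract the hermitean symmetry by polarization. -/
theorem PositiveType.conj_eq {K : Kernel} (hK : PositiveType K) {y : ℝ} (hy : 0 < y) (hy1 : y < 1)
    (x : ℝ) : conj ((K : ℂ → ℂ) (x - y * Complex.I)) = (K : ℂ → ℂ) ((-x : ℝ) - y * Complex.I) := by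
  set a := (K : ℂ → ℂ) ((x : ℝ) - y * Complex.I) with ha
  set b := (K : ℂ → ℂ) ((-x : ℝ) - y * Complex.I) with hb
  set e := (K : ℂ → ℂ) ((0 : ℝ) - y * Complex.I) with he
  have key : ∀ c : ℂ, (c * conj c * e + c * b + (conj c * a + e)).im = 0 := by
    intro c
    obtain ⟨r, -, hr⟩ := hK.sum_nonneg hy hy1 (ι := Fin 2) ![0, x] ![conj c, 1]
    simp only [Fin.sum_univ_two, Matrix.cons_val_zero, Matrix.cons_val_one, Complex.conj_conj,
      map_one, one_mul, mul_one, sub_zero, zero_sub, sub_self, ← ha, ← hb, ← he] at hr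
    rw [hr, Complex.ofReal_im]
  have h0 := key 0
  have h1 := key 1
  have h2 := key Complex.I
  simp at h0 h1 h2
  apply Complex.ext <;> simp <;> linarith

open scoped ComplexOrder in
theorem PositiveType.posSemidef {K : Kernel} (hK : PositiveType K) {y : ℝ} (hy : 0 < y) (hy1 : y < 1) :
    (Matrix.of fun t t' : ℝ => (K : ℂ → ℂ) ((t - t' : ℝ) - y * Complex.I)).PosSemidef := by
  refine ⟨?_, fun w => ?_⟩
  · ext t t'
    rw [Matrix.conjTranspose_apply, Matrix.of_apply, Matrix.of_apply]
    change conj _ = _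
    rw [hK.conj_eq hy hy1, neg_sub]
  · obtain ⟨r, hr, h⟩ := hK.sum_nonneg hy hy1 (fun i : w.support => (i : ℝ)) (fun i => w i)
    have : (w.sum fun i xi => w.sum fun j xj => star xi *
        (Matrix.of fun t t' : ℝ => (K : ℂ → ℂ) ((t - t' : ℝ) - y * Complex.I)) i j * xj) = r := by
      rw [← h, Finsupp.sum, ← Finset.sum_coe_sort]
      refine Finset.sum_congr rfl fun i _ => ?_
      rw [Finsupp.sum, ← Finset.sum_coe_sort]
      refine Finset.sum_congr rfl fun j _ => ?_
      rw [Matrix.of_apply]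
      change conj _ * _ * _ = _
      ring
    rw [this]
    exact Complex.zero_le_real.2 hr

open scoped ComplexOrder in
theorem posSemidef_inner {F : Type*} [NormedAddCommGroup F] [InnerProductSpace ℂ F] (v : ℝ → F) :
    (Matrix.of fun t t' => ⟪v t, v t'⟫_ℂ).PosSemidef := by
  refine ⟨?_, fun w => ?_⟩
  · ext t t'
    exact inner_conj_symm _ _
  · have : (w.sum fun i xi => w.sum fun j xj => star xi *
        (Matrix.of fun t t' => ⟪v t, v t'⟫_ℂ) i j * xj) =
        ((‖∑ i ∈ w.support, w i • v i‖ ^ 2 : ℝ) : ℂ) := by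
      have h1 := inner_self_eq_norm_sq_to_K (𝕜 := ℂ) (∑ i ∈ w.support, w i • v i)
      rw [sum_inner] at h1
      simp only [inner_sum, inner_smul_left, inner_smul_right] at h1
      rw [Complex.ofReal_pow]
      refine Eq.trans ?_ h1
      refine Finset.sum_congr rfl fun i _ => Finset.sum_congr rfl fun j _ => ?_
      change conj (w i) * ⟪v i, v j⟫_ℂ * w j = _
      ring
    rw [this]
    exact Complex.zero_le_real.2 (by positivity)

/-- Positivity of the regularized products of a kernel of positive type with a two-point function. -/
theorem PositiveType.integral_diamond_nonneg {K : Kernel} (hK : PositiveType K) {y : ℝ} (hy : 0 < y)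
    (hy1 : y < 1) {F : Type*} [NormedAddCommGroup F] [InnerProductSpace ℂ F] {Ψ : ℝ → F}
    (hΨ : Continuous Ψ) (g : Test) :
    ∃ r : ℝ, 0 ≤ r ∧ ∫ s : ℝ, ∫ s' : ℝ, diamondTest (conjTest g) g s s' *
      (K : ℂ → ℂ) (s' - y * Complex.I) * ⟪Ψ (s + s' / 2), Ψ (s - s' / 2)⟫_ℂ = r := by
  have hc : Continuous (Function.uncurry fun t t' : ℝ =>
      (K : ℂ → ℂ) ((t - t' : ℝ) - y * Complex.I) * ⟪Ψ t, Ψ t'⟫_ℂ) := by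
    have h1 := (Kernel.continuous_line K hy).comp (continuous_fst.sub continuous_snd : Continuous fun x : ℝ × ℝ => x.1 - x.2)
    exact h1.mul ((hΨ.comp continuous_fst).inner (hΨ.comp continuous_snd))
  obtain ⟨r, hr, h⟩ := QI.integral_diamond_nonneg hc
    ((hK.posSemidef hy hy1).hadamard (posSemidef_inner Ψ)) (g.contDiff.continuous) g.hasCompactSupport
  refine ⟨r, hr, ?_⟩
  rw [← h]
  refine integral_congr_ae (Eventually.of_forall fun s => ?_)
  refine integral_congr_ae (Eventually.of_forall fun s' => ?_)
  simp only
  rw [show s + s' / 2 - (s - s' / 2) = s' by ring, mul_assoc]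
  rfl

end QI

namespace QI

/-! ### Boundary values of analytic functions -/

theorem hasDerivAt_comp_line {G : ℂ → ℂ} {x y : ℝ} (hG : DifferentiableAt ℂ G (x - y * Complex.I)) :
    HasDerivAt (fun x : ℝ => G (x - y * Complex.I)) (deriv G (x - y * Complex.I)) x ∧
    HasDerivAt (fun y : ℝ => G (x - y * Complex.I)) (-Complex.I * deriv G (x - y * Complex.I)) y := by
  constructor
  · have h1 : HasDerivAt (fun x : ℝ => (x : ℂ) - y * Complex.I) 1 x :=
      (Complex.ofRealCLM.hasDerivAt (x := x)).sub_const _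
    have h2 := HasDerivAt.scomp (h := fun x : ℝ => (x : ℂ) - y * Complex.I) x hG.hasDerivAt h1
    exact h2.congr_deriv (one_smul _ _)
  · have h1 : HasDerivAt (fun y : ℝ => (x : ℂ) - y * Complex.I) (-Complex.I) y := by
      have := ((Complex.ofRealCLM.hasDerivAt (x := y)).mul_const Complex.I).const_sub (x : ℂ)
      exact this.congr_deriv (by simp)
    exact HasDerivAt.scomp (h := fun y : ℝ => (x : ℂ) - y * Complex.I) y hG.hasDerivAt h1

/-- By the Cauchy–Riemann equations `∂_y` is `-i ∂_x` on `G(x - iy)`, and integration by parts moves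
the derivative onto `f`. -/
theorem hasDerivAt_boundary_integral {G : ℂ → ℂ} (hG : ∀ z : ℂ, z.im < 0 → DifferentiableAt ℂ G z)
    {f : ℝ → ℂ} (hf : ContDiff ℝ 1 f) (hf' : HasCompactSupport f) {y : ℝ} (hy : 0 < y) :
    HasDerivAt (fun y : ℝ => ∫ x : ℝ, f x * G (x - y * Complex.I))
      (Complex.I * ∫ x : ℝ, deriv f x * G (x - y * Complex.I)) y := by
  have hO : IsOpen {z : ℂ | z.im < 0} := isOpen_lt Complex.continuous_im continuous_const
  have hG' : DifferentiableOn ℂ G {z | z.im < 0} := fun z hz => (hG z hz).differentiableWithinAt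
  have hdG : ContinuousOn (deriv G) {z | z.im < 0} := (hG'.deriv hO).continuousOn
  have hline : ∀ y : ℝ, 0 < y → ∀ x : ℝ, ((x : ℂ) - y * Complex.I).im < 0 := fun y hy x => by simpa
  have hc1 : ∀ y : ℝ, 0 < y → Continuous fun x : ℝ => G (x - y * Complex.I) := fun y hy =>
    hG'.continuousOn.comp_continuous (by fun_prop) (hline y hy)
  have hc2 : ∀ y : ℝ, 0 < y → Continuous fun x : ℝ => deriv G (x - y * Complex.I) := fun y hy =>
    hdG.comp_continuous (by fun_prop) (hline y hy)
  obtain ⟨d, hd, hfd⟩ := eq_zero_of_hasCompactSupport hf'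
  obtain ⟨B, hB⟩ := (isCompact_Icc (a := -d) (b := d)).prod (isCompact_Icc (a := y / 2) (b := 2 * y))
    |>.exists_bound_of_continuousOn (f := fun p : ℝ × ℝ => deriv G (p.1 - p.2 * Complex.I))
      (hdG.comp (by fun_prop) (by
        rintro ⟨a, b⟩ ⟨-, hb, -⟩
        exact hline b (by linarith [show y / 2 ≤ b from hb]) a))
  have key := (hasDerivAt_integral_of_dominated_loc_of_deriv_le (μ := volume) (x₀ := y)
    (s := Set.Ioo (y / 2) (2 * y))
    (F := fun (y : ℝ) (x : ℝ) => f x * G (x - y * Complex.I))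
    (F' := fun (y : ℝ) (x : ℝ) => f x * (-Complex.I * deriv G (x - y * Complex.I)))
    (bound := fun x => ‖f x‖ * B) (Ioo_mem_nhds (by linarith) (by linarith))
    (by
      filter_upwards [eventually_gt_nhds hy] with y hy
      exact (hf.continuous.mul (hc1 y hy)).aestronglyMeasurable)
    ((hf.continuous.mul (hc1 y hy)).integrable_of_hasCompactSupport hf'.mul_right)
    ((hf.continuous.mul (continuous_const.mul (hc2 y hy))).aestronglyMeasurable)
    (Eventually.of_forall fun x y' hy' => by
      rw [norm_mul, norm_mul, norm_neg, Complex.norm_I, one_mul]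
      by_cases hx : d ≤ |x|
      · simp [hfd x hx]
      · push Not at hx
        rw [abs_lt] at hx
        gcongr
        exact hB (x, y') ⟨⟨hx.1.le, hx.2.le⟩, ⟨hy'.1.le, hy'.2.le⟩⟩)
    ((hf.continuous.norm.mul continuous_const).integrable_of_hasCompactSupport hf'.norm.mul_right)
    (Eventually.of_forall fun x y' hy' =>
      (hasDerivAt_comp_line (hG _ (hline y' (by linarith [hy'.1]) x))).2.const_mul (f x))).2
  refine key.congr_deriv ?_
  have hparts := integral_mul_deriv_eq_deriv_mul_of_integrable (u := f)
    (v := fun x : ℝ => G (x - y * Complex.I)) (u' := deriv f)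
    (v' := fun x : ℝ => deriv G (x - y * Complex.I))
    (fun x _ => ((hf.differentiable one_ne_zero) x).hasDerivAt)
    (fun x _ => (hasDerivAt_comp_line (hG _ (hline y hy x))).1)
    ((hf.continuous.mul (hc2 y hy)).integrable_of_hasCompactSupport hf'.mul_right)
    (((hf.continuous_deriv le_rfl).mul (hc1 y hy)).integrable_of_hasCompactSupport hf'.deriv.mul_right)
    ((hf.continuous.mul (hc1 y hy)).integrable_of_hasCompactSupport hf'.mul_right)
  have : ∀ x : ℝ, f x * (-Complex.I * deriv G (x - y * Complex.I)) =
      -Complex.I * (f x * deriv G (x - y * Complex.I)) := fun x => by ring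
  simp only [this]
  rw [integral_const_mul, hparts]
  ring

/-- Integrating the bound for `h'` over `[y, 1]` improves the exponent by one; the exponent `-1` is
excluded to avoid a logarithm. -/
theorem boundary_integral_step {h h' : ℝ → ℂ} (hd : ∀ y, 0 < y → HasDerivAt h (h' y) y)
    (hc : ∀ y, 0 < y → ContinuousAt h' y) {D r : ℝ} (hr : r + 1 ≠ 0)
    (hb : ∀ y, 0 < y → y ≤ 1 → ‖h' y‖ ≤ D * y ^ r) {y : ℝ} (hy : 0 < y) (hy1 : y ≤ 1) :
    ‖h y‖ ≤ ‖h 1‖ + D * ((1 - y ^ (r + 1)) / (r + 1)) := by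
  have hpos : ∀ t ∈ Set.uIcc y 1, 0 < t := fun t ht => by
    rw [Set.uIcc_of_le hy1] at ht
    linarith [ht.1]
  have h1 : ∫ t in y..1, h' t = h 1 - h y :=
    intervalIntegral.integral_eq_sub_of_hasDerivAt (fun t ht => hd t (hpos t ht))
      (ContinuousOn.intervalIntegrable fun t ht => (hc t (hpos t ht)).continuousWithinAt)
  have h0 : (0 : ℝ) ∉ Set.uIcc y 1 := fun hh => lt_irrefl _ (hpos 0 hh)
  have h2 : ‖∫ t in y..1, h' t‖ ≤ ∫ t in y..1, D * t ^ r := by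
    refine intervalIntegral.norm_integral_le_of_norm_le hy1
      (Eventually.of_forall fun t ht => hb t (by linarith [ht.1]) ht.2) ?_
    exact (intervalIntegral.intervalIntegrable_rpow (Or.inr h0)).const_mul D
  rw [intervalIntegral.integral_const_mul, integral_rpow (Or.inr ⟨by
    intro hh; apply hr; linarith, h0⟩), Real.one_rpow, h1] at h2
  calc ‖h y‖ = ‖h 1 - (h 1 - h y)‖ := by rw [sub_sub_cancel]
    _ ≤ ‖h 1‖ + ‖h 1 - h y‖ := norm_sub_le _ _
    _ ≤ _ := by gcongr

/-- The sum of the `L¹` norms of the first derivatives. -/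
def derivSum (k : ℕ) (f : ℝ → ℂ) : ℝ := ∑ i ∈ Finset.range (k + 1), ∫ x, ‖iteratedDeriv i f x‖

theorem derivSum_nonneg (k : ℕ) (f : ℝ → ℂ) : 0 ≤ derivSum k f :=
  Finset.sum_nonneg fun _ _ => integral_nonneg fun _ => norm_nonneg _

theorem derivSum_succ (k : ℕ) (f : ℝ → ℂ) :
    derivSum (k + 1) f = derivSum k (deriv f) + ∫ x, ‖f x‖ := by
  rw [derivSum, Finset.sum_range_succ']
  simp only [iteratedDeriv_succ', iteratedDeriv_zero]
  rfl

theorem norm_boundary_integral_le {G : ℂ → ℂ} {A : ℝ} {M : ℕ}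
    (hA : ∀ x y : ℝ, 0 < y → y ≤ 1 → ‖G (x - y * Complex.I)‖ ≤ A * y⁻¹ ^ M)
    {f : ℝ → ℂ} (hf : Integrable f) {y : ℝ} (hy : 0 < y) (hy1 : y ≤ 1) :
    ‖∫ x : ℝ, f x * G (x - y * Complex.I)‖ ≤ A * y⁻¹ ^ M * ∫ x, ‖f x‖ := by
  rw [← integral_const_mul]
  refine norm_integral_le_of_norm_le (hf.norm.const_mul _) (Eventually.of_forall fun x => ?_)
  rw [norm_mul, mul_comm]
  gcongr
  exact hA x y hy hy1

/-- Each step trades one derivative of `f` for one power of `y`. The initial loss of `1/2` keeps the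
exponents half-integral, so that `-1` never occurs. -/
theorem exists_boundary_bound_aux (M j : ℕ) (hj : j ≤ M) : ∃ C : ℝ, 0 ≤ C ∧ ∀ (G : ℂ → ℂ) (A : ℝ),
    0 ≤ A → (∀ z : ℂ, z.im < 0 → DifferentiableAt ℂ G z) →
    (∀ x y : ℝ, 0 < y → y ≤ 1 → ‖G (x - y * Complex.I)‖ ≤ A * y⁻¹ ^ M) →
    ∀ f : ℝ → ℂ, ContDiff ℝ ∞ f → HasCompactSupport f → ∀ y : ℝ, 0 < y → y ≤ 1 →
      ‖∫ x : ℝ, f x * G (x - y * Complex.I)‖ ≤ C * A * derivSum j f * y ^ (-(M + 1 / 2) + j : ℝ) := by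
  induction j with
  | zero =>
    refine ⟨1, zero_le_one, fun G A hA0 hG hA f hf hf' y hy hy1 => ?_⟩
    refine (norm_boundary_integral_le hA (hf.continuous.integrable_of_hasCompactSupport hf') hy hy1).trans ?_
    have h1 : y⁻¹ ^ M ≤ y ^ (-(M + 1 / 2) + (0 : ℕ) : ℝ) := by
      rw [inv_pow, ← Real.rpow_natCast, ← Real.rpow_neg hy.le]
      exact Real.rpow_le_rpow_of_exponent_ge hy hy1 (by push_cast; linarith)
    have h2 : derivSum 0 f = ∫ x, ‖f x‖ := by simp [derivSum]
    rw [h2]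
    have h3 : 0 ≤ ∫ x, ‖f x‖ := integral_nonneg fun _ => norm_nonneg _
    calc _ ≤ A * y ^ (-(M + 1 / 2) + (0 : ℕ) : ℝ) * ∫ x, ‖f x‖ := by gcongr
      _ = _ := by ring
  | succ j ih =>
    obtain ⟨C, hC, hj'⟩ := ih (by omega)
    refine ⟨1 + 2 * C, by positivity, fun G A hA0 hG hA f hf hf' y hy hy1 => ?_⟩
    have hfd : ContDiff ℝ ∞ (deriv f) := hf.deriv'
    set r : ℝ := -(M + 1 / 2) + j with hr
    have hjM : (j : ℝ) + 1 ≤ M := by exact_mod_cast hj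
    have hr1 : r + 1 ≤ -(1 / 2) := by rw [hr]; linarith
    have hstep := boundary_integral_step (r := r) (D := C * A * derivSum j (deriv f))
      (fun y hy => hasDerivAt_boundary_integral hG (hf.of_le (by simp)) hf' hy)
      (fun y hy => (hasDerivAt_boundary_integral hG (hfd.of_le (by simp)) hf'.deriv hy).continuousAt.const_mul _)
      (by linarith) (fun y hy hy1 => by
        rw [norm_mul, Complex.norm_I, one_mul]
        exact hj' G A hA0 hG hA _ hfd hf'.deriv y hy hy1) hy hy1
    have h1 : ‖∫ x : ℝ, f x * G (x - (1 : ℝ) * Complex.I)‖ ≤ A * ∫ x, ‖f x‖ := by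
      simpa using norm_boundary_integral_le hA (hf.continuous.integrable_of_hasCompactSupport hf') one_pos le_rfl
    have hy2 : 1 ≤ y ^ (r + 1) := Real.one_le_rpow_of_pos_of_le_one_of_nonpos hy hy1 (by linarith)
    have h2 : (1 - y ^ (r + 1)) / (r + 1) ≤ 2 * y ^ (r + 1) := by
      rw [div_le_iff_of_neg (by linarith)]
      nlinarith
    have h3 : 0 ≤ ∫ x, ‖f x‖ := integral_nonneg fun _ => norm_nonneg _
    have h4 := derivSum_nonneg j (deriv f)
    have he : (-(M + 1 / 2) + (j + 1 : ℕ) : ℝ) = r + 1 := by rw [hr]; push_cast; ring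
    rw [he, derivSum_succ]
    calc _ ≤ A * (∫ x, ‖f x‖) * y ^ (r + 1) + C * A * derivSum j (deriv f) * (2 * y ^ (r + 1)) := by
          refine hstep.trans (add_le_add (h1.trans ?_) (by gcongr))
          exact le_mul_of_one_le_right (by positivity) hy2
      _ ≤ _ := by
          have a1 : 0 ≤ C * A * (∫ x, ‖f x‖) * y ^ (r + 1) := by positivity
          have a2 : 0 ≤ A * derivSum j (deriv f) * y ^ (r + 1) := by positivity
          nlinarith

/-- Functions of moderate growth at the boundary have boundary values in the sense of distributions,
with a uniform bound. -/
theorem exists_boundary_bound (M : ℕ) : ∃ C : ℝ, 0 ≤ C ∧ ∀ (G : ℂ → ℂ) (A : ℝ),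
    0 ≤ A → (∀ z : ℂ, z.im < 0 → DifferentiableAt ℂ G z) →
    (∀ x y : ℝ, 0 < y → y ≤ 1 → ‖G (x - y * Complex.I)‖ ≤ A * y⁻¹ ^ M) →
    ∀ f : ℝ → ℂ, ContDiff ℝ ∞ f → HasCompactSupport f → ∀ y : ℝ, 0 < y → y ≤ 1 →
      ‖∫ x : ℝ, f x * G (x - y * Complex.I)‖ ≤ C * A * derivSum (M + 1) f := by
  obtain ⟨C, hC, hM⟩ := exists_boundary_bound_aux M M le_rfl
  refine ⟨1 + 2 * C, by positivity, fun G A hA0 hG hA f hf hf' y hy hy1 => ?_⟩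
  have hfd : ContDiff ℝ ∞ (deriv f) := hf.deriv'
  have hr : (-(M + 1 / 2) + M : ℝ) = -(1 / 2) := by ring
  rw [hr] at hM
  -- After `M` steps the exponent is `-1/2`, integrable at `0`; one more integration removes the
  -- singularity.
  have hstep := boundary_integral_step (r := -(1 / 2)) (D := C * A * derivSum M (deriv f))
    (fun y hy => hasDerivAt_boundary_integral hG (hf.of_le (by simp)) hf' hy)
    (fun y hy => (hasDerivAt_boundary_integral hG (hfd.of_le (by simp)) hf'.deriv hy).continuousAt.const_mul _)
    (by norm_num) (fun y hy hy1 => by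
      rw [norm_mul, Complex.norm_I, one_mul]
      exact hM G A hA0 hG hA _ hfd hf'.deriv y hy hy1) hy hy1
  have h1 : ‖∫ x : ℝ, f x * G (x - (1 : ℝ) * Complex.I)‖ ≤ A * ∫ x, ‖f x‖ := by
    simpa using norm_boundary_integral_le hA (hf.continuous.integrable_of_hasCompactSupport hf') one_pos le_rfl
  have h2 : (1 - y ^ (-(1 / 2) + 1 : ℝ)) / (-(1 / 2) + 1) ≤ 2 := by
    rw [div_le_iff₀ (by norm_num)]
    have := Real.rpow_nonneg hy.le (-(1 / 2) + 1 : ℝ)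
    linarith
  have h3 : 0 ≤ ∫ x, ‖f x‖ := integral_nonneg fun _ => norm_nonneg _
  have h4 := derivSum_nonneg M (deriv f)
  rw [derivSum_succ]
  calc _ ≤ A * (∫ x, ‖f x‖) + C * A * derivSum M (deriv f) * 2 :=
        hstep.trans (add_le_add h1 (by gcongr))
    _ ≤ _ := by
        have a1 : 0 ≤ C * A * (∫ x, ‖f x‖) := by positivity
        have a2 : 0 ≤ A * derivSum M (deriv f) := by positivity
        nlinarith

end QI

namespace QI

/-! ### Test functions -/

/-- The derivative of a test function. -/
def derivTest (f : Test) : Test where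
  toFun := deriv f
  contDiff' := (show ContDiff ℝ ∞ f from f.contDiff).deriv'
  hasCompactSupport' := f.hasCompactSupport.deriv
  tsupport_subset' := fun _ _ => trivial

theorem hasDerivAt_test (f : Test) (x : ℝ) : HasDerivAt f (derivTest f x) x :=
  ((show ContDiff ℝ ∞ f from f.contDiff).differentiable (by simp) x).hasDerivAt

theorem iteratedDeriv_test (k : ℕ) (f : Test) : iteratedDeriv k f = (derivTest^[k] f : Test) := by
  induction k generalizing f with
  | zero => rw [iteratedDeriv_zero]; rfl
  | succ k ih => rw [iteratedDeriv_succ', Function.iterate_succ_apply, ← ih]; rfl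

theorem derivTest_sub (f g : Test) : derivTest (f - g) = derivTest f - derivTest g := by
  ext x
  exact ((hasDerivAt_test f x).sub (hasDerivAt_test g x)).deriv

theorem derivTest_add (f g : Test) : derivTest (f + g) = derivTest f + derivTest g := by
  ext x
  exact ((hasDerivAt_test f x).add (hasDerivAt_test g x)).deriv

theorem derivTest_smul (c : ℂ) (f : Test) : derivTest (c • f) = c • derivTest f := by
  ext x
  exact ((hasDerivAt_test f x).const_smul c).deriv

theorem iterate_derivTest_sub (k : ℕ) (f g : Test) :
    derivTest^[k] (f - g) = derivTest^[k] f - derivTest^[k] g := by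
  induction k generalizing f g with
  | zero => rfl
  | succ k ih => rw [Function.iterate_succ_apply, derivTest_sub, ih]; rfl

theorem iterate_derivTest_smul (k : ℕ) (c : ℂ) (f : Test) :
    derivTest^[k] (c • f) = c • derivTest^[k] f := by
  induction k generalizing f with
  | zero => rfl
  | succ k ih => rw [Function.iterate_succ_apply, derivTest_smul, ih]; rfl

theorem Test.exists_bound (f : Test) : ∃ B : ℝ, 0 ≤ B ∧ ∀ x, ‖f x‖ ≤ B := by
  obtain ⟨B, hB⟩ := f.continuous.bounded_above_of_compact_support f.hasCompactSupport
  exact ⟨B, (norm_nonneg _).trans (hB 0), hB⟩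

theorem Test.integrable (f : Test) : Integrable f :=
  f.continuous.integrable_of_hasCompactSupport f.hasCompactSupport

theorem Test.norm_le_integral (f : Test) (x : ℝ) : ‖f x‖ ≤ ∫ t, ‖derivTest f t‖ := by
  rw [← HasCompactSupport.integral_Iic_deriv_eq ((show ContDiff ℝ ∞ f from f.contDiff).of_le (by simp))
    f.hasCompactSupport x]
  exact (norm_integral_le_integral_norm _).trans (setIntegral_le_integral (derivTest f).integrable.norm
    (Eventually.of_forall fun _ => norm_nonneg _))

theorem Test.SupportedIn.eq_zero {f : Test} {d : ℝ} (hf : f.SupportedIn d) {x : ℝ} (hx : d ≤ |x|) :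
    f x = 0 := by
  by_contra hne
  have := hf (subset_tsupport f hne)
  rw [Set.mem_Ioo, ← abs_lt] at this
  linarith

theorem Test.supportedIn_of_lt {f : Test} {d e : ℝ} (hde : d < e) (hf : ∀ x, d < |x| → f x = 0) :
    f.SupportedIn e := by
  have h : tsupport f ⊆ Set.Icc (-d) d := by
    refine closure_minimal (fun x hx => ?_) isClosed_Icc
    rw [Set.mem_Icc, ← abs_le]
    exact le_of_not_gt fun hh => hx (hf x hh)
  exact h.trans fun x hx => ⟨by linarith [hx.1], by linarith [hx.2]⟩

theorem Test.exists_supportedIn (f : Test) : ∃ d : ℝ, 0 < d ∧ f.SupportedIn d := by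
  obtain ⟨d, hd, h⟩ := eq_zero_of_hasCompactSupport f.hasCompactSupport
  exact ⟨d + 1, by linarith, Test.supportedIn_of_lt (lt_add_one d) fun x hx => h x hx.le⟩

theorem Test.SupportedIn.mono {f : Test} {d e : ℝ} (hde : d ≤ e) (hf : f.SupportedIn d) :
    f.SupportedIn e :=
  hf.trans (Set.Ioo_subset_Ioo (neg_le_neg hde) hde)

theorem Test.SupportedIn.derivTest {f : Test} {d : ℝ} (hf : f.SupportedIn d) :
    (derivTest f).SupportedIn d :=
  (tsupport_deriv_subset).trans hf

theorem Test.SupportedIn.conjTest {f : Test} {d : ℝ} (hf : f.SupportedIn d) :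
    (conjTest f).SupportedIn d :=
  (closure_mono fun x hx => by
    intro h0
    apply hx
    change conj (f x) = 0
    rw [h0, map_zero]).trans hf

theorem Test.SupportedIn.iterate_derivTest {f : Test} {d : ℝ} (hf : f.SupportedIn d) (k : ℕ) :
    (QI.derivTest^[k] f).SupportedIn d := by
  induction k with
  | zero => exact hf
  | succ k ih => rw [Function.iterate_succ_apply']; exact ih.derivTest

theorem Test.SupportedIn.integral_norm_le {f : Test} {d B : ℝ} (hd : 0 < d) (hf : f.SupportedIn d)
    (hB : ∀ x, ‖f x‖ ≤ B) : ∫ x, ‖f x‖ ≤ 2 * d * B := by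
  have h1 : ∫ x, ‖f x‖ = ∫ x in Set.Icc (-d) d, ‖f x‖ := by
    rw [setIntegral_eq_integral_of_forall_compl_eq_zero]
    intro x hx
    rw [hf.eq_zero, norm_zero]
    rw [Set.mem_Icc, ← abs_le] at hx
    exact (not_le.1 hx).le
  have h2 := norm_setIntegral_le_of_norm_le_const (μ := volume) (s := Set.Icc (-d) d)
    (f := fun x => ‖f x‖) (C := B) (by simp) (fun x _ => by simpa using hB x)
  rw [← h1, Real.norm_eq_abs, abs_of_nonneg (integral_nonneg fun _ => norm_nonneg _)] at h2
  refine h2.trans_eq ?_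
  rw [Measure.real, Real.volume_Icc, ENNReal.toReal_ofReal (by linarith)]
  ring

/-! ### Scaled Sobolev norms of test functions -/

theorem le_sobNorm (d : ℝ) {k m : ℕ} (h : k ≤ m) (f : ℝ → ℂ) :
    d ^ k * ∫ t, ‖iteratedDeriv k f t‖ ≤ sobNorm d m f :=
  Finset.le_sup' (fun k => d ^ k * ∫ t, ‖iteratedDeriv k f t‖) (by simp; omega)

theorem sobNorm_nonneg (d : ℝ) (m : ℕ) (f : ℝ → ℂ) : 0 ≤ sobNorm d m f :=
  le_trans (by simpa using integral_nonneg fun _ => norm_nonneg _) (le_sobNorm d (Nat.zero_le m) f)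

theorem sobNorm_mono {d : ℝ} {m m' : ℕ} (h : m ≤ m') (f : ℝ → ℂ) : sobNorm d m f ≤ sobNorm d m' f :=
  Finset.sup'_le _ _ fun k hk => le_sobNorm d (by simp at hk; omega) f

theorem sobNorm_conjTest (d : ℝ) (m : ℕ) (g : Test) : sobNorm d m (conjTest g) = sobNorm d m g := by
  have h : ∀ k, derivTest^[k] (conjTest g) = conjTest (derivTest^[k] g) := by
    intro k
    induction k with
    | zero => rfl
    | succ k ih =>
      rw [Function.iterate_succ_apply', ih, Function.iterate_succ_apply']
      ext x
      exact ((hasDerivAt_test _ x).star).deriv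
  unfold sobNorm
  congr 1
  funext k
  rw [iteratedDeriv_test, iteratedDeriv_test, h]
  congr 2
  funext t
  exact RCLike.norm_conj _

theorem sobNorm_le_of_bound {f : Test} {d B : ℝ} {m : ℕ} (hd : 0 < d) (hf : f.SupportedIn d)
    (hB0 : 0 ≤ B) (hB : ∀ k ≤ m, ∀ x, ‖(derivTest^[k] f) x‖ ≤ B) :
    sobNorm d m f ≤ max 1 d ^ m * (2 * d * B) := by
  refine Finset.sup'_le _ _ fun k hk => ?_
  have hk' : k ≤ m := by simp at hk; omega
  rw [iteratedDeriv_test]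
  have h1 := (hf.iterate_derivTest k).integral_norm_le hd (hB k hk')
  have h2 : d ^ k ≤ max 1 d ^ m :=
    (pow_le_pow_left₀ hd.le (le_max_right _ _) k).trans (pow_le_pow_right₀ (le_max_left _ _) hk')
  have : 0 ≤ 2 * d * B := by positivity
  gcongr

/-- A supremum is bounded by the `L¹` norm of one further derivative, whence the order `m + 1`. The
powers of `d⁻¹` do no harm: the estimate is used only at fixed `d`. -/
theorem norm_iterate_derivTest_le {d : ℝ} (hd : 0 < d) {k m : ℕ} (hk : k ≤ m) (g : Test) (x : ℝ) :
    ‖(derivTest^[k] g) x‖ ≤ max 1 d⁻¹ ^ (m + 1) * sobNorm d (m + 1) g := by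
  refine (Test.norm_le_integral _ x).trans ?_
  have h1 := le_sobNorm d (show k + 1 ≤ m + 1 by omega) g
  rw [iteratedDeriv_test, Function.iterate_succ_apply'] at h1
  have h2 : ∫ t, ‖derivTest (derivTest^[k] g) t‖ ≤ d⁻¹ ^ (k + 1) * sobNorm d (m + 1) g := by
    rw [inv_pow, ← div_eq_inv_mul, le_div_iff₀ (by positivity), mul_comm]
    exact h1
  refine h2.trans ?_
  have h3 := sobNorm_nonneg d (m + 1) g
  gcongr
  exact (pow_le_pow_left₀ (by positivity) (le_max_right _ _) _).trans
    (pow_le_pow_right₀ (le_max_left _ _) (by omega))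

/-! ### The test functions `g₁ ⋄ g₂` -/

theorem diamondTest_apply (g₁ g₂ : Test) (s s' : ℝ) :
    diamondTest g₁ g₂ s s' = g₁ (s + s' / 2) * g₂ (s - s' / 2) := rfl

theorem derivTest_diamondTest (g₁ g₂ : Test) (s : ℝ) : derivTest (diamondTest g₁ g₂ s) =
    (1 / 2 : ℂ) • (diamondTest (derivTest g₁) g₂ s - diamondTest g₁ (derivTest g₂) s) := by
  ext x
  have h1 : HasDerivAt (fun x : ℝ => g₁ (s + x / 2)) ((1 / 2 : ℝ) • derivTest g₁ (s + x / 2)) x :=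
    HasDerivAt.scomp (h := fun x : ℝ => s + x / 2) x (hasDerivAt_test g₁ _)
      (((hasDerivAt_id x).div_const 2).const_add s)
  have h2 : HasDerivAt (fun x : ℝ => g₂ (s - x / 2)) ((-(1 / 2) : ℝ) • derivTest g₂ (s - x / 2)) x :=
    HasDerivAt.scomp (h := fun x : ℝ => s - x / 2) x (hasDerivAt_test g₂ _)
      (((hasDerivAt_id x).div_const 2).const_sub s)
  have h3 := (h1.mul h2).deriv
  refine Eq.trans h3 ?_
  change _ = (1 / 2 : ℂ) * (derivTest g₁ (s + x / 2) * g₂ (s - x / 2) -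
    g₁ (s + x / 2) * derivTest g₂ (s - x / 2))
  simp only [Complex.real_smul]
  push_cast
  ring

theorem hasDerivAt_diamondTest_left (g₁ g₂ : Test) (s s' : ℝ) :
    HasDerivAt (fun s => diamondTest g₁ g₂ s s')
      (diamondTest (derivTest g₁) g₂ s s' + diamondTest g₁ (derivTest g₂) s s') s := by
  have h1 : HasDerivAt (fun s : ℝ => g₁ (s + s' / 2)) (derivTest g₁ (s + s' / 2)) s :=
    (hasDerivAt_test g₁ _).comp_add_const s _
  have h2 : HasDerivAt (fun s : ℝ => g₂ (s - s' / 2)) (derivTest g₂ (s - s' / 2)) s :=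
    (hasDerivAt_test g₂ _).comp_sub_const s _
  exact h1.mul h2

/-- Each derivative in `s'` is half of a difference of two terms of the same kind, so the constant
does not grow. -/
theorem norm_iterate_derivTest_diamondTest_le (k : ℕ) (g₁ g₂ : Test) {A B : ℝ}
    (hA : ∀ i ≤ k, ∀ x, ‖(derivTest^[i] g₁) x‖ ≤ A) (hB : ∀ i ≤ k, ∀ x, ‖(derivTest^[i] g₂) x‖ ≤ B)
    (s s' : ℝ) : ‖(derivTest^[k] (diamondTest g₁ g₂ s)) s'‖ ≤ A * B := by
  induction k generalizing g₁ g₂ with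
  | zero =>
    have hA0 : 0 ≤ A := (norm_nonneg _).trans (hA 0 le_rfl 0)
    change ‖g₁ (s + s' / 2) * g₂ (s - s' / 2)‖ ≤ _
    rw [norm_mul]
    exact mul_le_mul (hA 0 le_rfl _) (hB 0 le_rfl _) (norm_nonneg _) hA0
  | succ k ih =>
    rw [Function.iterate_succ_apply, derivTest_diamondTest, iterate_derivTest_smul,
      iterate_derivTest_sub]
    have h1 := ih (derivTest g₁) g₂ (fun i hi x => hA (i + 1) (by omega) x)
      (fun i hi x => hB i (by omega) x)
    have h2 := ih g₁ (derivTest g₂) (fun i hi x => hA i (by omega) x)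
      (fun i hi x => hB (i + 1) (by omega) x)
    change ‖(1 / 2 : ℂ) * (_ - _)‖ ≤ _
    rw [norm_mul]
    have h3 : ‖(1 / 2 : ℂ)‖ = 1 / 2 := by norm_num
    rw [h3]
    have := norm_sub_le ((derivTest^[k] (diamondTest (derivTest g₁) g₂ s)) s')
      ((derivTest^[k] (diamondTest g₁ (derivTest g₂) s)) s')
    linarith

/-- The second-order remainder of `s ↦ (g₁ ⋄ g₂)(s, · )`. -/
def diamondRem (g₁ g₂ : Test) (s h : ℝ) : Test :=
  diamondTest g₁ g₂ (s + h) - diamondTest g₁ g₂ s -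
    (h : ℂ) • (diamondTest (derivTest g₁) g₂ s + diamondTest g₁ (derivTest g₂) s)

/-- The remainder obeys the same product rule as `g₁ ⋄ g₂`, so its estimate at order zero yields all
orders. -/
theorem derivTest_diamondRem (g₁ g₂ : Test) (s h : ℝ) : derivTest (diamondRem g₁ g₂ s h) =
    (1 / 2 : ℂ) • (diamondRem (derivTest g₁) g₂ s h - diamondRem g₁ (derivTest g₂) s h) := by
  unfold diamondRem
  rw [derivTest_sub, derivTest_sub, derivTest_smul, derivTest_add, derivTest_diamondTest,
    derivTest_diamondTest, derivTest_diamondTest, derivTest_diamondTest]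
  module

theorem norm_sub_sub_smul_le {φ φ' φ'' : ℝ → ℂ} (h1 : ∀ t, HasDerivAt φ (φ' t) t)
    (h2 : ∀ t, HasDerivAt φ' (φ'' t) t) {C : ℝ} (hC : ∀ t, ‖φ'' t‖ ≤ C) (s h : ℝ) :
    ‖φ (s + h) - φ s - h * φ' s‖ ≤ C * h ^ 2 := by
  have hl : ∀ t, ‖φ' t - φ' s‖ ≤ C * |t - s| := fun t =>
    Convex.norm_image_sub_le_of_norm_hasDerivWithin_le (f := φ') (f' := φ'') (s := Set.univ)
      (fun t _ => (h2 t).hasDerivWithinAt) (fun t _ => hC t) convex_univ trivial trivial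
  have hC0 : 0 ≤ C := (norm_nonneg _).trans (hC 0)
  have key := Convex.norm_image_sub_le_of_norm_hasDerivWithin_le
    (f := fun t : ℝ => φ t - (t : ℂ) * φ' s) (f' := fun t => φ' t - φ' s) (s := Set.uIcc s (s + h))
    (C := C * |h|)
    (fun t _ => ((h1 t).sub (((Complex.ofRealCLM.hasDerivAt (x := t)).mul_const (φ' s)).congr_deriv
      (by simp))).hasDerivWithinAt)
    (fun t ht => (hl t).trans (by
      refine mul_le_mul_of_nonneg_left ?_ hC0
      have := Set.abs_sub_left_of_mem_uIcc ht
      simpa using this))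
    (convex_uIcc _ _) Set.left_mem_uIcc Set.right_mem_uIcc
  have e : φ (s + h) - φ s - h * φ' s = φ (s + h) - ((s + h : ℝ) : ℂ) * φ' s - (φ s - s * φ' s) := by
    push_cast; ring
  rw [e]
  refine key.trans_eq ?_
  rw [add_sub_cancel_left, Real.norm_eq_abs, mul_assoc, ← sq, sq_abs]

/-- Quadratic smallness in `h`, uniform in `s` and `s'` and at every order, is what makes a
distribution of finite order differentiable along `s ↦ (g₁ ⋄ g₂)(s, · )`. -/
theorem exists_bound_diamondRem (k : ℕ) (g₁ g₂ : Test) : ∃ C : ℝ, 0 ≤ C ∧ ∀ s h s' : ℝ,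
    ‖(derivTest^[k] (diamondRem g₁ g₂ s h)) s'‖ ≤ C * h ^ 2 := by
  induction k generalizing g₁ g₂ with
  | zero =>
    have hb : ∀ a b : Test, ∃ C : ℝ, 0 ≤ C ∧ ∀ s s', ‖diamondTest a b s s'‖ ≤ C := fun a b => by
      obtain ⟨A, hA, hA'⟩ := a.exists_bound
      obtain ⟨B, hB, hB'⟩ := b.exists_bound
      refine ⟨A * B, by positivity, fun s s' => ?_⟩
      rw [diamondTest_apply, norm_mul]
      exact mul_le_mul (hA' _) (hB' _) (norm_nonneg _) hA
    obtain ⟨C₁, h1, h1'⟩ := hb (derivTest (derivTest g₁)) g₂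
    obtain ⟨C₂, h2, h2'⟩ := hb (derivTest g₁) (derivTest g₂)
    obtain ⟨C₃, h3, h3'⟩ := hb g₁ (derivTest (derivTest g₂))
    refine ⟨C₁ + C₂ + (C₂ + C₃), by positivity, fun s h s' => ?_⟩
    exact norm_sub_sub_smul_le (φ := fun s => diamondTest g₁ g₂ s s')
      (fun t => hasDerivAt_diamondTest_left g₁ g₂ t s')
      (fun t => (hasDerivAt_diamondTest_left (derivTest g₁) g₂ t s').add
        (hasDerivAt_diamondTest_left g₁ (derivTest g₂) t s'))
      (fun t => (norm_add_le _ _).trans (add_le_add ((norm_add_le _ _).trans (add_le_add (h1' _ _) (h2' _ _)))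
        ((norm_add_le _ _).trans (add_le_add (h2' _ _) (h3' _ _))))) s h
  | succ k ih =>
    obtain ⟨C₁, h1, h1'⟩ := ih (derivTest g₁) g₂
    obtain ⟨C₂, h2, h2'⟩ := ih g₁ (derivTest g₂)
    refine ⟨C₁ + C₂, by positivity, fun s h s' => ?_⟩
    rw [Function.iterate_succ_apply, derivTest_diamondRem, iterate_derivTest_smul,
      iterate_derivTest_sub]
    change ‖(1 / 2 : ℂ) * (_ - _)‖ ≤ _
    rw [norm_mul]
    have h3 : ‖(1 / 2 : ℂ)‖ = 1 / 2 := by norm_num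
    rw [h3]
    have := norm_sub_le ((derivTest^[k] (diamondRem (derivTest g₁) g₂ s h)) s')
      ((derivTest^[k] (diamondRem g₁ (derivTest g₂) s h)) s')
    have a1 := h1' s h s'
    have a2 := h2' s h s'
    have a3 := norm_nonneg ((derivTest^[k] (diamondRem (derivTest g₁) g₂ s h)) s')
    have a4 := norm_nonneg ((derivTest^[k] (diamondRem g₁ (derivTest g₂) s h)) s')
    linarith

theorem diamondTest_eq_zero {g₁ g₂ : Test} {d : ℝ} (h₁ : g₁.SupportedIn d) (h₂ : g₂.SupportedIn d)
    {s s' : ℝ} (h : d ≤ |s| ∨ 2 * d ≤ |s'|) : diamondTest g₁ g₂ s s' = 0 := by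
  rw [diamondTest_apply]
  by_contra hne
  have e1 : |s + s' / 2| < d := lt_of_not_ge fun hh => hne (by rw [h₁.eq_zero hh, zero_mul])
  have e2 : |s - s' / 2| < d := lt_of_not_ge fun hh => hne (by rw [h₂.eq_zero hh, mul_zero])
  rw [abs_lt] at e1 e2
  rcases h with h | h
  · rcases le_abs.1 h with h | h <;> linarith
  · rcases le_abs.1 h with h | h <;> linarith

/-- Vanishing for `|s'| ≥ 2d` puts the closed support inside `[-2d, 2d]`; the radius `3d` is any
larger one, leaving room for an open interval. -/
theorem supportedIn_diamondTest {g₁ g₂ : Test} {d : ℝ} (hd : 0 < d) (h₁ : g₁.SupportedIn d)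
    (h₂ : g₂.SupportedIn d) (s : ℝ) : (diamondTest g₁ g₂ s).SupportedIn (3 * d) :=
  Test.supportedIn_of_lt (d := 2 * d) (by linarith) fun _ hx => diamondTest_eq_zero h₁ h₂ (Or.inr hx.le)

theorem supportedIn_diamondRem {g₁ g₂ : Test} {d : ℝ} (hd : 0 < d) (h₁ : g₁.SupportedIn d)
    (h₂ : g₂.SupportedIn d) (s h : ℝ) : (diamondRem g₁ g₂ s h).SupportedIn (3 * d) := by
  refine Test.supportedIn_of_lt (d := 2 * d) (by linarith) fun x hx => ?_
  change diamondTest g₁ g₂ (s + h) x - diamondTest g₁ g₂ s x -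
    (h : ℂ) * (diamondTest (derivTest g₁) g₂ s x + diamondTest g₁ (derivTest g₂) s x) = 0
  rw [diamondTest_eq_zero h₁ h₂ (Or.inr hx.le), diamondTest_eq_zero h₁ h₂ (Or.inr hx.le),
    diamondTest_eq_zero h₁.derivTest h₂ (Or.inr hx.le), diamondTest_eq_zero h₁ h₂.derivTest (Or.inr hx.le)]
  simp

theorem diamondTest_eq_zero_of_le {g₁ g₂ : Test} {d : ℝ} (h₁ : g₁.SupportedIn d)
    (h₂ : g₂.SupportedIn d) {s : ℝ} (h : d ≤ |s|) : diamondTest g₁ g₂ s = 0 := by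
  ext x
  exact diamondTest_eq_zero h₁ h₂ (Or.inl h)

end QI

namespace QI

variable {n : ℕ} {𝓗 : Type*} [NormedAddCommGroup 𝓗] [InnerProductSpace ℂ 𝓗] [CompleteSpace 𝓗]

namespace LocalNet

variable (N : LocalNet n 𝓗)

/-! ### Field-valued distributions -/

/-- `T` is a distribution of order `m` with values in the forms of finite norm `‖ · ‖_{-ℓ}`. -/
def FieldBound (ℓ : ℝ) (m : ℕ) (T : Test →ₗ[ℂ] N.SmoothDual) : Prop :=
  ∀ d > (0 : ℝ), ∃ c : ℝ, 0 ≤ c ∧ ∀ f : Test, f.SupportedIn d → ∀ σ : N.SmoothFunctional,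
    ‖T f σ‖ ≤ c * sobNorm d m f * N.normFun ℓ σ.val

theorem IsFieldDistribution.fieldBound {N : LocalNet n 𝓗} {T : Test →ₗ[ℂ] N.SmoothDual}
    (hT : N.IsFieldDistribution T) : ∃ ℓ > (0 : ℝ), ∃ m : ℕ, N.FieldBound ℓ m T := by
  obtain ⟨ℓ, hℓ, m, h⟩ := hT
  refine ⟨ℓ, hℓ, m, fun d hd => ?_⟩
  obtain ⟨c, hc⟩ := h d hd
  refine ⟨|c|, abs_nonneg _, fun f hf σ => (hc f hf σ).trans ?_⟩
  have h1 := sobNorm_nonneg d m f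
  have h2 := N.normFun_nonneg hℓ σ
  gcongr
  exact le_abs_self c

theorem FieldBound.mono {N : LocalNet n 𝓗} {ℓ ℓ' : ℝ} {m m' : ℕ} {T : Test →ₗ[ℂ] N.SmoothDual}
    (hT : N.FieldBound ℓ m T) (hℓ : 0 < ℓ) (hℓ' : ℓ ≤ ℓ') (hm : m ≤ m') : N.FieldBound ℓ' m' T := by
  intro d hd
  obtain ⟨c, hc, h⟩ := hT d hd
  refine ⟨c, hc, fun f hf σ => (h f hf σ).trans ?_⟩
  have h1 := sobNorm_nonneg d m f
  have h2 := N.normFun_nonneg hℓ σ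
  have h3 := sobNorm_mono (d := d) hm f
  have h4 := N.normFun_mono hℓ hℓ' σ
  exact mul_le_mul (mul_le_mul_of_nonneg_left h3 hc) h4 h2 (mul_nonneg hc (h1.trans h3))

theorem FieldBound.sub {N : LocalNet n 𝓗} {ℓ : ℝ} {m : ℕ} {T T' : Test →ₗ[ℂ] N.SmoothDual}
    (hT : N.FieldBound ℓ m T) (hT' : N.FieldBound ℓ m T') : N.FieldBound ℓ m (T - T') := by
  intro d hd
  obtain ⟨c, hc, h⟩ := hT d hd
  obtain ⟨c', hc', h'⟩ := hT' d hd
  refine ⟨c + c', by positivity, fun f hf σ => ?_⟩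
  change ‖T f σ - T' f σ‖ ≤ _
  rw [add_mul, add_mul]
  exact (norm_sub_le _ _).trans (add_le_add (h f hf σ) (h' f hf σ))

theorem FieldBound.exists_diamond_bound {N : LocalNet n 𝓗} {ℓ : ℝ} (hℓ : 0 < ℓ) {m : ℕ}
    {T : Test →ₗ[ℂ] N.SmoothDual} (hT : N.FieldBound ℓ m T) {d : ℝ} (hd : 0 < d) :
    ∃ C : ℝ, 0 ≤ C ∧ ∀ g₁ g₂ : Test, g₁.SupportedIn d → g₂.SupportedIn d →
      ∀ (s : ℝ) (σ : N.SmoothFunctional), ‖T (diamondTest g₁ g₂ s) σ‖ ≤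
        C * (sobNorm d (m + 1) g₁ * sobNorm d (m + 1) g₂) * N.normFun ℓ σ.val := by
  obtain ⟨c, hc, h⟩ := hT (3 * d) (by linarith)
  set κ := max 1 d⁻¹ ^ (m + 1) with hκ
  refine ⟨c * (max 1 (3 * d) ^ m * (2 * (3 * d) * (κ * κ))), by positivity,
    fun g₁ g₂ h₁ h₂ s σ => (h _ (supportedIn_diamondTest hd h₁ h₂ s) σ).trans ?_⟩
  have hn := N.normFun_nonneg hℓ σ
  have hs1 := sobNorm_nonneg d (m + 1) g₁
  have hs2 := sobNorm_nonneg d (m + 1) g₂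
  have h3 := sobNorm_le_of_bound (f := diamondTest g₁ g₂ s) (d := 3 * d) (m := m)
    (B := (κ * sobNorm d (m + 1) g₁) * (κ * sobNorm d (m + 1) g₂)) (by linarith)
    (supportedIn_diamondTest hd h₁ h₂ s) (by positivity) fun k hk x =>
      norm_iterate_derivTest_diamondTest_le k g₁ g₂
        (fun i hi x => norm_iterate_derivTest_le hd (hi.trans hk) g₁ x)
        (fun i hi x => norm_iterate_derivTest_le hd (hi.trans hk) g₂ x) s x
  calc _ ≤ c * (max 1 (3 * d) ^ m * (2 * (3 * d) * (κ * sobNorm d (m + 1) g₁ *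
        (κ * sobNorm d (m + 1) g₂)))) * N.normFun ℓ σ.val := by gcongr
    _ = _ := by ring

/-- Apply the finite-order bound to the Taylor remainder of `s ↦ (g₁ ⋄ g₂)(s, · )`, whose Sobolev
norm is quadratically small. -/
theorem FieldBound.hasDerivAt {N : LocalNet n 𝓗} {ℓ : ℝ} (hℓ : 0 < ℓ) {m : ℕ}
    {T : Test →ₗ[ℂ] N.SmoothDual} (hT : N.FieldBound ℓ m T) (g₁ g₂ : Test)
    (σ : N.SmoothFunctional) (s : ℝ) :
    HasDerivAt (fun s => T (diamondTest g₁ g₂ s) σ)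
      (T (diamondTest (derivTest g₁) g₂ s) σ + T (diamondTest g₁ (derivTest g₂) s) σ) s := by
  obtain ⟨d₁, hd₁, h₁⟩ := g₁.exists_supportedIn
  obtain ⟨d₂, hd₂, h₂⟩ := g₂.exists_supportedIn
  obtain ⟨d, hd, h₁, h₂⟩ : ∃ d, 0 < d ∧ g₁.SupportedIn d ∧ g₂.SupportedIn d :=
    ⟨max d₁ d₂, lt_max_of_lt_left hd₁, h₁.mono (le_max_left _ _), h₂.mono (le_max_right _ _)⟩
  obtain ⟨c, hc, h⟩ := hT (3 * d) (by linarith)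
  choose C hC hC' using fun k => exists_bound_diamondRem k g₁ g₂
  set B := ∑ k ∈ Finset.range (m + 1), C k with hB
  have hB0 : 0 ≤ B := Finset.sum_nonneg fun k _ => hC k
  have hn := N.normFun_nonneg hℓ σ
  refine hasDerivAt_of_norm_le_sq (C := c * (max 1 (3 * d) ^ m * (2 * (3 * d) * B)) * N.normFun ℓ σ.val)
    one_pos fun z _ => ?_
  have h3 := sobNorm_le_of_bound (f := diamondRem g₁ g₂ s z) (d := 3 * d) (m := m) (B := B * z ^ 2)
    (by linarith) (supportedIn_diamondRem hd h₁ h₂ s z) (by positivity) fun k hk x =>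
      (hC' k s z x).trans (by
        gcongr
        exact Finset.single_le_sum (f := C) (fun k _ => hC k) (by simp; omega))
  have h4 := h _ (supportedIn_diamondRem hd h₁ h₂ s z) σ
  have h5 : T (diamondRem g₁ g₂ s z) σ = T (diamondTest g₁ g₂ (s + z)) σ - T (diamondTest g₁ g₂ s) σ -
      z • (T (diamondTest (derivTest g₁) g₂ s) σ + T (diamondTest g₁ (derivTest g₂) s) σ) := by
    rw [diamondRem, map_sub, map_sub, map_smul, map_add]
    rfl
  rw [← h5, Real.norm_eq_abs, sq_abs]
  calc _ ≤ c * (max 1 (3 * d) ^ m * (2 * (3 * d) * (B * z ^ 2))) * N.normFun ℓ σ.val :=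
        h4.trans (by gcongr)
    _ = _ := by ring

theorem FieldBound.contDiff {N : LocalNet n 𝓗} {ℓ : ℝ} (hℓ : 0 < ℓ) {m : ℕ}
    {T : Test →ₗ[ℂ] N.SmoothDual} (hT : N.FieldBound ℓ m T) (g₁ g₂ : Test)
    (σ : N.SmoothFunctional) : ContDiff ℝ ∞ fun s => T (diamondTest g₁ g₂ s) σ := by
  rw [contDiff_infty]
  intro k
  induction k generalizing g₁ g₂ with
  | zero =>
    exact contDiff_zero.2 (continuous_iff_continuousAt.2 fun s => (hT.hasDerivAt hℓ g₁ g₂ σ s).continuousAt)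
  | succ k ih =>
    push_cast
    rw [contDiff_succ_iff_deriv]
    refine ⟨fun s => (hT.hasDerivAt hℓ g₁ g₂ σ s).differentiableAt, by simp, ?_⟩
    rw [show deriv (fun s => T (diamondTest g₁ g₂ s) σ) = fun s =>
      T (diamondTest (derivTest g₁) g₂ s) σ + T (diamondTest g₁ (derivTest g₂) s) σ from
      funext fun s => (hT.hasDerivAt hℓ g₁ g₂ σ s).deriv]
    exact (ih _ _).add (ih _ _)

theorem diamond_integrand_eq_zero (T : Test →ₗ[ℂ] N.SmoothDual) {g₁ g₂ : Test} {d : ℝ}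
    (h₁ : g₁.SupportedIn d) (h₂ : g₂.SupportedIn d) {s : ℝ} (hs : d ≤ |s|) (σ : N.SmoothFunctional) :
    T (diamondTest g₁ g₂ s) σ = 0 := by
  rw [diamondTest_eq_zero_of_le h₁ h₂ hs, map_zero]
  rfl

/-- The variable `s` enters twice. With the functional frozen the dependence is differentiable; the
change of the functional is controlled by the Lipschitz estimate for translations. -/
theorem FieldBound.continuous_translate {N : LocalNet n 𝓗} {ℓ : ℝ} (hℓ : 0 < ℓ) {m : ℕ}
    {T : Test →ₗ[ℂ] N.SmoothDual} (hT : N.FieldBound ℓ m T) (g₁ g₂ : Test)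
    (σ : N.SmoothFunctional) : Continuous fun s => T (diamondTest g₁ g₂ s) (N.translate s σ) := by
  obtain ⟨d₁, hd₁, h₁⟩ := g₁.exists_supportedIn
  obtain ⟨d₂, hd₂, h₂⟩ := g₂.exists_supportedIn
  obtain ⟨d, hd, h₁, h₂⟩ : ∃ d, 0 < d ∧ g₁.SupportedIn d ∧ g₂.SupportedIn d :=
    ⟨max d₁ d₂, lt_max_of_lt_left hd₁, h₁.mono (le_max_left _ _), h₂.mono (le_max_right _ _)⟩
  obtain ⟨C, hC, h⟩ := hT.exists_diamond_bound hℓ hd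
  rw [continuous_iff_continuousAt]
  intro t
  set K := C * (sobNorm d (m + 1) g₁ * sobNorm d (m + 1) g₂)
  have hK : 0 ≤ K := mul_nonneg hC (mul_nonneg (sobNorm_nonneg _ _ _) (sobNorm_nonneg _ _ _))
  have h3 : Tendsto (fun s => T (diamondTest g₁ g₂ s) (N.translate s σ - N.translate t σ)) (𝓝 t) (𝓝 0) := by
    have h4 : Tendsto (fun s => K * (2 * |s - t| * N.normFun (ℓ + 1) σ.val)) (𝓝 t) (𝓝 0) := by
      have : Continuous fun s => K * (2 * |s - t| * N.normFun (ℓ + 1) σ.val) := by fun_prop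
      simpa using this.tendsto t
    refine squeeze_zero_norm (fun s => (h g₁ g₂ h₁ h₂ s _).trans ?_) h4
    refine mul_le_mul_of_nonneg_left ?_ hK
    rw [abs_sub_comm]
    exact N.normFun_translate_sub_translate_le hℓ _ _ σ
  have h5 := (hT.hasDerivAt hℓ g₁ g₂ (N.translate t σ) t).continuousAt.tendsto.add h3
  rw [add_zero] at h5
  refine h5.congr fun s => ?_
  rw [map_sub]
  ring

theorem FieldBound.integrable {N : LocalNet n 𝓗} {ℓ : ℝ} (hℓ : 0 < ℓ) {m : ℕ}
    {T : Test →ₗ[ℂ] N.SmoothDual} (hT : N.FieldBound ℓ m T) (g₁ g₂ : Test)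
    (σ : N.SmoothFunctional) : Integrable fun s => T (diamondTest g₁ g₂ s) (N.translate s σ) := by
  obtain ⟨d₁, hd₁, h₁⟩ := g₁.exists_supportedIn
  obtain ⟨d₂, hd₂, h₂⟩ := g₂.exists_supportedIn
  obtain ⟨d, hd, h₁, h₂⟩ : ∃ d, 0 < d ∧ g₁.SupportedIn d ∧ g₂.SupportedIn d :=
    ⟨max d₁ d₂, lt_max_of_lt_left hd₁, h₁.mono (le_max_left _ _), h₂.mono (le_max_right _ _)⟩
  refine (hT.continuous_translate hℓ g₁ g₂ σ).integrable_of_hasCompactSupport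
    (HasCompactSupport.intro (isCompact_Icc (a := -d) (b := d)) fun s hs => ?_)
  rw [Set.mem_Icc, ← abs_le, not_le] at hs
  exact N.diamond_integrand_eq_zero T h₁ h₂ hs.le _

theorem FieldBound.exists_convolInt_bound {N : LocalNet n 𝓗} {ℓ : ℝ} (hℓ : 0 < ℓ) {m : ℕ}
    {T : Test →ₗ[ℂ] N.SmoothDual} (hT : N.FieldBound ℓ m T) {d : ℝ} (hd : 0 < d) :
    ∃ C : ℝ, 0 ≤ C ∧ ∀ g₁ g₂ : Test, g₁.SupportedIn d → g₂.SupportedIn d →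
      ∀ σ : N.SmoothFunctional, ‖N.convolInt T g₁ g₂ σ‖ ≤
        C * (sobNorm d (m + 1) g₁ * sobNorm d (m + 1) g₂) * N.normFun ℓ σ.val := by
  obtain ⟨C, hC, h⟩ := hT.exists_diamond_bound hℓ hd
  refine ⟨2 * d * C, by positivity, fun g₁ g₂ h₁ h₂ σ => ?_⟩
  set K := C * (sobNorm d (m + 1) g₁ * sobNorm d (m + 1) g₂) * N.normFun ℓ σ.val with hKdef
  have hK : 0 ≤ K := by
    have := sobNorm_nonneg d (m + 1) g₁
    have := sobNorm_nonneg d (m + 1) g₂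
    have := N.normFun_nonneg hℓ σ
    positivity
  have h1 : N.convolInt T g₁ g₂ σ = ∫ s in Set.Icc (-d) d, T (diamondTest g₁ g₂ s) (N.translate s σ) := by
    rw [setIntegral_eq_integral_of_forall_compl_eq_zero]
    · rfl
    intro s hs
    rw [Set.mem_Icc, ← abs_le, not_le] at hs
    exact N.diamond_integrand_eq_zero T h₁ h₂ hs.le _
  rw [h1]
  refine (norm_setIntegral_le_of_norm_le_const (C := K) (by simp) fun s _ => ?_).trans_eq ?_
  · refine (h g₁ g₂ h₁ h₂ s _).trans ?_
    refine mul_le_mul_of_nonneg_left (N.normFun_translate_le hℓ s σ) ?_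
    exact mul_nonneg hC (mul_nonneg (sobNorm_nonneg _ _ _) (sobNorm_nonneg _ _ _))
  · rw [Measure.real, Real.volume_Icc, ENNReal.toReal_ofReal (by linarith), hKdef]
    ring

theorem FieldBound.convolInt_add {N : LocalNet n 𝓗} {ℓ : ℝ} (hℓ : 0 < ℓ) {m : ℕ}
    {T : Test →ₗ[ℂ] N.SmoothDual} (hT : N.FieldBound ℓ m T) (g₁ g₂ : Test) (σ τ : N.SmoothFunctional) :
    N.convolInt T g₁ g₂ (σ + τ) = N.convolInt T g₁ g₂ σ + N.convolInt T g₁ g₂ τ := by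
  unfold convolInt
  rw [← integral_add (hT.integrable hℓ _ _ _) (hT.integrable hℓ _ _ _)]
  simp only [translate_add, map_add]

theorem convolInt_smul (T : Test →ₗ[ℂ] N.SmoothDual) (g₁ g₂ : Test) (c : ℂ) (σ : N.SmoothFunctional) :
    N.convolInt T g₁ g₂ (c • σ) = c * N.convolInt T g₁ g₂ σ := by
  unfold convolInt
  rw [← integral_const_mul]
  simp only [translate_smul, map_smul, smul_eq_mul]

theorem FieldBound.convolInt_sub {N : LocalNet n 𝓗} {ℓ ℓ' : ℝ} (hℓ : 0 < ℓ) (hℓ' : 0 < ℓ') {m m' : ℕ}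
    {T T' : Test →ₗ[ℂ] N.SmoothDual} (hT : N.FieldBound ℓ m T) (hT' : N.FieldBound ℓ' m' T')
    (g₁ g₂ : Test) (σ : N.SmoothFunctional) :
    N.convolInt (T - T') g₁ g₂ σ = N.convolInt T g₁ g₂ σ - N.convolInt T' g₁ g₂ σ := by
  unfold convolInt
  rw [← integral_sub (hT.integrable hℓ _ _ _) (hT'.integrable hℓ' _ _ _)]
  rfl

theorem tendsto_normFun_sub_truncate {ℓ : ℝ} (hℓ : 0 < ℓ) (σ : N.SmoothFunctional) :
    Tendsto (fun E => N.normFun ℓ (σ - N.truncate E σ).val) atTop (𝓝 0) := by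
  have h1 : Tendsto (fun E : ℝ => 2 * (1 / (1 + E)) * N.normFun (ℓ + 1) σ.val) atTop (𝓝 0) := by
    have h2 : Tendsto (fun E : ℝ => 1 / (1 + E)) atTop (𝓝 0) := by
      simp only [one_div]
      exact tendsto_inv_atTop_zero.comp (tendsto_atTop_add_const_left _ 1 tendsto_id)
    simpa using (h2.const_mul 2).mul_const (N.normFun (ℓ + 1) σ.val)
  refine squeeze_zero' (Eventually.of_forall fun E => N.normFun_nonneg hℓ _) ?_ h1
  filter_upwards [eventually_gt_atTop 0] with E hE
  exact N.normFun_sub_truncate_le hℓ hE σ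

/-- The form defined by a distribution is determined by its values on energy-bounded functionals. -/
theorem FieldBound.tendsto_convolInt_truncate {N : LocalNet n 𝓗} {ℓ : ℝ} (hℓ : 0 < ℓ) {m : ℕ}
    {T : Test →ₗ[ℂ] N.SmoothDual} (hT : N.FieldBound ℓ m T) (g₁ g₂ : Test) (σ : N.SmoothFunctional) :
    Tendsto (fun E => N.convolInt T g₁ g₂ (N.truncate E σ)) atTop (𝓝 (N.convolInt T g₁ g₂ σ)) := by
  obtain ⟨d₁, hd₁, h₁⟩ := g₁.exists_supportedIn
  obtain ⟨d₂, hd₂, h₂⟩ := g₂.exists_supportedIn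
  obtain ⟨d, hd, h₁, h₂⟩ : ∃ d, 0 < d ∧ g₁.SupportedIn d ∧ g₂.SupportedIn d :=
    ⟨max d₁ d₂, lt_max_of_lt_left hd₁, h₁.mono (le_max_left _ _), h₂.mono (le_max_right _ _)⟩
  obtain ⟨C, hC, h⟩ := hT.exists_convolInt_bound hℓ hd
  have h3 : Tendsto (fun E => N.convolInt T g₁ g₂ (σ - N.truncate E σ)) atTop (𝓝 0) := by
    refine squeeze_zero_norm (fun E => h g₁ g₂ h₁ h₂ _) ?_
    simpa using (N.tendsto_normFun_sub_truncate hℓ σ).const_mul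
      (C * (sobNorm d (m + 1) g₁ * sobNorm d (m + 1) g₂))
  have h4 := (tendsto_const_nhds (x := N.convolInt T g₁ g₂ σ)).sub h3
  rw [sub_zero] at h4
  refine h4.congr fun E => ?_
  have := hT.convolInt_add hℓ g₁ g₂ (N.truncate E σ) (σ - N.truncate E σ)
  rw [add_sub_cancel] at this
  rw [this, add_sub_cancel_right]

theorem tendsto_truncate (φ : N.SmoothDual) (σ : N.SmoothFunctional) :
    Tendsto (fun E => φ (N.truncate E σ)) atTop (𝓝 (φ σ)) := by
  obtain ⟨k, hk, C, hC, h⟩ := N.exists_dualBound φ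
  have hk' : (0 : ℝ) < k := by exact_mod_cast hk
  have h3 : Tendsto (fun E => φ (σ - N.truncate E σ)) atTop (𝓝 0) := by
    refine squeeze_zero_norm (fun E => h _) ?_
    simpa using (N.tendsto_normFun_sub_truncate hk' σ).const_mul C
  have h4 := (tendsto_const_nhds (x := φ σ)).sub h3
  rw [sub_zero] at h4
  refine h4.congr fun E => ?_
  rw [map_sub, sub_sub_cancel]

end LocalNet

end QI

namespace QI

variable {n : ℕ} {𝓗 : Type*} [NormedAddCommGroup 𝓗] [InnerProductSpace ℂ 𝓗] [CompleteSpace 𝓗]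

/-! ### Uniform bounds, reflections and limits of nonnegative numbers -/

theorem exists_derivSum_diamondTest_le (L : ℕ) {d : ℝ} (hd : 0 < d) {g₁ g₂ : Test}
    (h₁ : g₁.SupportedIn d) (h₂ : g₂.SupportedIn d) :
    ∃ D : ℝ, 0 ≤ D ∧ ∀ s, derivSum L (diamondTest g₁ g₂ s) ≤ D := by
  set A := max 1 d⁻¹ ^ (L + 1) * sobNorm d (L + 1) g₁
  set B := max 1 d⁻¹ ^ (L + 1) * sobNorm d (L + 1) g₂
  have hA : 0 ≤ A := (norm_nonneg _).trans (norm_iterate_derivTest_le hd (Nat.zero_le L) g₁ 0)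
  have hB : 0 ≤ B := (norm_nonneg _).trans (norm_iterate_derivTest_le hd (Nat.zero_le L) g₂ 0)
  refine ⟨(L + 1) * (2 * (3 * d) * (A * B)), by positivity, fun s => ?_⟩
  have h : ∀ k ∈ Finset.range (L + 1), ∫ x, ‖iteratedDeriv k (diamondTest g₁ g₂ s) x‖ ≤
      2 * (3 * d) * (A * B) := fun k hk => by
    have hk' : k ≤ L := by simp at hk; omega
    rw [iteratedDeriv_test]
    exact ((supportedIn_diamondTest hd h₁ h₂ s).iterate_derivTest k).integral_norm_le (by linarith)
      fun x => norm_iterate_derivTest_diamondTest_le k g₁ g₂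
        (fun i hi x => norm_iterate_derivTest_le hd (hi.trans hk') g₁ x)
        (fun i hi x => norm_iterate_derivTest_le hd (hi.trans hk') g₂ x) s x
  refine (Finset.sum_le_sum h).trans_eq ?_
  simp

/-- The test function `x ↦ conj (f (-x))`. -/
def reflectTest (f : Test) : Test where
  toFun x := conj (f (-x))
  contDiff' := Complex.conjCLE.contDiff.comp ((show ContDiff ℝ ∞ f from f.contDiff).comp contDiff_neg)
  hasCompactSupport' := (f.hasCompactSupport.comp_homeomorph (Homeomorph.neg ℝ)).comp_left
    (g := fun z : ℂ => conj z) (map_zero _)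
  tsupport_subset' := fun _ _ => trivial

theorem reflectTest_diamondTest (g : Test) (s : ℝ) :
    reflectTest (diamondTest (conjTest g) g s) = diamondTest (conjTest g) g s := by
  ext x
  change conj (conj (g (s + -x / 2)) * g (s - -x / 2)) = conj (g (s + x / 2)) * g (s - x / 2)
  rw [map_mul, Complex.conj_conj, mul_comm]
  congr 3 <;> ring_nf

theorem isClosed_nonneg_complex : IsClosed {z : ℂ | ∃ r : ℝ, 0 ≤ r ∧ z = r} := by
  have : {z : ℂ | ∃ r : ℝ, 0 ≤ r ∧ z = r} = {z | 0 ≤ z.re} ∩ {z | z.im = 0} := by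
    ext z
    constructor
    · rintro ⟨r, hr, rfl⟩
      exact ⟨by simpa, by simp⟩
    · rintro ⟨h1, h2⟩
      exact ⟨z.re, h1, Complex.ext rfl (by simpa using h2)⟩
  rw [this]
  exact (isClosed_le continuous_const Complex.continuous_re).inter
    (isClosed_eq Complex.continuous_im continuous_const)

namespace LocalNet

variable (N : LocalNet n 𝓗)

/-! ### Classically positive products -/

theorem norm_translate_val_le (s : ℝ) (σ : N.SmoothFunctional) :
    ‖(N.translate s σ).val‖ ≤ ‖σ.val‖ := by
  refine ContinuousLinearMap.opNorm_le_bound _ (norm_nonneg _) fun B => ?_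
  rw [translate_val]
  refine (σ.val.le_opNorm _).trans ?_
  gcongr
  have := norm_mul₃_le_of_le (B := B) (N.norm_timeU_le s)
    (show ‖star (N.timeU s)‖ ≤ 1 by rw [norm_star]; exact N.norm_timeU_le s)
  simpa using this

/-- The growth orders `a` of the kernel and `2k` of the two-point function add up. The functional
enters only through its ordinary norm, which translations do not increase, so the bound is uniform
in `s`. -/
theorem exists_product_bound (K : Kernel) {k : ℕ} {E : ℝ} (hE : 0 < E) {φ : N.SmoothDual}
    {M : 𝓗 →L[ℂ] 𝓗} (hM : N.IsFormOperator k φ M) : ∃ (L : ℕ) (C : ℝ), 0 ≤ C ∧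
      ∀ (σ : N.SmoothFunctional) (f : Test) (y : ℝ), 0 < y → y ≤ 1 →
        ‖∫ s' : ℝ, f s' * (K : ℂ → ℂ) (s' - y * Complex.I) *
          N.twoPointFn E σ (N.conjField φ) φ (s' - y * Complex.I)‖ ≤ C * ‖σ.val‖ * derivSum L f := by
  obtain ⟨a, A, hA, hA'⟩ := Kernel.exists_bound K
  obtain ⟨B, hB, hB'⟩ := N.norm_twoPointOp_le k hE M
  obtain ⟨C, hC, hC'⟩ := exists_boundary_bound (a + 2 * k)
  refine ⟨a + 2 * k + 1, C * (A * B * 2 ^ (2 * k)), by positivity, fun σ f y hy hy1 => ?_⟩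
  have hre : ∀ z : ℂ, (Complex.I * z / 2).re = -z.im / 2 := fun z => by simp
  have key := hC' (fun z => (K : ℂ → ℂ) z * σ.val (N.twoPointOp k E M (Complex.I * z / 2)))
    (A * B * 2 ^ (2 * k) * ‖σ.val‖) (by positivity)
    (fun z hz => by
      have h1 := N.differentiableAt_twoPointOp k hE M (w := Complex.I * z / 2) (by rw [hre]; linarith)
      have h2 : DifferentiableAt ℂ (fun z => N.twoPointOp k E M (Complex.I * z / 2)) z :=
        h1.comp (f := fun z : ℂ => Complex.I * z / 2) z (by fun_prop)
      exact (Kernel.differentiableAt K hz).mul (σ.val.differentiableAt.comp z h2))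
    (fun x y hy hy1 => by
      have h1 := hA' x y hy hy1
      have h2 : (Complex.I * ((x : ℂ) - y * Complex.I) / 2).re = y / 2 := by rw [hre]; simp
      have h3 := hB' (Complex.I * ((x : ℂ) - y * Complex.I) / 2) (by rw [h2]; linarith) (by rw [h2]; linarith)
      rw [h2] at h3
      rw [norm_mul]
      calc _ ≤ (A * y⁻¹ ^ a) * (‖σ.val‖ * (B * (y / 2)⁻¹ ^ (2 * k))) := by
            gcongr
            exact (σ.val.le_opNorm _).trans (by gcongr)
        _ = _ := by
            rw [inv_div, div_eq_mul_inv, mul_pow, pow_add]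
            ring)
    f f.contDiff f.hasCompactSupport y hy hy1
  have he : ∀ s' : ℝ, f s' * (K : ℂ → ℂ) (s' - y * Complex.I) *
      N.twoPointFn E σ (N.conjField φ) φ (s' - y * Complex.I) =
      f s' * ((K : ℂ → ℂ) (s' - y * Complex.I) *
        σ.val (N.twoPointOp k E M (Complex.I * (s' - y * Complex.I) / 2))) := fun s' => by
    rw [N.twoPointFn_eq hE hM σ (by simpa using hy), mul_assoc]
  simp only [he]
  refine key.trans_eq ?_
  ring

/-- The regularized product, translated and smeared with `g₁ ⋄ g₂`. -/
def regularized (K : Kernel) (φ : N.SmoothDual) (E : ℝ) (g₁ g₂ : Test) (σ : N.SmoothFunctional)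
    (y s : ℝ) : ℂ :=
  ∫ s' : ℝ, diamondTest g₁ g₂ s s' * (K : ℂ → ℂ) (s' - y * Complex.I) *
    N.twoPointFn E (N.translate s σ) (N.conjField φ) φ (s' - y * Complex.I)

/-- The dominating function for the limit `y → 0`: a constant on the interval outside which `ḡ ⋄ g`
vanishes. -/
theorem exists_regularized_bound (K : Kernel) (φ : N.SmoothDual) {E : ℝ} (hE : 0 < E) {d : ℝ}
    (hd : 0 < d) {g₁ g₂ : Test} (h₁ : g₁.SupportedIn d) (h₂ : g₂.SupportedIn d)
    (σ : N.SmoothFunctional) : ∃ C : ℝ, 0 ≤ C ∧ ∀ y s : ℝ, 0 < y → y ≤ 1 →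
      ‖N.regularized K φ E g₁ g₂ σ y s‖ ≤ (Set.Icc (-d) d).indicator (fun _ => C) s := by
  obtain ⟨k, hk, C₀, hC₀, hφ⟩ := N.exists_dualBound φ
  obtain ⟨M, hM⟩ := N.exists_isFormOperator (by exact_mod_cast hk) hC₀ hφ
  obtain ⟨L, C, hC, h⟩ := N.exists_product_bound K hE hM
  obtain ⟨D, hD, hD'⟩ := exists_derivSum_diamondTest_le L hd h₁ h₂
  refine ⟨C * ‖σ.val‖ * D, by positivity, fun y s hy hy1 => ?_⟩
  by_cases hs : s ∈ Set.Icc (-d) d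
  · rw [Set.indicator_of_mem hs]
    refine (h (N.translate s σ) _ y hy hy1).trans ?_
    have := N.norm_translate_val_le s σ
    exact mul_le_mul (mul_le_mul_of_nonneg_left this hC) (hD' s) (derivSum_nonneg _ _) (by positivity)
  · rw [Set.indicator_of_notMem hs, regularized]
    rw [Set.mem_Icc, ← abs_le, not_le] at hs
    simp [diamondTest_eq_zero h₁ h₂ (Or.inl hs.le)]

/-- Once the two-point function is an inner product of continuous vectors, the integrand is jointly
continuous, which gives measurability, and the Schur product gives positivity. -/
theorem regularized_vecSmooth {K : Kernel} (hK : PositiveType K) (φ : N.SmoothDual) {E : ℝ}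
    (hE : 0 < E) (g : Test) (u : N.smoothVectors) (hu : N.energyProj E (u : 𝓗) = u) {y : ℝ}
    (hy : 0 < y) (hy1 : y < 1) :
    StronglyMeasurable (N.regularized K φ E (conjTest g) g (N.vecSmooth u u) y) ∧
    ∃ r : ℝ, 0 ≤ r ∧ ∫ s, N.regularized K φ E (conjTest g) g (N.vecSmooth u u) y s = r := by
  obtain ⟨k, hk, C₀, hC₀, hφ⟩ := N.exists_dualBound φ
  obtain ⟨M, hM⟩ := N.exists_isFormOperator (by exact_mod_cast hk) hC₀ hφ
  have h1 : N.regularized K φ E (conjTest g) g (N.vecSmooth u u) y = fun s => ∫ s' : ℝ,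
      diamondTest (conjTest g) g s s' * (K : ℂ → ℂ) (s' - y * Complex.I) *
        ⟪N.fieldVector k E M u y (s + s' / 2), N.fieldVector k E M u y (s - s' / 2)⟫_ℂ := by
    funext s
    simp only [regularized, N.twoPointFn_translate_vecSmooth hE hM u hu hy]
  have hΨ := N.continuous_fieldVector k E M u y
  rw [h1]
  refine ⟨StronglyMeasurable.integral_prod_right (Continuous.stronglyMeasurable ?_),
    hK.integral_diamond_nonneg hy hy1 hΨ g⟩
  have hg := g.continuous
  have h2 : Continuous fun x : ℝ × ℝ => diamondTest (conjTest g) g x.1 x.2 := by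
    change Continuous fun x : ℝ × ℝ => conj (g (x.1 + x.2 / 2)) * g (x.1 - x.2 / 2)
    fun_prop
  have h3 := (Kernel.continuous_line K hy).comp (continuous_snd : Continuous (Prod.snd : ℝ × ℝ → ℝ))
  exact (h2.mul h3).mul ((hΨ.comp (by fun_prop : Continuous fun x : ℝ × ℝ => x.1 + x.2 / 2)).inner
    (hΨ.comp (by fun_prop : Continuous fun x : ℝ × ℝ => x.1 - x.2 / 2)))

section PositiveProduct

variable {q : ℕ} {K : Fin q → Kernel} {φ : Fin q → N.SmoothDual} {P : N.Products}
  {T : Test →ₗ[ℂ] N.SmoothDual}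

theorem convolInt_nonneg_of_energyProj (hK : ∀ j, PositiveType (K j))
    (hP : P = ∑ j, K j ⊗ₜ[ℂ] (N.conjField (φ j) ⊗ₜ[ℂ] φ j)) (hT : N.IsProductDistribution P T)
    {E : ℝ} (hE : 0 < E) (u : N.smoothVectors) (hu : N.energyProj E (u : 𝓗) = u) (g : Test) :
    ∃ r : ℝ, 0 ≤ r ∧ N.convolInt T (conjTest g) g (N.vecSmooth u u) = r := by
  obtain ⟨d, hd, hg⟩ := g.exists_supportedIn
  set σ := N.vecSmooth u u with hσ
  have hσE : N.truncate E σ = σ := by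
    rw [hσ, N.truncate_vecSmooth E u u (by rw [hu]; exact u.2) (by rw [hu]; exact u.2)]
    congr 1 <;> exact Subtype.ext hu
  choose C hC hC' using fun j => N.exists_regularized_bound (K j) (φ j) hE hd hg.conjTest hg σ
  have hint : ∀ y, 0 < y → y < 1 → ∀ j, Integrable (N.regularized (K j) (φ j) E (conjTest g) g σ y) :=
    fun y hy hy1 j => Integrable.mono' (g := (Set.Icc (-d) d).indicator fun _ => C j)
      ((integrableOn_const (by simp)).integrable_indicator measurableSet_Icc)
      (N.regularized_vecSmooth (hK j) (φ j) hE g u hu hy hy1).1.aestronglyMeasurable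
      (Eventually.of_forall fun s => hC' j y s hy hy1.le)
  have hIoo : Set.Ioo (0 : ℝ) 1 ∈ 𝓝[>] (0 : ℝ) := Ioo_mem_nhdsGT one_pos
  have hlim := tendsto_integral_filter_of_dominated_convergence (μ := volume) (l := 𝓝[>] (0 : ℝ))
    (F := fun y s => ∑ j, N.regularized (K j) (φ j) E (conjTest g) g σ y s)
    (f := fun s => T (diamondTest (conjTest g) g s) (N.translate s σ))
    (fun s => ∑ j, (Set.Icc (-d) d).indicator (fun _ => C j) s)
    (by
      filter_upwards [hIoo] with y hy
      exact (integrable_finsetSum _ fun j _ => hint y hy.1 hy.2 j).aestronglyMeasurable)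
    (by
      filter_upwards [hIoo] with y hy
      refine Eventually.of_forall fun s => (norm_sum_le _ _).trans (Finset.sum_le_sum fun j _ => ?_)
      exact hC' j y s hy.1 hy.2.le)
    (integrable_finsetSum _ fun j _ =>
      (integrableOn_const (by simp)).integrable_indicator measurableSet_Icc)
    (Eventually.of_forall fun s => by
      -- The defining limit holds for every representation of `Π` as a sum, in particular for the
      -- one with kernels of positive type. Translation preserves the energy bound.
      refine hT.2 q K _ φ hP E hE (N.translate s σ) ?_ _
      rw [← hσE, ← truncate_translate]
      exact N.energyBounded_truncate E _)
  refine isClosed_nonneg_complex.mem_of_tendsto hlim ?_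
  filter_upwards [hIoo] with y hy
  choose r hr hr' using fun j => (N.regularized_vecSmooth (hK j) (φ j) hE g u hu hy.1 hy.2).2
  refine ⟨∑ j, r j, Finset.sum_nonneg fun j _ => hr j, ?_⟩
  rw [integral_finsetSum _ fun j _ => hint y hy.1 hy.2 j, Complex.ofReal_sum]
  exact Finset.sum_congr rfl fun j _ => hr' j

theorem convolInt_nonneg (hK : ∀ j, PositiveType (K j))
    (hP : P = ∑ j, K j ⊗ₜ[ℂ] (N.conjField (φ j) ⊗ₜ[ℂ] φ j)) (hT : N.IsProductDistribution P T)
    (u : N.smoothVectors) (g : Test) :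
    ∃ r : ℝ, 0 ≤ r ∧ N.convolInt T (conjTest g) g (N.vecSmooth u u) = r := by
  obtain ⟨ℓ, hℓ, m, hb⟩ := hT.1.fieldBound
  refine isClosed_nonneg_complex.mem_of_tendsto
    (hb.tendsto_convolInt_truncate hℓ (conjTest g) g (N.vecSmooth u u)) ?_
  filter_upwards [eventually_gt_atTop 0] with E hE
  have hu := N.energyProj_mem_smoothVectors hE (u : 𝓗)
  rw [N.truncate_vecSmooth E u u hu hu]
  exact N.convolInt_nonneg_of_energyProj hK hP hT hE ⟨_, hu⟩
    (congrArg (fun B : 𝓗 →L[ℂ] 𝓗 => B u) (N.energyProj_mul_self E)) g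

/-! ### Hermiticity of classically positive products -/

theorem twoPointFn_conj {k : ℕ} {E : ℝ} (hE : 0 < E) {φ : N.SmoothDual} {M : 𝓗 →L[ℂ] 𝓗}
    (hM : N.IsFormOperator k φ M) (σ : N.SmoothFunctional) {y : ℝ} (hy : 0 < y) (x : ℝ) :
    conj (N.twoPointFn E σ (N.conjField φ) φ (x - y * Complex.I)) =
      N.twoPointFn E (N.conjSmooth σ) (N.conjField φ) φ ((-x : ℝ) - y * Complex.I) := by
  rw [N.twoPointFn_eq hE hM _ (by simpa using hy), N.twoPointFn_eq hE hM _ (by simpa using hy),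
    conjSmooth_val, star_twoPointOp]
  congr 4
  simp only [map_mul, map_div₀, Complex.conj_I, map_sub, Complex.conj_ofReal, map_ofNat]
  push_cast
  ring

/-- Complex conjugation reflects `x - iy` to `-x - iy` both in a kernel of positive type and, with
`σ` replaced by `σ*`, in the two-point function of `φ* ⊗ φ`. Energy-bounded functionals suffice by
approximation. -/
theorem conj_productDistribution (hK : ∀ j, PositiveType (K j))
    (hP : P = ∑ j, K j ⊗ₜ[ℂ] (N.conjField (φ j) ⊗ₜ[ℂ] φ j)) (hT : N.IsProductDistribution P T)
    (f : Test) : N.conjField (T f) = T (reflectTest f) := by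
  have hE : ∀ E, 0 < E → ∀ σ : N.SmoothFunctional, N.EnergyBounded E σ →
      N.EnergyBounded E (N.conjSmooth σ) → conj (T f (N.conjSmooth σ)) = T (reflectTest f) σ := by
    intro E hE σ hσ hσ'
    have h1 := (Complex.continuous_conj.tendsto _).comp (hT.2 q K _ φ hP E hE _ hσ' f)
    refine tendsto_nhds_unique h1 ((hT.2 q K _ φ hP E hE _ hσ (reflectTest f)).congr' ?_)
    filter_upwards [Ioo_mem_nhdsGT one_pos] with y hy
    simp only [Function.comp_apply, map_sum]
    refine Finset.sum_congr rfl fun j _ => ?_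
    obtain ⟨k, hk, C₀, hC₀, hφ⟩ := N.exists_dualBound (φ j)
    obtain ⟨M, hM⟩ := N.exists_isFormOperator (by exact_mod_cast hk) hC₀ hφ
    rw [← integral_conj, ← integral_neg_eq_self]
    refine integral_congr_ae (Eventually.of_forall fun s' => ?_)
    simp only [map_mul]
    rw [N.twoPointFn_conj hE hM _ hy.1, (hK j).conj_eq hy.1 hy.2, conjSmooth_conjSmooth]
    change conj (f (-(-s'))) * _ * _ = _
    rw [neg_neg]
  refine ContinuousLinearMap.ext fun σ => ?_
  refine tendsto_nhds_unique (N.tendsto_truncate _ σ) ((N.tendsto_truncate _ σ).congr' ?_)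
  filter_upwards [eventually_gt_atTop 0] with E hE0
  rw [conjField_apply]
  refine (hE E hE0 _ (N.energyBounded_truncate E σ) ?_).symm
  rw [conjSmooth_truncate]
  exact N.energyBounded_truncate E _

end PositiveProduct

end LocalNet

end QI

namespace QI

variable {n : ℕ} {𝓗 : Type*} [NormedAddCommGroup 𝓗] [InnerProductSpace ℂ 𝓗] [CompleteSpace 𝓗]

/-- Where `f` does not vanish, `s` is the midpoint of points of the two supports. These midpoints
form a compact subset of the open interval, whereas vanishing for `|s| ≥ d` alone would only give
the closed one. -/
theorem supportedIn_of_diamond {d : ℝ} {g₁ g₂ : Test} (h₁ : g₁.SupportedIn d) (h₂ : g₂.SupportedIn d)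
    (f : Test) (hf : ∀ s, diamondTest g₁ g₂ s = 0 → f s = 0) : f.SupportedIn d := by
  have hK : IsCompact ((fun x : ℝ × ℝ => (x.1 + x.2) / 2) '' (tsupport g₁ ×ˢ tsupport g₂)) :=
    (IsCompact.prod g₁.hasCompactSupport g₂.hasCompactSupport).image (by fun_prop)
  have h : tsupport f ⊆ (fun x : ℝ × ℝ => (x.1 + x.2) / 2) '' (tsupport g₁ ×ˢ tsupport g₂) := by
    refine closure_minimal (fun s hs => ?_) hK.isClosed
    have hne : ∃ x, diamondTest g₁ g₂ s x ≠ 0 := by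
      by_contra hh
      push Not at hh
      exact hs (hf s (TestFunction.ext hh))
    obtain ⟨x, hx⟩ := hne
    rw [diamondTest_apply] at hx
    refine ⟨(s + x / 2, s - x / 2), ⟨subset_tsupport _ (left_ne_zero_of_mul hx),
      subset_tsupport _ (right_ne_zero_of_mul hx)⟩, ?_⟩
    simp
  refine h.trans ?_
  rintro _ ⟨⟨a, b⟩, ⟨ha, hb⟩, rfl⟩
  have ha' := h₁ ha
  have hb' := h₂ hb
  simp only [Set.mem_Ioo] at ha' hb' ⊢
  constructor <;> linarith

theorem exists_eq_sum_of_finiteDimensional_range {E : Type*} [AddCommGroup E] [Module ℂ E]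
    [TopologicalSpace E] [IsTopologicalAddGroup E] [ContinuousSMul ℂ E] [T2Space E] (p : E →L[ℂ] E)
    (hp : FiniteDimensional ℂ (LinearMap.range (p : E →ₗ[ℂ] E))) :
    ∃ (q : ℕ) (c : Fin q → E →L[ℂ] ℂ) (e : Fin q → E), ∀ x, p x = ∑ j, c j x • e j := by
  set V := LinearMap.range (p : E →ₗ[ℂ] E)
  let b := Module.finBasis ℂ V
  let pr : E →L[ℂ] V := p.codRestrict V fun x => LinearMap.mem_range_self _ x
  have hc : ∀ j, Continuous (b.coord j) := fun j => LinearMap.continuous_of_finiteDimensional _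
  refine ⟨_, fun j => (⟨b.coord j, hc j⟩ : V →L[ℂ] ℂ).comp pr, fun j => (b j : E), fun x => ?_⟩
  have h1 := congrArg Subtype.val (b.sum_repr (pr x))
  rw [Submodule.coe_sum] at h1
  exact h1.symm

namespace LocalNet

variable (N : LocalNet n 𝓗)

/-! ### Projectors of finite rank -/

/-- The continuous dual of a weak* dual consists of evaluations. -/
theorem exists_eq_eval (c : N.SmoothDual →L[ℂ] ℂ) : ∃ σ : N.SmoothFunctional, ∀ φ, c φ = φ σ := by
  obtain ⟨σ, hσ⟩ := LinearMap.dualEmbedding_surjective (topDualPairing ℂ N.SmoothFunctional) c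
  exact ⟨σ, fun φ => (congrArg (fun c : N.SmoothDual →L[ℂ] ℂ => c φ) hσ).symm⟩

theorem exists_eq_sum_eval (p : N.SmoothDual →L[ℂ] N.SmoothDual)
    (hp : FiniteDimensional ℂ (LinearMap.range (p : N.SmoothDual →ₗ[ℂ] N.SmoothDual))) :
    ∃ (q : ℕ) (σ : Fin q → N.SmoothFunctional) (φ : Fin q → N.SmoothDual),
      ∀ χ, p χ = ∑ j, χ (σ j) • φ j := by
  obtain ⟨q, c, φ, h⟩ := exists_eq_sum_of_finiteDimensional_range p hp
  choose σ hσ using fun j => N.exists_eq_eval (c j)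
  refine ⟨q, σ, φ, fun χ => ?_⟩
  rw [h]
  simp only [hσ]

theorem sum_field_apply {ι : Type*} (s : Finset ι) (φ : ι → N.SmoothDual) (σ : N.SmoothFunctional) :
    (∑ j ∈ s, φ j) σ = ∑ j ∈ s, φ j σ :=
  map_sum (AddMonoidHom.mk' (fun χ : N.SmoothDual => χ σ) fun _ _ => rfl) φ s

/-- In the finite-rank expansion the test function enters only through the scalars `T f (τ j)`, so
the order `m` persists, while the energy index is dictated by the fields `φ j`. -/
theorem FieldBound.exists_applyProj {N : LocalNet n 𝓗} {ℓ : ℝ} (hℓ : 0 < ℓ) {m : ℕ}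
    {T : Test →ₗ[ℂ] N.SmoothDual} (hT : N.FieldBound ℓ m T) (p : N.SmoothDual →L[ℂ] N.SmoothDual)
    (hp : FiniteDimensional ℂ (LinearMap.range (p : N.SmoothDual →ₗ[ℂ] N.SmoothDual))) :
    ∃ ℓ' > (0 : ℝ), N.FieldBound ℓ' m (N.applyProj p T) := by
  obtain ⟨q, τ, φ, h⟩ := N.exists_eq_sum_eval p hp
  choose k hk C hC hφ using fun j => N.exists_dualBound (φ j)
  -- The sum dominates every `k j`; the `1` keeps the index positive when the rank is zero.
  refine ⟨(1 + ∑ j, k j : ℕ), by positivity, fun d hd => ?_⟩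
  obtain ⟨c, hc, hc'⟩ := hT d hd
  have hn : ∀ j, 0 ≤ N.normFun ℓ (τ j).val := fun j => N.normFun_nonneg hℓ _
  refine ⟨∑ j, c * N.normFun ℓ (τ j).val * C j,
    Finset.sum_nonneg fun j _ => mul_nonneg (mul_nonneg hc (hn j)) (hC j), fun f hf σ => ?_⟩
  have h1 : N.applyProj p T f σ = ∑ j, T f (τ j) * φ j σ := by
    change p (T f) σ = _
    rw [h]
    exact N.sum_field_apply _ _ σ
  rw [h1, Finset.sum_mul, Finset.sum_mul]
  refine (norm_sum_le _ _).trans (Finset.sum_le_sum fun j _ => ?_)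
  have hkj : (0 : ℝ) < k j := by exact_mod_cast hk j
  have h2 : N.normFun (k j) σ.val ≤ N.normFun (1 + ∑ j, k j : ℕ) σ.val := by
    refine N.normFun_mono hkj ?_ σ
    have := Finset.single_le_sum (f := k) (fun _ _ => Nat.zero_le _) (Finset.mem_univ j)
    exact_mod_cast (by omega : k j ≤ 1 + ∑ j, k j)
  have h3 := N.normFun_nonneg hkj σ
  have h4 := sobNorm_nonneg d m f
  have h5 := hn j
  have h6 := hC j
  rw [norm_mul]
  calc _ ≤ (c * sobNorm d m f * N.normFun ℓ (τ j).val) * (C j * N.normFun (1 + ∑ j, k j : ℕ) σ.val) :=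
        mul_le_mul (hc' f hf _) ((hφ j σ).trans (mul_le_mul_of_nonneg_left h2 h6)) (norm_nonneg _)
          (by positivity)
    _ = _ := by ring

end LocalNet

end QI

namespace QI

variable {n : ℕ} {𝓗 : Type*} [NormedAddCommGroup 𝓗] [InnerProductSpace ℂ 𝓗] [CompleteSpace 𝓗]

namespace LocalNet

variable (N : LocalNet n 𝓗)

/-! ### The quantum inequality -/

/-- The properties of the distributions of classically positive products that are used below. -/
structure IsPositiveDistribution (T : Test →ₗ[ℂ] N.SmoothDual) : Prop where
  fieldBound : ∃ ℓ > (0 : ℝ), ∃ m : ℕ, N.FieldBound ℓ m T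
  conj_eq : ∀ (g : Test) (s : ℝ), N.conjField (T (diamondTest (conjTest g) g s)) =
    T (diamondTest (conjTest g) g s)
  nonneg : ∀ (u : N.smoothVectors) (g : Test),
    ∃ r : ℝ, 0 ≤ r ∧ N.convolInt T (conjTest g) g (N.vecSmooth u u) = r

/-- This covers the fallback value of `productDistribution`, so that no existence statement is
needed. -/
theorem isPositiveDistribution_zero : N.IsPositiveDistribution 0 where
  fieldBound := ⟨1, one_pos, 0, fun d hd => ⟨0, le_rfl, fun f _ σ => by
    change ‖(0 : ℂ)‖ ≤ _
    simp⟩⟩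
  conj_eq g s := ContinuousLinearMap.ext fun σ => map_zero (starRingEnd ℂ)
  nonneg u g := ⟨0, le_rfl, by
    unfold convolInt
    change ∫ s : ℝ, (0 : ℂ) = _
    simp⟩

theorem isPositiveDistribution_productDistribution {P : N.Products} (hP : P ∈ N.positiveProducts) :
    N.IsPositiveDistribution (N.productDistribution P) := by
  obtain ⟨q, K, φ, hK, -, hP⟩ := hP
  unfold productDistribution
  split_ifs with h
  · exact ⟨h.choose_spec.1.fieldBound,
      fun g s => (N.conj_productDistribution hK hP h.choose_spec _).trans
        (by rw [reflectTest_diamondTest]),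
      fun u g => N.convolInt_nonneg hK hP h.choose_spec u g⟩
  · exact N.isPositiveDistribution_zero

theorem convolInt_im_eq_zero {T : Test →ₗ[ℂ] N.SmoothDual} {g : Test}
    (hT : ∀ s, N.conjField (T (diamondTest (conjTest g) g s)) = T (diamondTest (conjTest g) g s))
    (u : N.smoothVectors) : (N.convolInt T (conjTest g) g (N.vecSmooth u u)).im = 0 := by
  rw [← Complex.conj_eq_iff_im]
  unfold convolInt
  rw [← integral_conj]
  refine integral_congr_ae (Eventually.of_forall fun s => ?_)
  have h := congrArg (fun χ : N.SmoothDual => χ (N.translate s (N.vecSmooth u u))) (hT s)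
  simp only [conjField_apply, conjSmooth_translate, conjSmooth_vecSmooth] at h
  exact h

/-- A bound that holds at each scale, and is `o(d^α)`, is attained by a positive function. -/
theorem exists_rate {α : ℝ} (V : ℝ → Set ℝ) (hV0 : ∀ d, ∀ C ∈ V d, 0 ≤ C)
    (hV : ∀ d, 0 < d → (V d).Nonempty) (hup : ∀ d, ∀ C ∈ V d, ∀ C', C ≤ C' → C' ∈ V d)
    (ho : ∀ c > (0 : ℝ), ∀ᶠ d : ℝ in 𝓝[>] 0, c * d ^ α ∈ V d) :
    ∃ ε : ℝ → ℝ, (∀ d, 0 < d → 0 < ε d) ∧ ε =o[𝓝[>] 0] (fun d : ℝ => d ^ α) ∧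
      ∀ d, 0 < d → ε d ∈ V d := by
  have h0 : ∀ d, 0 ≤ sInf (V d) := fun d => Real.sInf_nonneg (hV0 d)
  -- The infimum may be zero and need not be attained; the summand `d^(α+1)`, which is `o(d^α)`,
  -- repairs both.
  refine ⟨fun d => sInf (V d) + d ^ (α + 1), fun d hd => ?_, ?_, fun d hd => ?_⟩
  · have := h0 d
    have := Real.rpow_pos_of_pos hd (α + 1)
    positivity
  · rw [Asymptotics.isLittleO_iff]
    intro c hc
    filter_upwards [ho (c / 2) (by positivity), Ioo_mem_nhdsGT (show 0 < c / 2 by positivity)]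
      with d h1 hd
    have h2 : sInf (V d) ≤ c / 2 * d ^ α := csInf_le ⟨0, hV0 d⟩ h1
    have h3 : d ^ (α + 1) ≤ c / 2 * d ^ α := by
      rw [Real.rpow_add_one hd.1.ne', mul_comm]
      have := Real.rpow_nonneg hd.1.le α
      gcongr
      exact hd.2.le
    have h4 := Real.rpow_nonneg hd.1.le (α + 1)
    have h5 := Real.rpow_nonneg hd.1.le α
    rw [Real.norm_eq_abs, Real.norm_eq_abs, abs_of_nonneg (add_nonneg (h0 d) h4), abs_of_nonneg h5]
    linarith
  · obtain ⟨C, hC, hlt⟩ := exists_lt_of_csInf_lt (hV d hd)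
      (lt_add_of_pos_right (sInf (V d)) (Real.rpow_pos_of_pos hd (α + 1)))
    exact hup d C hC _ hlt.le

/-- An operator is bounded below if its expectation values in smooth vectors are. -/
theorem neg_smul_one_le {B : 𝓗 →L[ℂ] 𝓗} {c : ℝ}
    (h : ∀ v : N.smoothVectors, ∃ r : ℝ, -(c * ‖(v : 𝓗)‖ ^ 2) ≤ r ∧ ⟪(v : 𝓗), B v⟫_ℂ = r) :
    -(c • (1 : 𝓗 →L[ℂ] 𝓗)) ≤ B := by
  have key : ∀ x : 𝓗, ∃ r : ℝ, 0 ≤ r ∧ ⟪x, (B + c • (1 : 𝓗 →L[ℂ] 𝓗)) x⟫_ℂ = r := by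
    intro x
    have hcl : IsClosed {x : 𝓗 | ∃ r : ℝ, 0 ≤ r ∧ ⟪x, (B + c • (1 : 𝓗 →L[ℂ] 𝓗)) x⟫_ℂ = r} :=
      isClosed_nonneg_complex.preimage
        (f := fun x : 𝓗 => ⟪x, (B + c • (1 : 𝓗 →L[ℂ] 𝓗)) x⟫_ℂ) (by fun_prop)
    refine hcl.closure_subset_iff.2 (fun v hv => ?_) (N.dense_smoothVectors x)
    obtain ⟨r, hr, hr'⟩ := h ⟨v, hv⟩
    refine ⟨r + c * ‖v‖ ^ 2, by linarith, ?_⟩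
    have h1 : (B + c • (1 : 𝓗 →L[ℂ] 𝓗)) v = B v + (c : ℂ) • v := rfl
    rw [h1, inner_add_right, inner_smul_right, inner_self_eq_norm_sq_to_K]
    change ⟪v, B v⟫_ℂ = r at hr'
    rw [hr']
    push_cast
    rfl
  rw [ContinuousLinearMap.le_def, sub_neg_eq_add, ContinuousLinearMap.isPositive_iff_complex]
  intro x
  obtain ⟨r, hr, hr'⟩ := key x
  rw [← inner_conj_symm, hr']
  simpa using hr

theorem exists_test_of_diamond {T : Test →ₗ[ℂ] N.SmoothDual} {ℓ : ℝ} (hℓ : 0 < ℓ) {m : ℕ}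
    (hT : N.FieldBound ℓ m T) {g₁ g₂ : Test} {d : ℝ} (h₁ : g₁.SupportedIn d) (h₂ : g₂.SupportedIn d)
    (σ : N.SmoothFunctional) :
    ∃ f : Test, (∀ s, f s = T (diamondTest g₁ g₂ s) σ) ∧ f.SupportedIn d := by
  let f : Test :=
    { toFun := fun s => T (diamondTest g₁ g₂ s) σ
      contDiff' := hT.contDiff hℓ g₁ g₂ σ
      hasCompactSupport' := HasCompactSupport.intro (isCompact_Icc (a := -d) (b := d)) fun s hs => by
        rw [Set.mem_Icc, ← abs_le, not_le] at hs
        exact N.diamond_integrand_eq_zero T h₁ h₂ hs.le σ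
      tsupport_subset' := fun _ _ => trivial }
  refine ⟨f, fun s => rfl, supportedIn_of_diamond h₁ h₂ f fun s hs => ?_⟩
  change T (diamondTest g₁ g₂ s) σ = 0
  rw [hs, map_zero]
  rfl

/-- The coefficient functions are those of `p T` in the basis, so the smeared fields sum up to the
form already estimated. -/
theorem sum_smearedField_eq {T : Test →ₗ[ℂ] N.SmoothDual} {p : N.SmoothDual →L[ℂ] N.SmoothDual}
    {q : ℕ} {σ : Fin q → N.SmoothFunctional} {φ : Fin q → N.SmoothDual}
    (hp : ∀ χ, p χ = ∑ j, χ (σ j) • φ j) {g₁ g₂ : Test} {f : Fin q → Test}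
    (hf : ∀ j s, f j s = T (diamondTest g₁ g₂ s) (σ j)) (τ : N.SmoothFunctional) :
    ∑ j, N.smearedField (φ j) (f j) τ = N.convolInt (N.applyProj p T) g₁ g₂ τ := by
  unfold smearedField convolInt
  rw [← integral_finsetSum]
  · refine integral_congr_ae (Eventually.of_forall fun s => ?_)
    change _ = p (T (diamondTest g₁ g₂ s)) (N.translate s τ)
    rw [hp, sum_field_apply]
    refine Finset.sum_congr rfl fun j _ => ?_
    rw [hf]
    rfl
  · intro j _
    exact ((f j).continuous.mul (N.continuous_field_translate (φ j) τ)).integrable_of_hasCompactSupport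
      (f j).hasCompactSupport.mul_right

/-- Positivity of `Π` minus the error form. Vectors are written as `u = R^ℓ v`, since then `‖⟪u, ·
u⟫‖_ℓ ≤ ‖v‖²`. -/
theorem exists_lower_bound {α : ℝ} {P : N.Products} {p : N.SmoothDual →L[ℂ] N.SmoothDual}
    (hP : P ∈ N.positiveProducts) (hp : N.IsApproximating α P p) :
    ∃ (ℓ : ℝ) (m : ℕ) (ε : ℝ → ℝ), 0 < ℓ ∧ (∀ d, 0 < d → 0 < ε d) ∧
      ε =o[𝓝[>] 0] (fun d : ℝ => d ^ α) ∧
      N.FieldBound ℓ m (N.applyProj p (N.productDistribution P)) ∧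
      ∀ d : ℝ, 0 < d → ∀ g : Test, g.SupportedIn d → ∀ (u : N.smoothVectors) (v : 𝓗),
        N.Rpow ℓ v = u → ∃ r : ℝ, -(ε d * sobNorm d m g ^ 2 * ‖v‖ ^ 2) ≤ r ∧
          N.convolInt (N.applyProj p (N.productDistribution P)) (conjTest g) g (N.vecSmooth u u) = r := by
  set T := N.productDistribution P with hTdef
  have hT := N.isPositiveDistribution_productDistribution hP
  rw [← hTdef] at hT
  obtain ⟨-, hpc, hfin, -, ℓ₁, hℓ₁, m₁, happ⟩ := hp
  rw [← hTdef] at happ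
  obtain ⟨ℓ₂, hℓ₂, m₂, hb⟩ := hT.fieldBound
  obtain ⟨ℓ₃, hℓ₃, hb'⟩ := hb.exists_applyProj hℓ₂ p hfin
  set ℓ := max ℓ₁ (max ℓ₂ ℓ₃) with hℓdef
  have hℓ : 0 < ℓ := lt_max_of_lt_left hℓ₁
  -- The extra derivative pays for passing from `L¹` to supremum norms in the bounds at fixed `d`.
  set m := max m₁ (m₂ + 1) with hmdef
  have hb2 : N.FieldBound ℓ m₂ T := hb.mono hℓ₂ ((le_max_left _ _).trans (le_max_right _ _)) le_rfl
  have hb3 : N.FieldBound ℓ m₂ (N.applyProj p T) :=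
    hb'.mono hℓ₃ ((le_max_right _ _).trans (le_max_right _ _)) le_rfl
  let V : ℝ → Set ℝ := fun d => {C | 0 ≤ C ∧ ∀ g₁ g₂ : Test, g₁.SupportedIn d → g₂.SupportedIn d →
    ∀ σ : N.SmoothFunctional, ‖N.convolInt (T - N.applyProj p T) g₁ g₂ σ‖ ≤
      C * (sobNorm d m g₁ * sobNorm d m g₂) * N.normFun ℓ σ.val}
  have hmono : ∀ (d C : ℝ) (g₁ g₂ : Test) (σ : N.SmoothFunctional) (m' : ℕ) (ℓ' : ℝ), 0 ≤ C → m' ≤ m →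
      0 < ℓ' → ℓ' ≤ ℓ → C * (sobNorm d m' g₁ * sobNorm d m' g₂) * N.normFun ℓ' σ.val ≤
        C * (sobNorm d m g₁ * sobNorm d m g₂) * N.normFun ℓ σ.val := by
    intro d C g₁ g₂ σ m' ℓ' hC hm' hℓ' hℓℓ
    have e1 := sobNorm_mono (d := d) hm' g₁
    have e2 := sobNorm_mono (d := d) hm' g₂
    have e3 := N.normFun_mono hℓ' hℓℓ σ
    have e4 := sobNorm_nonneg d m' g₁
    have e5 := sobNorm_nonneg d m' g₂
    have e6 := N.normFun_nonneg hℓ' σ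
    exact mul_le_mul (mul_le_mul_of_nonneg_left (mul_le_mul e1 e2 e5 (e4.trans e1)) hC) e3 e6
      (mul_nonneg hC (mul_nonneg (e4.trans e1) (e5.trans e2)))
  -- Finite constants at every `d` come from the order of the distributions, the small ones near `0`
  -- from the approximation property.
  obtain ⟨ε, hε, hεo, hεV⟩ := exists_rate (α := α) V (fun d C hC => hC.1)
    (fun d hd => by
      obtain ⟨C, hC, h⟩ := (hb2.sub hb3).exists_convolInt_bound hℓ hd
      exact ⟨C, hC, fun g₁ g₂ h₁ h₂ σ => (h g₁ g₂ h₁ h₂ σ).trans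
        (hmono d C g₁ g₂ σ _ ℓ hC (le_max_right _ _) hℓ le_rfl)⟩)
    (fun d C hC C' hCC' => ⟨hC.1.trans hCC', fun g₁ g₂ h₁ h₂ σ => (hC.2 g₁ g₂ h₁ h₂ σ).trans (by
      have e4 := sobNorm_nonneg d m g₁
      have e5 := sobNorm_nonneg d m g₂
      have e6 := N.normFun_nonneg hℓ σ
      gcongr)⟩)
    (fun c hc => by
      filter_upwards [happ c hc, self_mem_nhdsWithin] with d hd hd0
      have hcd : 0 ≤ c * d ^ α := mul_nonneg hc.le (Real.rpow_nonneg (le_of_lt hd0) α)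
      exact ⟨hcd, fun g₁ g₂ h₁ h₂ σ => (hd g₁ g₂ h₁ h₂ σ).trans
        (hmono d _ g₁ g₂ σ m₁ ℓ₁ hcd (le_max_left _ _) hℓ₁ (le_max_left _ _))⟩)
  refine ⟨ℓ, m, ε, hℓ, hε, hεo, hb3.mono hℓ le_rfl (le_trans (by omega) (le_max_right _ _)),
    fun d hd g hg u v huv => ?_⟩
  obtain ⟨r₀, hr₀, h0⟩ := hT.nonneg u g
  have hsub := hb2.convolInt_sub hℓ hℓ hb3 (conjTest g) g (N.vecSmooth u u)
  have hS := (hεV d hd).2 (conjTest g) g hg.conjTest hg (N.vecSmooth u u)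
  rw [sobNorm_conjTest, ← sq] at hS
  have hn : N.normFun ℓ (N.vecSmooth u u).val ≤ ‖v‖ ^ 2 := by
    rw [sq]
    exact N.normFun_vecSmooth_le ℓ u u huv huv
  -- The form of `pΠ` is real because `p` commutes with conjugation and `Π((ḡ ⋄ g)(s, · ))` is
  -- hermitean.
  have him := N.convolInt_im_eq_zero (T := N.applyProj p T) (g := g) (fun s => by
    change N.conjField (p (T _)) = p (T _)
    rw [← hpc, hT.conj_eq]) u
  refine ⟨(N.convolInt (N.applyProj p T) (conjTest g) g (N.vecSmooth u u)).re, ?_,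
    Complex.ext rfl (by simpa using him)⟩
  have h1 : ‖N.convolInt (T - N.applyProj p T) (conjTest g) g (N.vecSmooth u u)‖ ≤
      ε d * sobNorm d m g ^ 2 * ‖v‖ ^ 2 := hS.trans (by
    have := (hε d hd).le
    gcongr)
  have h2 := (Complex.re_le_norm _).trans h1
  rw [hsub, h0, Complex.sub_re, Complex.ofReal_re] at h2
  linarith

theorem FieldBound.exists_isWeakProduct {N : LocalNet n 𝓗} {ℓ : ℝ} (hℓ : 0 < ℓ) {m : ℕ}
    {T : Test →ₗ[ℂ] N.SmoothDual} (hT : N.FieldBound ℓ m T) (g₁ g₂ : Test) :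
    ∃ B : 𝓗 →L[ℂ] 𝓗, N.IsWeakProduct (N.Rpow ℓ) (N.convolInt T g₁ g₂) (N.Rpow ℓ) B ∧
      ∀ x y : N.smoothVectors, ⟪(x : 𝓗), B y⟫_ℂ =
        N.convolInt T g₁ g₂ (N.vecSmooth (N.smoothRpow ℓ x) (N.smoothRpow ℓ y)) := by
  obtain ⟨d₁, hd₁, h₁⟩ := g₁.exists_supportedIn
  obtain ⟨d₂, hd₂, h₂⟩ := g₂.exists_supportedIn
  obtain ⟨d, hd, h₁, h₂⟩ : ∃ d, 0 < d ∧ g₁.SupportedIn d ∧ g₂.SupportedIn d :=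
    ⟨max d₁ d₂, lt_max_of_lt_left hd₁, h₁.mono (le_max_left _ _), h₂.mono (le_max_right _ _)⟩
  obtain ⟨C, hC, h⟩ := hT.exists_convolInt_bound hℓ hd
  obtain ⟨B, hB⟩ := N.exists_operator_of_dualBound ℓ (N.convolInt T g₁ g₂)
    (fun _ _ _ => hT.convolInt_add hℓ _ _ _ _) (fun _ _ _ => hT.convolInt_add hℓ _ _ _ _)
    (fun c _ _ => N.convolInt_smul T g₁ g₂ c _)
    (mul_nonneg hC (mul_nonneg (sobNorm_nonneg d (m + 1) g₁) (sobNorm_nonneg d (m + 1) g₂)))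
    (fun u v => h g₁ g₂ h₁ h₂ _)
  refine ⟨B, fun x y => ⟨by rw [star_Rpow]; exact N.Rpow_mem_smoothVectors ℓ x,
    N.Rpow_mem_smoothVectors ℓ y, (hB x y).trans ?_⟩, hB⟩
  congr 2
  exact Subtype.ext (congrArg (fun A : 𝓗 →L[ℂ] 𝓗 => A x) (N.star_Rpow ℓ).symm)

end LocalNet

end QI

end

/-- In the basis statement every smooth `u` is `R^ℓ v` for a unique smooth `v`, and `‖v‖²` is the
expectation value of `(1+H)^(2ℓ)` in `u`; this is how the unbounded right-hand side is expressed. -/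
theorem mainTheorem1 {n : ℕ} (hn : 2 ≤ n) {𝓗 : Type*} [NormedAddCommGroup 𝓗]
    [InnerProductSpace ℂ 𝓗] [CompleteSpace 𝓗] (N : QI.LocalNet n 𝓗)
    (hN : N.MicroscopicPhaseSpace) (P : N.Products) (hP : P ∈ N.positiveProducts)
    (α : ℝ) (hα : 0 ≤ α) (p : N.SmoothDual →L[ℂ] N.SmoothDual)
    (hp : N.IsApproximating α P p) :
    ∃ (ℓ : ℝ) (m : ℕ) (ε : ℝ → ℝ), 0 < ℓ ∧ (∀ d, 0 < d → 0 < ε d) ∧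
      ε =o[𝓝[>] 0] (fun d : ℝ => d ^ α) ∧
      ∀ d : ℝ, 0 < d → ∀ g : QI.Test, g.SupportedIn d →
        -- `R^ℓ I R^ℓ` is a bounded operator, bounded below
        (∃ B : 𝓗 →L[ℂ] 𝓗,
          N.IsWeakProduct (N.Rpow ℓ)
            (N.convolInt (N.applyProj p (N.productDistribution P)) (QI.conjTest g) g)
            (N.Rpow ℓ) B ∧
          -((ε d * QI.sobNorm d m g ^ 2) • (1 : 𝓗 →L[ℂ] 𝓗)) ≤ B) ∧
        -- in a basis: `∑ⱼ φⱼ(fⱼ) ≥ -ε(d) ‖g‖² (1+H)^(2ℓ)` as quadratic forms on smooth vectors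
        (∀ (q : ℕ) (σ : Fin q → N.SmoothFunctional) (φ : Fin q → N.SmoothDual),
          N.IsBasisOf p σ φ →
          ∃ f : Fin q → QI.Test,
            (∀ j s, f j s =
              N.productDistribution P (QI.diamondTest (QI.conjTest g) g s) (σ j)) ∧
            (∀ j s, (f j s).im = 0) ∧ (∀ j, (f j).SupportedIn d) ∧
            ∀ u v : N.smoothVectors, (u : 𝓗) = N.Rpow ℓ (v : 𝓗) →
              (∑ j, N.smearedField (φ j) (f j) (N.vecSmooth u u)).im = 0 ∧
              -(ε d * QI.sobNorm d m g ^ 2 * ‖(v : 𝓗)‖ ^ 2) ≤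
                (∑ j, N.smearedField (φ j) (f j) (N.vecSmooth u u)).re) := by
  obtain ⟨ℓ, m, ε, hℓ, hε, hεo, hb, h⟩ := N.exists_lower_bound hP hp
  refine ⟨ℓ, m, ε, hℓ, hε, hεo, fun d hd g hg => ⟨?_, fun q σ φ hbasis => ?_⟩⟩
  · obtain ⟨B, hB, hB'⟩ := hb.exists_isWeakProduct hℓ (QI.conjTest g) g
    refine ⟨B, hB, N.neg_smul_one_le fun v => ?_⟩
    rw [hB']
    exact h d hd g hg _ (v : 𝓗) rfl
  · obtain ⟨hσ, -, -, -, hpσ⟩ := hbasis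
    have hT := N.isPositiveDistribution_productDistribution hP
    obtain ⟨ℓ', hℓ', m', hb'⟩ := hT.fieldBound
    choose f hf hfd using fun j => N.exists_test_of_diamond hℓ' hb' hg.conjTest hg (σ j)
    refine ⟨f, hf, fun j s => ?_, hfd, fun u v huv => ?_⟩
    -- A hermitean field takes real values on the hermitean functional `σ j`.
    · rw [← Complex.conj_eq_iff_im, hf]
      have h1 := congrArg (fun χ : N.SmoothDual => χ (σ j)) (hT.conj_eq g s)
      simp only [QI.LocalNet.conjField_apply, hσ] at h1
      exact h1
    · rw [N.sum_smearedField_eq hpσ hf]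
      obtain ⟨r, hr, hr'⟩ := h d hd g hg u (v : 𝓗) huv.symm
      rw [hr']
      exact ⟨Complex.ofReal_im r, hr⟩
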